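/- **Setting.** Let $L_1,L_2,L_3\ge 0$ be integers with $L=L_1+L_2+L_3\ge 1$, let $x\in\mathbf C$ with $0<|x|<1$ (complex powers $x^a$ are taken with the principal branch of $\log x$), and let $\lambda_1,\lambda_2,\lambda_3\in\mathbf R$ with $\lambda_1+\lambda_2+\lambda_3=0$. Put $q_c=x^{2\lambda_c}$, $s_c=x^{\lambda_c}$, $\kappa_r=\prod_{c=1}^3(1-q_c^r)$, $[n]_x=\frac{x^n-x^{-n}}{x-x^{-1}}$, $b_c=-(s_c-s_c^{-1})/\kappa_1$, and assume that $q_1^lq_2^mq_3^n=1$ with $l,m,n\in\mathbf Z$ implies $l=m=n$. Let $\alpha\in\mathbf C$ be such that $\mu=x^{2\alpha}$ satisfies $\mu^m\ne1$ for all $m\ge1$. Choose colours $c_1,\dots,c_L\in\{1,2,3\}$ such that each colour $c$ occurs exactly $L_c$ times, and $u_1,\dots,u_L\in\mathbf C^\times$. Let $\mathcal F=\mathbf C[h^{(i)}_{-r}: 1\le i\le L,\ r\ge1]$ be the Fock space of $L$ commuting Heisenberg algebras with $[h^{(i)}_r,h^{(i)}_{-r}]=\frac{s_{c_i}^r-s_{c_i}^{-r}}{r\,\kappa_r}$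 for $r\ge1$, all other commutators being zero, and $h^{(i)}_r\cdot 1=0$ for $r\ge 1$. With $a_i=\prod_{j>i}s_{c_j}^{-1}$ put $$\psi_j(z)=\exp\Big(\sum_{r>0}\kappa_rh^{(j)}_r(s_{c_j}^{-1}a_jz)^{-r}\Big),$$ $$\Lambda_i(z)=u_i\exp\Big(\sum_{r>0}\tfrac{\kappa_r}{1-q_{c_i}^r}h^{(i)}_{-r}(a_iz)^r\Big)\exp\Big(\sum_{r>0}\tfrac{\kappa_r}{1-q_{c_i}^r}s_{c_i}^{r}h^{(i)}_{r}(a_iz)^{-r}\Big)\prod_{j>i}\psi_j(z),$$ $$\mathbf\Lambda_i(z)=\Lambda_i(z)\exp\Big(-\sum_{r>0}\tfrac{1}{1-\mu^r}\sum_{j=1}^L\kappa_rh^{(j)}_r(s_{c_j}^{-1}a_jz)^{-r}\Big),\qquad \mathbf T_1(z)=\sum_{i=1}^Lb_{c_i}\mathbf\Lambda_i(z),\qquad \mathbf T_0(z)=1.$$ For $i,j\ge1$ put $$g_{i,j}(z)=\exp\Big(\sum_{m\ge1}\tfrac1m\,\tfrac{[\lambda_1m]_x[\lambda_3m]_x[\min(i,j)\lambda_2m]_x[(\alpha-\max(i,j)\lambda_2)m]_x}{[\lambda_2m]_x[\alpha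 m]_x}(x-x^{-1})^2z^m\Big),$$ $$d_\lambda(z)=\frac{(1-x^{\lambda_1-\lambda_3}z)(1-x^{\lambda_3-\lambda_1}z)}{(1-x^{\lambda_2}z)(1-x^{-\lambda_2}z)},\qquad c_\lambda=\frac{[\lambda_1]_x[\lambda_3]_x}{[\lambda_2]_x}(x-x^{-1}).$$ A current is a series $A(z)=\sum_{m\in\mathbf Z}A[m]z^{-m}$ of linear operators on $\mathcal F$ such that every vector is killed by $A[m]$ for all large $m$. **Statement.** There is exactly one family of currents $(\mathbf T_i(z))_{i\ge0}$ with $\mathbf T_0,\mathbf T_1$ as above that satisfies, for all $i,j\ge1$ and both signs, the fusion relations $$\lim_{z_1\to x^{\pm(i+j)\lambda_2}z_2}\Big(1-\frac{x^{\pm(i+j)\lambda_2}z_2}{z_1}\Big)g_{i,j}\Big(\frac{z_2}{z_1}\Big)\mathbf T_i(z_1)\mathbf T_j(z_2)=\mp c_\lambda\prod_{l=1}^{\min(i,j)-1}d_\lambda\big(x^{(2l+1)\lambda_2}\big)\,\mathbf T_{i+j}\big(x^{\pm i\lambda_2}z_2\big),$$ where, for every power of $z_2$, each matrix element of the product on the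 left is the expansion at $z_2/z_1=0$ of a rational function of $z_2/z_1$, whose limit is taken. For this family: 1. If $L_1+L_3\ge1$, then $\mathbf T_i(z)\ne0$ for every $i\in\mathbf N$. 2. If $L_1=L_3=0$ (so $L_2=L$, the non-super case), then $\mathbf T_i(z)\neq0$ for $0\le i\le L_2$ and $\mathbf T_i(z)=0$ for $i\ge L_2+1$. -/

import Mathlib

open Filter Topology

namespace QY

/-! ## Exponentials of formal power series -/

/-- `exp (∑_{r > 0} a_r w ^ r)` as a formal power series in `w`, with coefficients in a possibly
noncommutative `ℂ`-algebra. As the exponent has no constant term, its `k`-th power contributes to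
the coefficient of `w ^ n` only for `k ≤ n`. -/
noncomputable def expSum {A : Type*} [Ring A] [Algebra ℂ A] (a : ℕ+ → A) : PowerSeries A :=
  PowerSeries.mk fun n => ∑ k ∈ Finset.range (n + 1), ((k.factorial : ℂ)⁻¹) •
    PowerSeries.coeff n
      ((PowerSeries.mk fun r : ℕ => if hr : 0 < r then a ⟨r, hr⟩ else 0) ^ k)

/-! ## The Fock space and the currents acting on it -/

/-- The underlying vector space of a tensor product of `L` Fock modules: polynomials in the
creation operators `h_{-r}` (`r ≥ 1`) of the tensor factors. -/
abbrev Fock (L : ℕ) : Type := MvPolynomial (Fin L × ℕ+) ℂ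

/-- The energy of a monomial, where the creation operator `h_{-r}` has energy `r`. -/
def energy {L : ℕ} (s : Fin L × ℕ+ →₀ ℕ) : ℤ := s.sum fun p k => (k : ℤ) * ((p.2 : ℕ) : ℤ)

/-- The vectors of energy at most `d`. -/
noncomputable def Fil (L : ℕ) (d : ℤ) : Submodule ℂ (Fock L) :=
  Submodule.span ℂ {v | ∃ s : Fin L × ℕ+ →₀ ℕ, energy s ≤ d ∧ v = MvPolynomial.monomial s 1}

/-- A current `A(z) = ∑_{m ∈ ℤ} A[m] z ^ (-m)`, given by its modes `A[m]`, linear operators on the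
Fock space such that every vector is killed by `A[m]` for all large `m`. -/
noncomputable def Current (L : ℕ) : Submodule ℂ (ℤ → Module.End ℂ (Fock L)) where
  carrier := {A | ∀ v : Fock L, ∃ K : ℤ, ∀ m : ℤ, K ≤ m → A m v = 0}
  zero_mem' := fun _ => ⟨0, fun _ _ => rfl⟩
  add_mem' := by
    intro A B hA hB v
    obtain ⟨K, hK⟩ := hA v
    obtain ⟨K', hK'⟩ := hB v
    refine ⟨max K K', fun m hm => ?_⟩
    simp [hK m (le_trans (le_max_left _ _) hm), hK' m (le_trans (le_max_right _ _) hm)]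
  smul_mem' := by
    intro c A hA v
    obtain ⟨K, hK⟩ := hA v
    exact ⟨K, fun m hm => by simp [hK m hm]⟩

/-- The identity operator, as a current that does not depend on `z`. -/
noncomputable def Current.id (L : ℕ) : Current L :=
  ⟨fun m => if m = 0 then 1 else 0, fun _ => ⟨1, fun m hm => by
    have : m ≠ 0 := by omega
    simp [this]⟩⟩

/-- The current `A(ρ z)`. -/
noncomputable def Current.rescale {L : ℕ} (ρ : ℂ) (A : Current L) : Current L :=
  ⟨fun m => ρ ^ (-m) • A.1 m, fun v => by
    obtain ⟨K, hK⟩ := A.2 v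
    exact ⟨K, fun m hm => by simp [hK m hm]⟩⟩

/-! ## Series of operators lowering the energy -/

/-- The coefficient of `w ^ n` lowers the energy by at least `n`. -/
def Lowering {L : ℕ} (S : PowerSeries (Module.End ℂ (Fock L))) : Prop :=
  ∀ (n : ℕ) (d : ℤ), ∀ v ∈ Fil L d, PowerSeries.coeff n S v ∈ Fil L (d - n)

theorem energy_nonneg {L : ℕ} (s : Fin L × ℕ+ →₀ ℕ) : 0 ≤ energy s :=
  Finset.sum_nonneg fun _ _ => by positivity

theorem Fil_neg {L : ℕ} {d : ℤ} (hd : d < 0) {v : Fock L} (hv : v ∈ Fil L d) : v = 0 := by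
  have : {v : Fock L | ∃ s : Fin L × ℕ+ →₀ ℕ, energy s ≤ d ∧
      v = MvPolynomial.monomial s 1} = ∅ := by
    ext w
    simp only [Set.mem_ofPred_eq, Set.mem_empty_iff_false, iff_false, not_exists, not_and]
    intro s hs
    have := energy_nonneg s
    omega
  rw [Fil, this, Submodule.span_empty] at hv
  exact (Submodule.mem_bot ℂ).1 hv

theorem Fil_mono {L : ℕ} {d e : ℤ} (h : d ≤ e) : Fil L d ≤ Fil L e :=
  Submodule.span_mono fun _ ⟨s, hs, hv⟩ => ⟨s, hs.trans h, hv⟩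

theorem exists_mem_Fil {L : ℕ} (v : Fock L) : ∃ d : ℤ, v ∈ Fil L d := by
  induction v using MvPolynomial.induction_on' with
  | monomial s a =>
    refine ⟨energy s, ?_⟩
    have : MvPolynomial.monomial s a = a • (MvPolynomial.monomial s (1 : ℂ)) := by
      simp [MvPolynomial.smul_monomial]
    rw [this]
    exact Submodule.smul_mem _ _ (Submodule.subset_span ⟨s, le_rfl, rfl⟩)
  | add p q hp hq =>
    obtain ⟨d, hd⟩ := hp
    obtain ⟨e, he⟩ := hq
    exact ⟨max d e, Submodule.add_mem _ (Fil_mono (le_max_left _ _) hd)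
      (Fil_mono (le_max_right _ _) he)⟩

theorem Lowering.one {L : ℕ} : Lowering (1 : PowerSeries (Module.End ℂ (Fock L))) := by
  intro n d v hv
  by_cases h : n = 0
  · subst h
    simpa using hv
  · rw [PowerSeries.coeff_one, if_neg h]
    exact Submodule.zero_mem _

theorem Lowering.mul {L : ℕ} {S T : PowerSeries (Module.End ℂ (Fock L))}
    (hS : Lowering S) (hT : Lowering T) : Lowering (S * T) := by
  intro n d v hv
  rw [PowerSeries.coeff_mul, LinearMap.sum_apply]
  refine Submodule.sum_mem _ fun p hp => ?_
  have h := hS p.1 _ _ (hT p.2 d v hv)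
  have hn : p.1 + p.2 = n := by simpa using hp
  have e : d - (p.2 : ℤ) - (p.1 : ℤ) = d - (n : ℤ) := by rw [← hn]; push_cast; ring
  rw [e] at h
  exact h

theorem Lowering.pow {L : ℕ} {S : PowerSeries (Module.End ℂ (Fock L))}
    (hS : Lowering S) (k : ℕ) : Lowering (S ^ k) := by
  induction k with
  | zero => simpa using Lowering.one
  | succ k ih => rw [pow_succ]; exact ih.mul hS

theorem Lowering.expSum {L : ℕ} {a : ℕ+ → Module.End ℂ (Fock L)}
    (ha : ∀ (r : ℕ+) (d : ℤ), ∀ v ∈ Fil L d, a r v ∈ Fil L (d - (r : ℕ))) :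
    Lowering (QY.expSum a) := by
  have h : Lowering (PowerSeries.mk fun r : ℕ => if hr : 0 < r then a ⟨r, hr⟩ else 0) := by
    intro n d v hv
    rw [PowerSeries.coeff_mk]
    split_ifs with hn
    · exact ha ⟨n, hn⟩ d v hv
    · exact Submodule.zero_mem _
  intro n d v hv
  rw [QY.expSum, PowerSeries.coeff_mk, LinearMap.sum_apply]
  exact Submodule.sum_mem _ fun k _ => Submodule.smul_mem _ _ (h.pow k n d v hv)

theorem pderiv_mem_Fil {L : ℕ} (i : Fin L) (r : ℕ+) (d : ℤ) (v : Fock L) (hv : v ∈ Fil L d) :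
    MvPolynomial.pderiv (i, r) v ∈ Fil L (d - (r : ℕ)) := by
  induction hv using Submodule.span_induction with
  | zero => simp
  | add x y _ _ hx hy => rw [map_add]; exact Submodule.add_mem _ hx hy
  | smul a x _ hx => rw [Derivation.map_smul]; exact Submodule.smul_mem _ _ hx
  | mem x hx =>
    obtain ⟨s, hs, rfl⟩ := hx
    rw [MvPolynomial.pderiv_monomial]
    by_cases h0 : s (i, r) = 0
    · simp [h0]
    · have hle : Finsupp.single (i, r) 1 ≤ s := by
        rw [Finsupp.single_le_iff]; omega
      have hE : energy s = energy (s - Finsupp.single (i, r) 1) + ((r : ℕ) : ℤ) := by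
        conv_lhs => rw [← tsub_add_cancel_of_le hle]
        unfold energy
        rw [Finsupp.sum_add_index' (by simp) (by intros; push_cast; ring)]
        simp
      have : MvPolynomial.monomial (s - Finsupp.single (i, r) 1) (1 * (s (i, r) : ℂ)) =
          (s (i, r) : ℂ) • MvPolynomial.monomial (s - Finsupp.single (i, r) 1) (1 : ℂ) := by
        simp [MvPolynomial.smul_monomial]
      rw [this]
      exact Submodule.smul_mem _ _ (Submodule.subset_span ⟨_, by omega, rfl⟩)

theorem Lowering.eventually_zero {L : ℕ} {S : PowerSeries (Module.End ℂ (Fock L))}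
    (hS : Lowering S) (v : Fock L) :
    ∃ K : ℕ, ∀ n : ℕ, K ≤ n → PowerSeries.coeff n S v = 0 := by
  obtain ⟨d, hd⟩ := exists_mem_Fil v
  refine ⟨d.toNat + 1, fun n hn => Fil_neg ?_ (hS n d v hd)⟩
  omega

/-! ## Normally ordered products -/

/-- The coefficient of `w ^ n` of a power series, zero for negative `n`. -/
noncomputable def coeffInt {A : Type*} [Semiring A] (n : ℤ) (S : PowerSeries A) : A :=
  if 0 ≤ n then PowerSeries.coeff n.toNat S else 0

/-- The current `N(z) M(z⁻¹)`, for a power series `N` of operators and a power series `M` of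
operators that lower the energy. Its mode `m`, the coefficient of `z ^ (-m)`, is
`∑_{a ≥ 0} N_a M_{m + a}`, a finite sum on every vector. -/
noncomputable def ordered {L : ℕ} (N M : PowerSeries (Module.End ℂ (Fock L)))
    (hM : Lowering M) : Current L :=
  have key : ∀ v : Fock L, ∃ K : ℤ, ∀ n : ℤ, K ≤ n → coeffInt n M v = 0 := fun v => by
    obtain ⟨K, hK⟩ := hM.eventually_zero v
    refine ⟨K, fun n hn => ?_⟩
    unfold coeffInt
    split_ifs with h
    · exact hK _ (by omega)
    · rfl
  have fin : ∀ (m : ℤ) (v : Fock L), (Function.support fun a : ℕ =>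
      PowerSeries.coeff a N (coeffInt (m + a) M v)).Finite := fun m v => by
    obtain ⟨K, hK⟩ := key v
    refine (Set.finite_lt_nat (K - m).toNat).subset fun a ha => ?_
    by_contra hlt
    simp only [Set.mem_ofPred_eq, not_lt] at hlt
    exact ha (by simp only [hK (m + a) (by omega), map_zero])
  ⟨fun m =>
    { toFun := fun v => ∑ᶠ a : ℕ, PowerSeries.coeff a N (coeffInt (m + a) M v)
      map_add' := fun v w => by
        rw [← finsum_add_distrib (fin m v) (fin m w)]
        exact finsum_congr fun a => by simp
      map_smul' := fun c v => by
        rw [RingHom.id_apply, smul_finsum' c (fin m v)]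
        exact finsum_congr fun a => by simp },
   fun v => by
    obtain ⟨K, hK⟩ := key v
    refine ⟨K, fun m hm => ?_⟩
    change ∑ᶠ a : ℕ, PowerSeries.coeff a N (coeffInt (m + a) M v) = 0
    rw [← finsum_zero (α := ℕ)]
    exact finsum_congr fun a => by rw [hK (m + a) (by omega), map_zero]⟩

/-! ## The data and the functions built from them -/

/-- The parameters: `x`, the numbers `lam c` (for the three colours `c`, numbered `0, 1, 2`), the
free parameter `alpha`, and the colours and spectral parameters of `L` Fock modules. -/
structure Data (L : ℕ) where
  x : ℂ
  lam : Fin 3 → ℝ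
  alpha : ℂ
  col : Fin L → Fin 3
  u : Fin L → ℂ

namespace Data

variable {L : ℕ} (D : Data L)

/-- `q_c = x ^ (2 λ_c)`. -/
noncomputable def q (c : Fin 3) : ℂ := D.x ^ (2 * (D.lam c : ℂ))

/-- `s_c = q_c ^ (1/2) = x ^ (λ_c)`. -/
noncomputable def s (c : Fin 3) : ℂ := D.x ^ (D.lam c : ℂ)

/-- `μ = x ^ (2 α)`. -/
noncomputable def mu : ℂ := D.x ^ (2 * D.alpha)

/-- `κ_r = ∏_c (1 - q_c ^ r)`. -/
noncomputable def kappa (r : ℕ) : ℂ := ∏ c, (1 - D.q c ^ r)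

/-- `[n]_x = (x ^ n - x ^ (-n)) / (x - x⁻¹)`. -/
noncomputable def qint (n : ℂ) : ℂ := (D.x ^ n - D.x ^ (-n)) / (D.x - D.x⁻¹)

/-- `b_c = - (s_c - s_c⁻¹) / κ_1`. -/
noncomputable def b (c : Fin 3) : ℂ := -(D.s c - (D.s c)⁻¹) / D.kappa 1

/-- `a_i = ∏_{j > i} s_{c_j}⁻¹`. -/
noncomputable def a (i : Fin L) : ℂ := ∏ j ∈ Finset.Ioi i, (D.s (D.col j))⁻¹

/-- `c_λ = [λ_1]_x [λ_3]_x / [λ_2]_x (x - x⁻¹)`. -/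
noncomputable def cLam : ℂ :=
  D.qint (D.lam 0) * D.qint (D.lam 2) / D.qint (D.lam 1) * (D.x - D.x⁻¹)

/-- `d_λ(z)`. -/
noncomputable def dLam (z : ℂ) : ℂ :=
  ((1 - D.x ^ ((D.lam 0 : ℂ) - D.lam 2) * z) * (1 - D.x ^ ((D.lam 2 : ℂ) - D.lam 0) * z)) /
    ((1 - D.x ^ (D.lam 1 : ℂ) * z) * (1 - D.x ^ (-(D.lam 1 : ℂ)) * z))

/-- The structure function `g_{i,j}(z)`, as a formal power series in `z`. -/
noncomputable def g (i j : ℕ) : PowerSeries ℂ :=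
  expSum fun m : ℕ+ => (1 / ((m : ℕ) : ℂ)) *
    (D.qint (D.lam 0 * (m : ℕ)) * D.qint (D.lam 2 * (m : ℕ)) *
      D.qint ((min i j : ℕ) * D.lam 1 * (m : ℕ)) *
      D.qint ((D.alpha - (max i j : ℕ) * D.lam 1) * (m : ℕ))) /
    (D.qint (D.lam 1 * (m : ℕ)) * D.qint (D.alpha * (m : ℕ))) * (D.x - D.x⁻¹) ^ 2

/-! ## Vertex operators -/

/-- The creation operator `h_{-r}` of the `i`-th tensor factor: multiplication by a variable. -/
noncomputable def hNeg (_ : Data L) (i : Fin L) (r : ℕ+) : Module.End ℂ (Fock L) :=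
  LinearMap.mulLeft ℂ (MvPolynomial.X (i, r))

/-- The annihilation operator `h_r` of the `i`-th tensor factor, for which
`[h_r, h_{-r}] = (C ^ r - C ^ (-r)) / (r κ_r)` with `C = s_{c_i}`. -/
noncomputable def hPos (i : Fin L) (r : ℕ+) : Module.End ℂ (Fock L) :=
  (((D.s (D.col i)) ^ (r : ℕ) - ((D.s (D.col i)) ^ (r : ℕ))⁻¹) /
      (((r : ℕ) : ℂ) * D.kappa r)) •
    (MvPolynomial.pderiv (i, r)).toLinearMap

/-- The exponent of `ψ^+(s_{c_j}⁻¹ a_j z)` in the `j`-th tensor factor: the coefficient of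
`z ^ (-r)` in `∑_{r > 0} κ_r h_r (s_{c_j}⁻¹ a_j z) ^ (-r)`. -/
noncomputable def psiExp (j : Fin L) (r : ℕ+) : Module.End ℂ (Fock L) :=
  (D.kappa r * (((D.s (D.col j))⁻¹ * D.a j) ^ (r : ℕ))⁻¹) • D.hPos j r

/-- The exponent of the creation part of `V_{c_i}(a_i z; u_i)`: the coefficient of `z ^ r`. -/
noncomputable def vNegExp (i : Fin L) (r : ℕ+) : Module.End ℂ (Fock L) :=
  (D.kappa r / (1 - D.q (D.col i) ^ (r : ℕ)) * D.a i ^ (r : ℕ)) • D.hNeg i r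

/-- The exponent of the annihilation part of `V_{c_i}(a_i z; u_i)`: the coefficient of
`z ^ (-r)`; here `q_c ^ (r/2) = s_c ^ r`. -/
noncomputable def vPosExp (i : Fin L) (r : ℕ+) : Module.End ℂ (Fock L) :=
  (D.kappa r / (1 - D.q (D.col i) ^ (r : ℕ)) * D.s (D.col i) ^ (r : ℕ) *
    (D.a i ^ (r : ℕ))⁻¹) • D.hPos i r

/-- The annihilation part, in powers of `w = z⁻¹`, of
`Λ_i(z) = 1 ⊗ ⋯ ⊗ 1 ⊗ V_{c_i}(a_i z; u_i) ⊗ ψ^+(s_{c_{i+1}}⁻¹ a_{i+1} z) ⊗ ⋯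
  ⊗ ψ^+(s_{c_L}⁻¹ a_L z)`. -/
noncomputable def lamPos (i : Fin L) : PowerSeries (Module.End ℂ (Fock L)) :=
  expSum fun r => D.vPosExp i r + ∑ j ∈ Finset.Ioi i, D.psiExp j r

/-- The creation part of `Λ_i(z)`, in powers of `z`. -/
noncomputable def lamNeg (i : Fin L) : PowerSeries (Module.End ℂ (Fock L)) :=
  expSum fun r => D.vNegExp i r

/-- The modes `H_r` in `K^+(z) = exp (∑_{r > 0} H_r z ^ (-r))`, acting on the tensor product of
the `L` Fock modules, where `K^+(z)` is `ψ^+(C⁻¹ z)`, with coproduct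
`ψ^+(s_{c_1}⁻¹ a_1 z) ⊗ ⋯ ⊗ ψ^+(s_{c_L}⁻¹ a_L z)`. -/
noncomputable def kExp (r : ℕ+) : Module.End ℂ (Fock L) := ∑ j, D.psiExp j r

/-- The inverse, in powers of `w = z⁻¹`, of
`K_μ^+(z) = ∏_{s ≥ 0} K^+(μ ^ (-s) z) = exp (∑_{r > 0} (∑_{s ≥ 0} μ ^ (r s)) H_r z ^ (-r))`,
the geometric series being summed to `1 / (1 - μ ^ r)`. -/
noncomputable def dressing : PowerSeries (Module.End ℂ (Fock L)) :=
  expSum fun r => -((1 - D.mu ^ (r : ℕ))⁻¹ • D.kExp r)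

theorem hPos_mem (i : Fin L) (r : ℕ+) (d : ℤ) (v : Fock L) (hv : v ∈ Fil L d) :
    D.hPos i r v ∈ Fil L (d - (r : ℕ)) :=
  Submodule.smul_mem _ _ (pderiv_mem_Fil i r d v hv)

theorem psiExp_mem (i : Fin L) (r : ℕ+) (d : ℤ) (v : Fock L) (hv : v ∈ Fil L d) :
    D.psiExp i r v ∈ Fil L (d - (r : ℕ)) :=
  Submodule.smul_mem _ _ (D.hPos_mem i r d v hv)

theorem dressed_lowering (i : Fin L) : Lowering (D.lamPos i * D.dressing) := by
  refine Lowering.mul (Lowering.expSum fun r d v hv => ?_) (Lowering.expSum fun r d v hv => ?_)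
  · rw [LinearMap.add_apply, LinearMap.sum_apply]
    exact Submodule.add_mem _ (Submodule.smul_mem _ _ (D.hPos_mem i r d v hv))
      (Submodule.sum_mem _ fun j _ => D.psiExp_mem j r d v hv)
  · rw [LinearMap.neg_apply, LinearMap.smul_apply, kExp, LinearMap.sum_apply]
    exact Submodule.neg_mem _ (Submodule.smul_mem _ _
      (Submodule.sum_mem _ fun j _ => D.psiExp_mem j r d v hv))

/-- The dressed current `𝚲_i(z) = Λ_i(z) K_μ^+(z)⁻¹`. -/
noncomputable def dressed (i : Fin L) : Current L :=
  D.u i • ordered (D.lamNeg i) (D.lamPos i * D.dressing) (D.dressed_lowering i)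

/-- The basic current `T_1(z) = ∑_i b_{c_i} 𝚲_i(z)`. -/
noncomputable def basic : Current L := ∑ i, D.b (D.col i) • D.dressed i

end Data

/-! ## Fusion -/

/-- `lim_{z₁ → p z₂} (1 - p z₂ / z₁) G(z₂ / z₁) A(z₁) B(z₂) = Y(z₂)`.

With `u = z₂ / z₁`, the coefficient of `z₂ ^ (-d)` in a matrix element of
`G(z₂ / z₁) A(z₁) B(z₂)` is a formal Laurent series in `u`: the expansion in the region
`|z₁| ≫ |z₂|`, that is, at `u = 0`. It is required to be the expansion of a rational function,
and the limit is the limit of that rational function, times `1 - p u`, as `u → p⁻¹`. -/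
def IsFusionLimit {L : ℕ} (G : PowerSeries ℂ) (p : ℂ) (A B Y : Current L) : Prop :=
  ∀ (v : Fock L) (t : Fin L × ℕ+ →₀ ℕ) (d : ℤ), ∃ f : RatFunc ℂ,
    (∀ M : ℤ, (f : LaurentSeries ℂ).coeff M =
      MvPolynomial.coeff t
        (∑ᶠ k : ℕ, PowerSeries.coeff k G • A.1 (M - k) (B.1 (d - M + k) v))) ∧
    Tendsto (fun u : ℂ => (1 - p * u) * f.eval (RingHom.id ℂ) u) (𝓝[≠] p⁻¹)
      (𝓝 (MvPolynomial.coeff t (Y.1 d v)))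

/-- The family of currents `T_i(z)`, `i ≥ 0`, is the family of higher currents: `T_0 = 1`, `T_1` is
the basic current, and all fusion relations hold. -/
structure IsHigherCurrents {L : ℕ} (D : Data L) (T : ℕ → Current L) : Prop where
  zero : T 0 = Current.id L
  one : T 1 = D.basic
  fusion_pos : ∀ i j : ℕ, 1 ≤ i → 1 ≤ j →
    IsFusionLimit (D.g i j) (D.x ^ (((i + j : ℕ) : ℂ) * D.lam 1)) (T i) (T j)
      ((-(D.cLam * ∏ l ∈ Finset.Icc 1 (min i j - 1),
          D.dLam (D.x ^ (((2 * l + 1 : ℕ) : ℂ) * D.lam 1)))) •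
        Current.rescale (D.x ^ ((i : ℂ) * D.lam 1)) (T (i + j)))
  fusion_neg : ∀ i j : ℕ, 1 ≤ i → 1 ≤ j →
    IsFusionLimit (D.g i j) (D.x ^ (-(((i + j : ℕ) : ℂ) * D.lam 1))) (T i) (T j)
      ((D.cLam * ∏ l ∈ Finset.Icc 1 (min i j - 1),
          D.dLam (D.x ^ (((2 * l + 1 : ℕ) : ℂ) * D.lam 1))) •
        Current.rescale (D.x ^ (-((i : ℂ) * D.lam 1))) (T (i + j)))

end QY

/-!
The currents are written down explicitly. All operators in question are vertex operators
`vert n m`: an exponential of creation operators times an exponential of annihilation operators.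
Two of them multiply to their normally ordered product times the exponential of a scalar
contraction (`vert_comp`). For the dressed currents `𝚲_i(z₁) 𝚲_j(z₂)` that scalar, multiplied by
`g_{1,1}`, is the expansion of a quotient `pairFn i j` of two quadratic polynomials in `z₂ / z₁`.
It has a pole at `z₁ = q_2 z₂` for `i ≤ j` alone, and the opposite order gives the mirrored pole.
Positions `s_2 ^ (n - 1) z`, `s_2 ^ (n - 3) z`, …, `s_2 ^ (1 - n) z` are thus those at which `n`
dressed currents fuse, and `higher n` is the sum over all tuples `K` of the normally ordered
products of the `𝚲_{K a}` at these positions, with the coefficient `coef K`: the product of the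
constants `b u` of the entries and of the values or residues of `pairFn` over all pairs,
normalized by `c_λ` and values of `d_λ`.

For the fusion relation, `isExpansion_tuple` identifies the product of two such terms, multiplied
by `g_{m,n}`, as the expansion of a product of `pairFn` factors and of factors `corrFn` which
measure the difference between `g_{m,n}` and a product of shifts of `g_{1,1}`. At most one factor
has a pole at the fusion point. The values at the other factors are those in the coefficient of
the concatenated tuple, and `prod_normal` accounts for the constants. Since `c_λ ≠ 0` and limits
are unique, fusion with `𝐓_1` determines `𝐓_{n+1}` from `𝐓_n`, whence uniqueness.

The vanishing is read off the coefficients. At distance `1` the weight of a pair `i, j` is zero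
for `j < i`, as there is no pole, and for `i = j` of the second colour, where a zero cancels the
pole. The weights of all other pairs are nonzero at every distance, since `q_2` is independent of
`q_1` and of `q_3`. Hence `coef K ≠ 0` forces `K` to be monotone, strictly so if all colours are
the second one; then no tuple is left for `n > L`. Otherwise some tuple contributes, namely a
constant one if another colour occurs and a strictly increasing one for `n ≤ L`. The contributing
terms cannot cancel (`sum_vert_ne_zero`): on the vacuum, modulo the `h_{-r}` with `r > 1`, they
are exponentials of linear forms in the `h_{-1}`. These forms are distinct because their
coefficients are sums over blocks of the positions, which determine a monotone tuple
(`tuple_ext`), and distinct exponentials are linearly independent by Dedekind's theorem.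

The three colours are numbered `0, 1, 2` in the code and `1, 2, 3` in the comments: `q_2`, `s_2`
and `λ_2` stand for `D.q 1`, `D.s 1` and `D.lam 1`, and the second colour is `1 : Fin 3`.
-/

namespace QY

/-! ### Exponentials of power series -/

section ExpSum

set_option linter.unusedSectionVars false

variable {A : Type*} [Ring A] [Algebra ℂ A]

/-- The exponent `∑_{r > 0} a_r w ^ r` as a power series. -/
noncomputable def posSeries (a : ℕ+ → A) : PowerSeries A :=
  PowerSeries.mk fun r : ℕ => if hr : 0 < r then a ⟨r, hr⟩ else 0

/-- The Euler operator `w d/dw` on power series over a possibly noncommutative algebra. -/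
noncomputable def euler (f : PowerSeries A) : PowerSeries A :=
  PowerSeries.mk fun n => (n : ℂ) • PowerSeries.coeff n f

@[simp] theorem coeff_euler (n : ℕ) (f : PowerSeries A) :
    PowerSeries.coeff n (euler f) = (n : ℂ) • PowerSeries.coeff n f := by
  simp [euler]

@[simp] theorem coeff_posSeries_zero (a : ℕ+ → A) : PowerSeries.coeff 0 (posSeries a) = 0 := by
  simp [posSeries]

theorem coeff_posSeries_pos (a : ℕ+ → A) (r : ℕ+) :
    PowerSeries.coeff (r : ℕ) (posSeries a) = a r := by
  rw [posSeries, PowerSeries.coeff_mk, dif_pos r.pos]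
  rfl

theorem posSeries_add (a b : ℕ+ → A) : posSeries (a + b) = posSeries a + posSeries b := by
  ext n
  simp only [posSeries, PowerSeries.coeff_mk, map_add]
  split_ifs
  · rfl
  · simp

theorem euler_add (f g : PowerSeries A) : euler (f + g) = euler f + euler g := by
  ext n
  simp [smul_add]

theorem euler_mul (f g : PowerSeries A) : euler (f * g) = euler f * g + f * euler g := by
  ext n
  simp only [coeff_euler, PowerSeries.coeff_mul, map_add, Finset.smul_sum]
  rw [← Finset.sum_add_distrib]
  refine Finset.sum_congr rfl fun p hp => ?_
  have h : p.1 + p.2 = n := by simpa using hp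
  rw [smul_mul_assoc, mul_smul_comm, ← add_smul, ← h]
  push_cast
  rfl

theorem euler_one : euler (1 : PowerSeries A) = 0 := by
  ext n
  rcases eq_or_ne n 0 with h | h <;> simp [PowerSeries.coeff_one, h]

theorem euler_pow_succ {f : PowerSeries A} (h : Commute f (euler f)) (k : ℕ) :
    euler (f ^ (k + 1)) = ((k + 1 : ℕ) : ℂ) • (euler f * f ^ k) := by
  induction k with
  | zero => simp
  | succ k ih =>
    rw [pow_succ, euler_mul, ih, (h.pow_left (k + 1)).eq, smul_mul_assoc, mul_assoc, ← pow_succ]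
    push_cast
    module

theorem coeff_pow_of_lt {f : PowerSeries A} (h : PowerSeries.coeff 0 f = 0) {n k : ℕ}
    (hn : n < k) : PowerSeries.coeff n (f ^ k) = 0 := by
  induction k generalizing n with
  | zero => omega
  | succ k ih =>
    rw [pow_succ, PowerSeries.coeff_mul]
    refine Finset.sum_eq_zero fun p hp => ?_
    have hp' : p.1 + p.2 = n := by simpa using hp
    rcases Nat.eq_zero_or_pos p.2 with h0 | h0
    · rw [h0, h, mul_zero]
    · rw [ih (by omega), zero_mul]

theorem coeff_expSum (a : ℕ+ → A) {n N : ℕ} (hN : n < N) :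
    PowerSeries.coeff n (expSum a) = ∑ k ∈ Finset.range N, ((k.factorial : ℂ)⁻¹) •
      PowerSeries.coeff n (posSeries a ^ k) := by
  rw [expSum, PowerSeries.coeff_mk]
  refine Finset.sum_subset (fun k hk => ?_) fun k _ hk => ?_
  · simp only [Finset.mem_range] at hk ⊢
    omega
  · simp only [Finset.mem_range, not_lt] at hk
    have : PowerSeries.coeff n (posSeries a ^ k) = 0 :=
      coeff_pow_of_lt (coeff_posSeries_zero a) (by omega)
    change (k.factorial : ℂ)⁻¹ • PowerSeries.coeff n (posSeries a ^ k) = 0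
    rw [this, smul_zero]

theorem coeff_mul_expSum (f : PowerSeries A) (a : ℕ+ → A) {n N : ℕ} (hN : n < N) :
    PowerSeries.coeff n (f * expSum a) = ∑ k ∈ Finset.range N, ((k.factorial : ℂ)⁻¹) •
      PowerSeries.coeff n (f * posSeries a ^ k) := by
  simp only [PowerSeries.coeff_mul, Finset.smul_sum]
  rw [Finset.sum_comm]
  refine Finset.sum_congr rfl fun p hp => ?_
  have hp' : p.1 + p.2 = n := by simpa using hp
  rw [coeff_expSum a (show p.2 < N by omega), Finset.mul_sum]
  simp only [mul_smul_comm]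

@[simp] theorem coeff_zero_expSum (a : ℕ+ → A) : PowerSeries.coeff 0 (expSum a) = 1 := by
  rw [coeff_expSum a Nat.zero_lt_one]
  simp

theorem commute_of_coeff {f g : PowerSeries A}
    (h : ∀ i j, Commute (PowerSeries.coeff i f) (PowerSeries.coeff j g)) : Commute f g := by
  ext n
  rw [PowerSeries.coeff_mul, PowerSeries.coeff_mul, ← Finset.Nat.sum_antidiagonal_swap]
  exact Finset.sum_congr rfl fun p _ => (h _ _).eq

theorem commute_posSeries {f : PowerSeries A} {a : ℕ+ → A}
    (h : ∀ i r, Commute (PowerSeries.coeff i f) (a r)) : Commute f (posSeries a) := by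
  refine commute_of_coeff fun i j => ?_
  rcases Nat.eq_zero_or_pos j with h0 | h0
  · rw [h0, coeff_posSeries_zero]
    exact Commute.zero_right _
  · have := coeff_posSeries_pos a ⟨j, h0⟩
    rw [PNat.mk_coe] at this
    rw [this]
    exact h i _

theorem commute_coeff_expSum {x : A} {a : ℕ+ → A} (h : ∀ r, Commute x (a r)) (n : ℕ) :
    Commute x (PowerSeries.coeff n (expSum a)) := by
  have hS : Commute (PowerSeries.C x) (posSeries a) := by
    refine commute_posSeries fun i r => ?_
    rw [PowerSeries.coeff_C]
    split_ifs
    · exact h r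
    · exact Commute.zero_left _
  rw [coeff_expSum a (Nat.lt_succ_self n)]
  refine Commute.sum_right _ _ _ fun k _ => Commute.smul_right ?_ _
  have := congrArg (PowerSeries.coeff n) (hS.pow_right k).eq
  rwa [PowerSeries.coeff_C_mul, PowerSeries.coeff_mul_C] at this

/-- The exponential satisfies the differential equation `w E' = (w S') E`. -/
theorem euler_expSum {a : ℕ+ → A} (h : ∀ r s, Commute (a r) (a s)) :
    euler (expSum a) = euler (posSeries a) * expSum a := by
  have hc : Commute (posSeries a) (posSeries a) := Commute.refl _
  have hS : Commute (posSeries a) (euler (posSeries a)) := by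
    refine commute_of_coeff fun i j => ?_
    rw [coeff_euler]
    refine Commute.smul_right ?_ _
    simp only [posSeries, PowerSeries.coeff_mk]
    split_ifs
    · exact h _ _
    · exact Commute.zero_right _
    · exact Commute.zero_left _
    · exact Commute.zero_left _
  ext n
  rw [coeff_mul_expSum _ a (Nat.lt_succ_self n), coeff_euler,
    coeff_expSum a (show n < n + 1 + 1 by omega), Finset.sum_range_succ',
    smul_add, Finset.smul_sum]
  have h0 : (n : ℂ) • ((Nat.factorial 0 : ℂ)⁻¹ •
      PowerSeries.coeff n (posSeries a ^ 0)) = 0 := by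
    rw [smul_comm, ← coeff_euler, pow_zero, euler_one]
    simp
  rw [h0, add_zero]
  refine Finset.sum_congr rfl fun k _ => ?_
  rw [smul_comm, ← coeff_euler, euler_pow_succ hS, PowerSeries.coeff_smul, smul_smul]
  congr 1
  rw [Nat.factorial_succ]
  have : ((k : ℂ) + 1) ≠ 0 := by exact_mod_cast Nat.succ_ne_zero k
  push_cast
  field_simp

/-- A solution of `w F' = B F`, with `B` without constant term, is determined by its constant
term. -/
theorem eq_of_euler_eq {B F G : PowerSeries A} (hB : PowerSeries.coeff 0 B = 0)
    (hF : euler F = B * F) (hG : euler G = B * G)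
    (h0 : PowerSeries.coeff 0 F = PowerSeries.coeff 0 G) : F = G := by
  ext n
  induction n using Nat.strong_induction_on with
  | _ n ih =>
    rcases Nat.eq_zero_or_pos n with hn | hn
    · rw [hn, h0]
    · have e : (n : ℂ) • PowerSeries.coeff n F = (n : ℂ) • PowerSeries.coeff n G := by
        rw [← coeff_euler, ← coeff_euler, hF, hG, PowerSeries.coeff_mul, PowerSeries.coeff_mul]
        refine Finset.sum_congr rfl fun p hp => ?_
        have hp' : p.1 + p.2 = n := by simpa using hp
        rcases Nat.eq_zero_or_pos p.1 with h1 | h1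
        · rw [h1, hB, zero_mul, zero_mul]
        · rw [ih p.2 (by omega)]
      have hne : (n : ℂ) ≠ 0 := by exact_mod_cast hn.ne'
      exact smul_right_injective A hne e

theorem coeff_euler_posSeries_zero (a : ℕ+ → A) :
    PowerSeries.coeff 0 (euler (posSeries a)) = 0 := by
  simp

/-- The exponential is characterized by its differential equation. -/
theorem eq_expSum {a : ℕ+ → A} (h : ∀ r s, Commute (a r) (a s)) {F : PowerSeries A}
    (hF : euler F = euler (posSeries a) * F) (h0 : PowerSeries.coeff 0 F = 1) : F = expSum a :=
  eq_of_euler_eq (coeff_euler_posSeries_zero a) hF (euler_expSum h) (by simp [h0])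

/-- Both sides solve the same differential equation. -/
theorem expSum_add {a b : ℕ+ → A} (ha : ∀ r s, Commute (a r) (a s))
    (hb : ∀ r s, Commute (b r) (b s)) (hab : ∀ r s, Commute (a r) (b s)) :
    expSum (a + b) = expSum a * expSum b := by
  symm
  refine eq_expSum (fun r s => ?_) ?_ (by simp [PowerSeries.coeff_mul])
  · exact ((ha r s).add_right (hab r s)).add_left (((hab s r).symm).add_right (hb r s))
  · have hc : Commute (expSum a) (euler (posSeries b)) := by
      refine commute_of_coeff fun i j => ?_
      rw [coeff_euler]
      refine Commute.smul_right ?_ _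
      simp only [posSeries, PowerSeries.coeff_mk]
      split_ifs
      · exact (commute_coeff_expSum (fun r => (hab r _).symm) i).symm
      · exact Commute.zero_right _
    rw [euler_mul, euler_expSum ha, euler_expSum hb, ← mul_assoc (expSum a), hc.eq, posSeries_add,
      euler_add]
    noncomm_ring

theorem expSum_zero : expSum (0 : ℕ+ → A) = 1 := by
  symm
  refine eq_expSum (fun r s => Commute.zero_left _) ?_ (by simp)
  have : posSeries (0 : ℕ+ → A) = 0 := by
    ext n
    rw [posSeries, PowerSeries.coeff_mk]
    split_ifs
    · rfl
    · simp
  rw [this, euler_one, show euler (0 : PowerSeries A) = 0 by ext; simp, zero_mul]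

theorem expSum_sum {R : Type*} [CommRing R] [Algebra ℂ R] {ι : Type*} (s : Finset ι)
    (f : ι → ℕ+ → R) : expSum (∑ i ∈ s, f i) = ∏ i ∈ s, expSum (f i) := by
  classical
  induction s using Finset.induction_on with
  | empty => simpa using expSum_zero
  | insert i s hi ih =>
    rw [Finset.sum_insert hi, Finset.prod_insert hi, ← ih,
      expSum_add (fun _ _ => Commute.all _ _) (fun _ _ => Commute.all _ _)
        (fun _ _ => Commute.all _ _)]

/-- Exponentials are preserved by algebra maps, coefficient by coefficient. -/
theorem expSum_map {B : Type*} [Ring B] [Algebra ℂ B] (φ : A →ₐ[ℂ] B) (a : ℕ+ → A) (n : ℕ) :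
    PowerSeries.coeff n (expSum fun r => φ (a r)) = φ (PowerSeries.coeff n (expSum a)) := by
  have hS : posSeries (fun r => φ (a r)) = PowerSeries.map (φ : A →+* B) (posSeries a) := by
    ext n
    simp only [posSeries, PowerSeries.coeff_mk, PowerSeries.coeff_map]
    split_ifs <;> simp
  rw [coeff_expSum _ (Nat.lt_succ_self n), coeff_expSum _ (Nat.lt_succ_self n), map_sum]
  refine Finset.sum_congr rfl fun k _ => ?_
  rw [hS, ← map_pow, PowerSeries.coeff_map, map_smul]
  rfl

/-- Rescaling the variable of an exponential. -/
theorem coeff_expSum_smul_pow (ρ : ℂ) (a : ℕ+ → A) (n : ℕ) :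
    PowerSeries.coeff n (expSum fun r => ρ ^ (r : ℕ) • a r) =
      ρ ^ n • PowerSeries.coeff n (expSum a) := by
  have key : ∀ k n, PowerSeries.coeff n (posSeries (fun r => ρ ^ (r : ℕ) • a r) ^ k) =
      ρ ^ n • PowerSeries.coeff n (posSeries a ^ k) := by
    intro k
    induction k with
    | zero =>
      intro n
      rw [pow_zero, pow_zero, PowerSeries.coeff_one]
      split_ifs with h <;> simp [h]
    | succ k ih =>
      intro n
      rw [pow_succ, pow_succ, PowerSeries.coeff_mul, PowerSeries.coeff_mul, Finset.smul_sum]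
      refine Finset.sum_congr rfl fun p hp => ?_
      have hp' : p.1 + p.2 = n := by simpa using hp
      have : PowerSeries.coeff p.2 (posSeries fun r => ρ ^ (r : ℕ) • a r) =
          ρ ^ p.2 • PowerSeries.coeff p.2 (posSeries a) := by
        simp only [posSeries, PowerSeries.coeff_mk]
        split_ifs <;> simp
      rw [ih, this, smul_mul_smul_comm, ← pow_add, hp']
  rw [coeff_expSum _ (Nat.lt_succ_self n), coeff_expSum _ (Nat.lt_succ_self n), Finset.smul_sum]
  refine Finset.sum_congr rfl fun k _ => ?_
  rw [key, smul_comm]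

/-- If the commutators `[x, a_r] = c_r` are central, then `[x, E] = (∑ c_r w ^ r) E`. -/
theorem commutator_expSum {x : A} {a : ℕ+ → A} {c : ℕ+ → ℂ}
    (h : ∀ r, x * a r = a r * x + algebraMap ℂ A (c r)) :
    PowerSeries.C x * expSum a = expSum a * PowerSeries.C x +
      posSeries (fun r => algebraMap ℂ A (c r)) * expSum a := by
  set S := posSeries a
  set c' := posSeries fun r => algebraMap ℂ A (c r) with hc'
  have hcS : Commute c' S := by
    refine commute_of_coeff fun i j => ?_
    rw [hc', posSeries, PowerSeries.coeff_mk]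
    split_ifs
    · exact Algebra.commute_algebraMap_left _ _
    · exact Commute.zero_left _
  have h1 : PowerSeries.C x * S = S * PowerSeries.C x + c' := by
    ext n
    simp only [S, hc', PowerSeries.coeff_C_mul, map_add, PowerSeries.coeff_mul_C, posSeries,
      PowerSeries.coeff_mk]
    split_ifs
    · exact h _
    · simp
  have hk : ∀ k : ℕ, PowerSeries.C x * S ^ (k + 1) =
      S ^ (k + 1) * PowerSeries.C x + ((k + 1 : ℕ) : ℂ) • (c' * S ^ k) := by
    intro k
    induction k with
    | zero => simpa using h1
    | succ k ih =>
      rw [pow_succ, ← mul_assoc, ih, add_mul, mul_assoc _ _ S, h1, mul_add, smul_mul_assoc,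
        mul_assoc c', ← pow_succ, ← mul_assoc, ← (hcS.pow_right (k + 1)).eq]
      push_cast
      module
  ext n
  have e1 : PowerSeries.coeff n (expSum a * PowerSeries.C x) =
      ∑ k ∈ Finset.range (n + 1 + 1), ((k.factorial : ℂ)⁻¹) •
        PowerSeries.coeff n (S ^ k * PowerSeries.C x) := by
    simp only [PowerSeries.coeff_mul_C]
    rw [coeff_expSum a (show n < n + 1 + 1 by omega), Finset.sum_mul]
    simp only [smul_mul_assoc, S]
  rw [map_add, e1, coeff_mul_expSum _ a (show n < n + 1 + 1 by omega),
    coeff_mul_expSum _ a (show n < n + 1 by omega), Finset.sum_range_succ',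
    Finset.sum_range_succ' _ (n + 1)]
  simp only [pow_zero, mul_one, one_mul]
  rw [add_right_comm, ← Finset.sum_add_distrib]
  congr 1
  refine Finset.sum_congr rfl fun k _ => ?_
  rw [hk k, map_add, smul_add, PowerSeries.coeff_smul, smul_smul]
  congr 2
  rw [Nat.factorial_succ]
  have : ((k : ℂ) + 1) ≠ 0 := by exact_mod_cast Nat.succ_ne_zero k
  push_cast
  field_simp

end ExpSum

/-! ### Exchanging two exponentials -/

section Exchange

set_option linter.unusedSectionVars false

variable {A : Type*} [Ring A] [Algebra ℂ A]

/-- The Euler operator on the left acts on the outer variable of a series in two variables. -/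
theorem euler_map_C (f : PowerSeries A) :
    euler (PowerSeries.map (PowerSeries.C (R := A)) f) =
      PowerSeries.map PowerSeries.C (euler f) := by
  ext n m
  simp only [coeff_euler, PowerSeries.coeff_map, PowerSeries.coeff_C, PowerSeries.coeff_smul]
  split_ifs <;> simp

/-- The series `∑ f_k (z w) ^ k`, as a power series in `w` over power series in `z`. -/
noncomputable def diagSeries (f : PowerSeries ℂ) : PowerSeries (PowerSeries A) :=
  PowerSeries.mk fun k => PowerSeries.coeff k f • PowerSeries.X ^ k

theorem commute_diagSeries (f : PowerSeries ℂ) (F : PowerSeries (PowerSeries A)) :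
    Commute (diagSeries f) F := by
  refine commute_of_coeff fun i j => ?_
  rw [diagSeries, PowerSeries.coeff_mk]
  exact Commute.smul_left ((PowerSeries.commute_X _).symm.pow_left i) _

theorem euler_diagSeries (f : PowerSeries ℂ) :
    euler (diagSeries f : PowerSeries (PowerSeries A)) = diagSeries (euler f) := by
  ext1 n
  simp [diagSeries, smul_smul]

theorem diagSeries_mul (f g : PowerSeries ℂ) :
    (diagSeries (f * g) : PowerSeries (PowerSeries A)) = diagSeries f * diagSeries g := by
  ext1 n
  rw [PowerSeries.coeff_mul]
  simp only [diagSeries, PowerSeries.coeff_mk, PowerSeries.coeff_mul, Finset.sum_smul]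
  refine Finset.sum_congr rfl fun p hp => ?_
  have hp' : p.1 + p.2 = n := by simpa using hp
  rw [smul_mul_smul_comm, ← pow_add, hp']

/-- Exchange of two exponentials whose exponents have central commutators: both sides, as series
in two variables, solve the same differential equation in one of them. -/
theorem exchange_expSum {P Q : ℕ+ → A} {c : ℕ+ → ℂ} (hP : ∀ r s, Commute (P r) (P s))
    (hPQ : ∀ r s, P r * Q s = Q s * P r + if r = s then algebraMap ℂ A (c r) else 0) :
    PowerSeries.map PowerSeries.C (expSum P) * PowerSeries.C (expSum Q) =
      diagSeries (expSum c) * PowerSeries.C (expSum Q) *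
        PowerSeries.map PowerSeries.C (expSum P) := by
  set Q' : PowerSeries (PowerSeries A) := PowerSeries.C (expSum Q)
  set P' : PowerSeries (PowerSeries A) := PowerSeries.map PowerSeries.C (expSum P)
  set B : PowerSeries (PowerSeries A) := PowerSeries.map PowerSeries.C (euler (posSeries P)) with hB
  set Γ : PowerSeries (PowerSeries A) := diagSeries (euler (posSeries c)) with hΓ
  have hQ' : euler Q' = 0 := by
    ext1 n
    rw [coeff_euler, PowerSeries.coeff_C]
    split_ifs with h <;> simp [h]
  have hP' : euler P' = B * P' := by
    rw [euler_map_C, euler_expSum hP, map_mul]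
  have hC' : euler (diagSeries (expSum c) : PowerSeries (PowerSeries A)) =
      diagSeries (expSum c) * Γ := by
    rw [euler_diagSeries, euler_expSum fun _ _ => Commute.all _ _, mul_comm, diagSeries_mul]
  have hBQ : B * Q' = Q' * B + Γ * Q' := by
    ext1 n
    rw [PowerSeries.coeff_mul_C, map_add, PowerSeries.coeff_C_mul, PowerSeries.coeff_mul_C, hB, hΓ,
      PowerSeries.coeff_map, diagSeries, PowerSeries.coeff_mk, coeff_euler, coeff_euler]
    rcases Nat.eq_zero_or_pos n with hn | hn
    · simp [hn]
    · obtain ⟨r, rfl⟩ : ∃ r : ℕ+, n = r := ⟨⟨n, hn⟩, rfl⟩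
      rw [coeff_posSeries_pos, coeff_posSeries_pos]
      have h1 := commutator_expSum (x := P r) (a := Q) (c := fun s => if r = s then c r else 0)
        (fun s => by rw [hPQ]; split_ifs <;> simp)
      have h2 : posSeries (fun s => algebraMap ℂ A (if r = s then c r else 0)) =
          c r • PowerSeries.X ^ (r : ℕ) := by
        ext m
        rw [posSeries, PowerSeries.coeff_mk, PowerSeries.coeff_smul, PowerSeries.coeff_X_pow]
        split_ifs with h3 h4 h5 h5 h5
        · simp [Algebra.algebraMap_eq_smul_one]
        · exact absurd (congrArg (fun s : ℕ+ => (s : ℕ)) h4).symm h5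
        · exact absurd (PNat.eq h5.symm) h4
        · simp
        · exact absurd r.pos (by omega)
        · simp
      have h3 : (PowerSeries.C (((r : ℕ) : ℂ) • P r) : PowerSeries A) =
          ((r : ℕ) : ℂ) • PowerSeries.C (P r) := by
        ext m
        rw [PowerSeries.coeff_smul, PowerSeries.coeff_C, PowerSeries.coeff_C]
        split_ifs <;> simp
      rw [h3, smul_mul_assoc, h1, h2, mul_smul_comm, smul_add, smul_assoc, smul_mul_assoc,
        smul_mul_assoc, smul_mul_assoc]
  refine eq_of_euler_eq (B := B) ?_ ?_ ?_ ?_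
  · simp [hB]
  · rw [euler_mul, hQ', mul_zero, add_zero, hP', mul_assoc]
  · rw [euler_mul, euler_mul, hQ', hC', hP', mul_zero, add_zero]
    calc diagSeries (expSum c) * Γ * Q' * P' + diagSeries (expSum c) * Q' * (B * P')
        = diagSeries (expSum c) * (Q' * B + Γ * Q') * P' := by noncomm_ring
      _ = diagSeries (expSum c) * B * Q' * P' := by rw [← hBQ]; noncomm_ring
      _ = B * (diagSeries (expSum c) * Q' * P') := by
        rw [(commute_diagSeries _ B).eq]; noncomm_ring
  · simp [Q', P', diagSeries, PowerSeries.coeff_mul]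

@[simp] theorem coeffInt_natCast (n : ℕ) (S : PowerSeries A) :
    coeffInt (n : ℤ) S = PowerSeries.coeff n S := by
  simp [coeffInt]

theorem coeffInt_of_neg {n : ℤ} (hn : n < 0) (S : PowerSeries A) : coeffInt n S = 0 := by
  rw [coeffInt, if_neg (by omega)]

theorem coeffInt_mul_of_le (S T : PowerSeries A) (n : ℤ) {N : ℕ} (hN : n < N) :
    coeffInt n (S * T) =
      ∑ k ∈ Finset.range N, PowerSeries.coeff k S * coeffInt (n - k) T := by
  rcases lt_or_ge n 0 with hn | hn
  · rw [coeffInt_of_neg hn]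
    refine (Finset.sum_eq_zero fun k _ => ?_).symm
    rw [coeffInt_of_neg (by omega), mul_zero]
  · lift n to ℕ using hn
    rw [coeffInt_natCast, PowerSeries.coeff_mul,
      Finset.Nat.sum_antidiagonal_eq_sum_range_succ (fun i j =>
        PowerSeries.coeff i S * PowerSeries.coeff j T)]
    refine Finset.sum_subset_zero_on_sdiff (fun k hk => ?_) (fun k hk => ?_) fun k hk => ?_
    · simp only [Finset.mem_range] at hk ⊢
      omega
    · simp only [Finset.mem_sdiff, Finset.mem_range] at hk
      rw [coeffInt_of_neg (by omega), mul_zero]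
    · simp only [Finset.mem_range] at hk
      rw [← Nat.cast_sub (by omega), coeffInt_natCast]

/-- The exchange of two exponentials, coefficient by coefficient. The sum is finite because the
coefficients of `expSum P` of negative index vanish. -/
theorem exchange_coeffInt {P Q : ℕ+ → A} {c : ℕ+ → ℂ} (hP : ∀ r s, Commute (P r) (P s))
    (hPQ : ∀ r s, P r * Q s = Q s * P r + if r = s then algebraMap ℂ A (c r) else 0)
    (e b : ℤ) {N : ℕ} (hN : e < N) :
    coeffInt e (expSum P) * coeffInt b (expSum Q) = ∑ k ∈ Finset.range N,
      PowerSeries.coeff k (expSum c) •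
        (coeffInt (b - k) (expSum Q) * coeffInt (e - k) (expSum P)) := by
  rcases lt_or_ge b 0 with hb | hb
  · rw [coeffInt_of_neg hb, mul_zero]
    refine (Finset.sum_eq_zero fun k _ => ?_).symm
    rw [coeffInt_of_neg (by omega), zero_mul, smul_zero]
  lift b to ℕ using hb
  have h := congrArg (fun F => PowerSeries.coeff b (coeffInt e F)) (exchange_expSum hP hPQ)
  simp only [mul_assoc] at h
  rw [coeffInt_mul_of_le (diagSeries (expSum c)) _ e hN] at h
  have h1 : ∀ (n : ℤ) (F : PowerSeries A),
      coeffInt n (PowerSeries.map PowerSeries.C F) = PowerSeries.C (coeffInt n F) := by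
    intro n F
    unfold coeffInt
    split_ifs <;> simp
  have h2 : ∀ (n : ℤ) (F : PowerSeries (PowerSeries A)) (a : PowerSeries A),
      coeffInt n (F * PowerSeries.C a) = coeffInt n F * a := by
    intro n F a
    unfold coeffInt
    split_ifs <;> simp [PowerSeries.coeff_mul_C]
  have h3 : ∀ (n : ℤ) (F : PowerSeries (PowerSeries A)) (a : PowerSeries A),
      coeffInt n (PowerSeries.C a * F) = a * coeffInt n F := by
    intro n F a
    unfold coeffInt
    split_ifs <;> simp [PowerSeries.coeff_C_mul]
  rw [h2, h1, PowerSeries.coeff_C_mul, map_sum] at h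
  rw [coeffInt_natCast, h]
  refine Finset.sum_congr rfl fun k _ => ?_
  rw [h3, h1, diagSeries, PowerSeries.coeff_mk, smul_mul_assoc, PowerSeries.coeff_smul,
    PowerSeries.coeff_X_pow_mul']
  split_ifs with hk
  · rw [PowerSeries.coeff_mul_C, ← Nat.cast_sub hk, coeffInt_natCast]
  · rw [coeffInt_of_neg (show (b : ℤ) - k < 0 by omega), zero_mul]

end Exchange

/-! ### Normally ordered currents -/

section Ordered

variable {L : ℕ}

theorem Lowering.coeffInt_mem {S : PowerSeries (Module.End ℂ (Fock L))} (hS : Lowering S)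
    {d : ℤ} {v : Fock L} (hv : v ∈ Fil L d) (n : ℤ) : coeffInt n S v ∈ Fil L (d - n) := by
  rcases lt_or_ge n 0 with hn | hn
  · rw [coeffInt_of_neg hn]
    exact Submodule.zero_mem _
  · lift n to ℕ using hn
    rw [coeffInt_natCast]
    exact hS n d v hv

theorem Lowering.coeffInt_eq_zero {S : PowerSeries (Module.End ℂ (Fock L))} (hS : Lowering S)
    {d : ℤ} {v : Fock L} (hv : v ∈ Fil L d) {n : ℤ} (hn : d < n) : coeffInt n S v = 0 :=
  Fil_neg (by omega) (hS.coeffInt_mem hv n)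

/-- The creation index may run over all integers, which makes the sums easy to reindex. -/
theorem ordered_apply (N M : PowerSeries (Module.End ℂ (Fock L))) (hM : Lowering M) (m : ℤ)
    (v : Fock L) :
    (ordered N M hM).1 m v = ∑ᶠ a : ℤ, coeffInt a N (coeffInt (m + a) M v) := by
  change ∑ᶠ a : ℕ, PowerSeries.coeff a N (coeffInt (m + a) M v) = _
  rw [← finsum_mem_univ, ← finsum_mem_univ (f := fun a : ℤ => _)]
  have h : ∑ᶠ a ∈ Set.range (Nat.cast : ℕ → ℤ), coeffInt a N (coeffInt (m + a) M v) =
      ∑ᶠ a : ℕ, coeffInt a N (coeffInt (m + a) M v) :=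
    finsum_mem_range Nat.cast_injective
  rw [finsum_mem_univ]
  simp only [coeffInt_natCast] at h
  rw [← h]
  refine finsum_mem_inter_support_eq' _ _ _ fun a ha => ?_
  simp only [Set.mem_range, Set.mem_univ, iff_true]
  by_contra hneg
  refine ha ?_
  dsimp only
  rw [coeffInt_of_neg, LinearMap.zero_apply]
  by_contra h0
  exact hneg ⟨a.toNat, by omega⟩

theorem ordered_finite (N : PowerSeries (Module.End ℂ (Fock L)))
    {M : PowerSeries (Module.End ℂ (Fock L))} (hM : Lowering M) (m : ℤ) (v : Fock L) :
    (Function.support fun a : ℤ => coeffInt a N (coeffInt (m + a) M v)).Finite := by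
  obtain ⟨D, hD⟩ := exists_mem_Fil v
  refine (Set.finite_Icc 0 (D - m)).subset fun a ha => ?_
  rw [Function.mem_support] at ha
  constructor
  · by_contra h
    exact ha (by rw [coeffInt_of_neg (by omega), LinearMap.zero_apply])
  · by_contra h
    exact ha (by rw [hM.coeffInt_eq_zero hD (by omega), map_zero])

end Ordered

/-! ### Vertex operators and their products -/

section Vertex

variable {L : ℕ}

/-- The creation exponent `∑_j n_{j,r} h_{-r}^{(j)}` with given coefficients. -/
noncomputable def creat (n : Fin L → ℕ+ → ℂ) (r : ℕ+) : Module.End ℂ (Fock L) :=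
  ∑ j, n j r • LinearMap.mulLeft ℂ (MvPolynomial.X (j, r))

/-- The annihilation exponent with given coefficients, in terms of the derivations `∂/∂h_{-r}`
rather than of the operators `h_r`, which are multiples of them. -/
noncomputable def annih (m : Fin L → ℕ+ → ℂ) (r : ℕ+) : Module.End ℂ (Fock L) :=
  ∑ j, m j r • (MvPolynomial.pderiv (j, r)).toLinearMap

theorem annih_mem (m : Fin L → ℕ+ → ℂ) (r : ℕ+) (d : ℤ) (v : Fock L) (hv : v ∈ Fil L d) :
    annih m r v ∈ Fil L (d - (r : ℕ)) := by
  rw [annih, LinearMap.sum_apply]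
  exact Submodule.sum_mem _ fun j _ => Submodule.smul_mem _ _ (pderiv_mem_Fil j r d v hv)

theorem annih_lowering (m : Fin L → ℕ+ → ℂ) : Lowering (expSum (annih m)) :=
  Lowering.expSum (annih_mem m)

/-- The vertex operator with the given creation and annihilation coefficients. -/
noncomputable def vert (n m : Fin L → ℕ+ → ℂ) : Current L :=
  ordered (expSum (creat n)) (expSum (annih m)) (annih_lowering m)

/-- The contraction exponent `[∑_j m_{j,r} ∂_{j,r}, ∑_j n_{j,r} h_{-r}^{(j)}]`. -/
def pairing (m n : Fin L → ℕ+ → ℂ) (r : ℕ+) : ℂ := ∑ j, m j r * n j r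

theorem pderiv_commute (p q : Fin L × ℕ+) :
    Commute (MvPolynomial.pderiv p : Derivation ℂ (Fock L) (Fock L)).toLinearMap
      (MvPolynomial.pderiv q : Derivation ℂ (Fock L) (Fock L)).toLinearMap := by
  classical
  let P : Derivation ℂ (Fock L) (Fock L) := MvPolynomial.pderiv p
  let Q : Derivation ℂ (Fock L) (Fock L) := MvPolynomial.pderiv q
  have h : ⁅P, Q⁆ = 0 := by
    refine MvPolynomial.derivation_ext fun i => ?_
    rw [Derivation.commutator_apply, MvPolynomial.pderiv_X, MvPolynomial.pderiv_X]
    simp only [Pi.single_apply]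
    split_ifs <;> simp
  refine LinearMap.ext fun v => ?_
  have := congrArg (fun D : Derivation ℂ (Fock L) (Fock L) => D v) h
  simp only [Derivation.commutator_apply, Derivation.zero_apply] at this
  exact sub_eq_zero.1 this

theorem annih_commute (m m' : Fin L → ℕ+ → ℂ) (r s : ℕ+) : Commute (annih m r) (annih m' s) :=
  Commute.sum_left _ _ _ fun _ _ => Commute.sum_right _ _ _ fun _ _ =>
    ((pderiv_commute _ _).smul_left _).smul_right _

theorem creat_eq (n : Fin L → ℕ+ → ℂ) (r : ℕ+) :
    creat n r = Algebra.lmul ℂ (Fock L) (∑ j, n j r • MvPolynomial.X (j, r)) := by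
  simp only [map_sum, map_smul]
  rfl

theorem creat_commute (n n' : Fin L → ℕ+ → ℂ) (r s : ℕ+) : Commute (creat n r) (creat n' s) := by
  rw [creat_eq, creat_eq]
  exact (Commute.all _ _).map (Algebra.lmul ℂ (Fock L))

theorem pderiv_X_mul {σ : Type*} [DecidableEq σ] (p q : σ) (v : MvPolynomial σ ℂ) :
    MvPolynomial.pderiv p (MvPolynomial.X q * v) =
      MvPolynomial.X q * MvPolynomial.pderiv p v + if p = q then v else 0 := by
  rw [MvPolynomial.pderiv_mul, MvPolynomial.pderiv_X, add_comm]
  congr 1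
  split_ifs with h
  · rw [h, Pi.single_eq_same, one_mul]
  · rw [Pi.single_eq_of_ne (Ne.symm h), zero_mul]

theorem pderiv_mul_mulLeft {σ : Type*} [DecidableEq σ] (p q : σ) :
    ((MvPolynomial.pderiv p).toLinearMap : Module.End ℂ (MvPolynomial σ ℂ)) *
      LinearMap.mulLeft ℂ (MvPolynomial.X q) =
      LinearMap.mulLeft ℂ (MvPolynomial.X q) * (MvPolynomial.pderiv p).toLinearMap +
        if p = q then 1 else 0 := by
  refine LinearMap.ext fun v => (pderiv_X_mul p q v).trans ?_
  rw [LinearMap.add_apply]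
  congr 1
  split_ifs <;> rfl

theorem annih_mul_creat (m n : Fin L → ℕ+ → ℂ) (r s : ℕ+) :
    annih m r * creat n s = creat n s * annih m r +
      if r = s then algebraMap ℂ (Module.End ℂ (Fock L)) (pairing m n r) else 0 := by
  classical
  simp only [annih, creat, Finset.sum_mul_sum, smul_mul_smul_comm, pderiv_mul_mulLeft, smul_add,
    Finset.sum_add_distrib]
  refine congrArg₂ (· + ·) ?_ ?_
  · rw [Finset.sum_comm]
    refine Finset.sum_congr rfl fun i _ => Finset.sum_congr rfl fun j _ => ?_
    rw [mul_comm]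
  · by_cases hrs : r = s
    · simp only [hrs, Prod.mk.injEq, and_true, smul_ite, smul_zero, Finset.sum_ite_eq,
        Finset.mem_univ, if_true, pairing, Algebra.algebraMap_eq_smul_one, Finset.sum_smul]
    · simp [hrs]

variable (n m n' m' : Fin L → ℕ+ → ℂ)

/-- The term of the fourfold sum in a product of two vertex operators: the coefficients of index
`a` and `b` of the two creation parts, applied after those of index `e` and `f` of the two
annihilation parts. -/
noncomputable def quad (v : Fock L) (a b e f : ℤ) : Fock L :=
  coeffInt a (expSum (creat n)) (coeffInt b (expSum (creat n'))
    (coeffInt e (expSum (annih m)) (coeffInt f (expSum (annih m')) v)))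

/-- The modes of the normally ordered product `:V(z₁) V'(z₂):` of two vertex operators. -/
noncomputable def bimode (x y : ℤ) (v : Fock L) : Fock L :=
  ∑ᶠ p : ℤ × ℤ, quad n m n' m' v p.1 p.2 (x + p.1) (y + p.2)

theorem quad_ne_zero {D : ℤ} {v : Fock L} (hv : v ∈ Fil L D) {a b e f : ℤ}
    (h : quad n m n' m' v a b e f ≠ 0) :
    0 ≤ a ∧ 0 ≤ b ∧ 0 ≤ e ∧ 0 ≤ f ∧ e + f ≤ D := by
  refine ⟨?_, ?_, ?_, ?_, ?_⟩ <;> by_contra hc <;> refine h ?_ <;> unfold quad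
  · simp [coeffInt_of_neg (show a < 0 by omega)]
  · simp [coeffInt_of_neg (show b < 0 by omega)]
  · simp [coeffInt_of_neg (show e < 0 by omega)]
  · simp [coeffInt_of_neg (show f < 0 by omega)]
  · rw [(annih_lowering m).coeffInt_eq_zero ((annih_lowering m').coeffInt_mem hv f) (by omega)]
    simp

theorem bimode_eq_zero {D : ℤ} {v : Fock L} (hv : v ∈ Fil L D) {x y : ℤ} (h : D < x ∨ D < y) :
    bimode n m n' m' x y v = 0 := by
  unfold bimode
  rw [← finsum_zero (α := ℤ × ℤ)]
  refine finsum_congr fun p => ?_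
  by_contra hne
  have := quad_ne_zero n m n' m' hv hne
  omega

theorem bimode_finite {D : ℤ} {v : Fock L} (hv : v ∈ Fil L D) (x y : ℤ) :
    (Function.support fun p : ℤ × ℤ => quad n m n' m' v p.1 p.2 (x + p.1) (y + p.2)).Finite := by
  refine ((Set.finite_Icc 0 (D - x)).prod (Set.finite_Icc 0 (D - y))).subset fun p hp => ?_
  have := quad_ne_zero n m n' m' hv hp
  simp only [Set.mem_prod, Set.mem_Icc]
  omega

/-- Reordering of a product of two vertex operators: the normally ordered product times the
exponential of the contractions, expanded in powers of `z₂ / z₁`. -/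
theorem vert_comp (x y : ℤ) (v : Fock L) :
    (vert n m).1 x ((vert n' m').1 y v) = ∑ᶠ k : ℕ,
      PowerSeries.coeff k (expSum (pairing m n')) • bimode n m n' m' (x - k) (y + k) v := by
  obtain ⟨D, hD⟩ := exists_mem_Fil v
  set c := fun k : ℕ => PowerSeries.coeff k (expSum (pairing m n'))
  let ψ : ℤ × ℤ × ℕ → Fock L := fun t =>
    c t.2.2 • quad n m n' m' v t.1 (t.2.1 - t.2.2) (x + t.1 - t.2.2) (y + t.2.1)
  have hψ : ∀ t, ψ t ≠ 0 → 0 ≤ t.1 ∧ t.1 ≤ 2 * D - x - y ∧ (t.2.2 : ℤ) ≤ t.2.1 ∧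
      t.2.1 ≤ D - y := by
    intro t ht
    have := quad_ne_zero n m n' m' hD (right_ne_zero_of_smul ht)
    omega
  have hfin : (Function.support ψ).Finite := by
    refine ((Set.finite_Icc 0 (2 * D - x - y)).prod ((Set.finite_Icc 0 (D - y)).prod
      (Set.finite_Iic (D - y).toNat))).subset fun t ht => ?_
    have := hψ t ht
    simp only [Set.mem_prod, Set.mem_Icc, Set.mem_Iic]
    omega
  have hexch : ∀ (a b : ℤ), coeffInt (x + a) (expSum (annih m))
      (coeffInt b (expSum (creat n')) (coeffInt (y + b) (expSum (annih m')) v)) =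
      ∑ᶠ k : ℕ, c k • (coeffInt (b - k) (expSum (creat n'))
        (coeffInt (x + a - k) (expSum (annih m)) (coeffInt (y + b) (expSum (annih m')) v))) := by
    intro a b
    have h := exchange_coeffInt (P := annih m) (Q := creat n') (c := pairing m n')
      (annih_commute m m) (annih_mul_creat m n') (x + a) b (N := (x + a).toNat + 1) (by omega)
    rw [← Module.End.mul_apply, h, LinearMap.sum_apply]
    rw [finsum_eq_sum_of_support_subset (s := Finset.range ((x + a).toNat + 1))]
    · rfl
    · intro k hk
      rw [Function.mem_support] at hk
      rw [Finset.coe_range, Set.mem_Iio]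
      by_contra hlt
      exact hk (by rw [coeffInt_of_neg (show x + a - k < 0 by omega)]; simp)
  have hexch_fin : ∀ (a b : ℤ), (Function.support fun k : ℕ => c k •
      (coeffInt (b - k) (expSum (creat n')) (coeffInt (x + a - k) (expSum (annih m))
        (coeffInt (y + b) (expSum (annih m')) v)))).Finite := by
    intro a b
    refine (Set.finite_Iic b.toNat).subset fun k hk => ?_
    rw [Function.mem_support] at hk
    rw [Set.mem_Iic]
    by_contra hlt
    exact hk (by rw [coeffInt_of_neg (show b - k < 0 by omega)]; simp)
  have h1 : (vert n m).1 x ((vert n' m').1 y v) = ∑ᶠ (a : ℤ) (b : ℤ) (k : ℕ), ψ (a, b, k) := by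
    rw [vert, vert, ordered_apply, ordered_apply]
    refine finsum_congr fun a => ?_
    have e1 := ((coeffInt a (expSum (creat n)) *
      coeffInt (x + a) (expSum (annih m))).toAddMonoidHom).map_finsum
        (ordered_finite (expSum (creat n')) (annih_lowering m') y v)
    refine e1.trans (finsum_congr fun b => ?_)
    have e2 := ((coeffInt a (expSum (creat n))).toAddMonoidHom).map_finsum (hexch_fin a b)
    change coeffInt a (expSum (creat n)) (coeffInt (x + a) (expSum (annih m))
      (coeffInt b (expSum (creat n')) (coeffInt (y + b) (expSum (annih m')) v))) = _
    rw [hexch a b]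
    refine e2.trans (finsum_congr fun k => ?_)
    change coeffInt a (expSum (creat n)) (c k • _) = _
    rw [map_smul]
    rfl
  -- The creation index `b` of the second operator becomes `b - k` after `k` contractions.
  let E : ℕ × ℤ × ℤ ≃ ℤ × ℤ × ℕ :=
    { toFun := fun t => (t.2.1, t.2.2 + t.1, t.1)
      invFun := fun t => (t.2.2, t.1, t.2.1 - t.2.2)
      left_inv := fun t => by simp
      right_inv := fun t => by simp }
  rw [h1, ← finsum_curry₃ ψ hfin, ← finsum_comp_equiv E,
    finsum_curry (fun t => ψ (E t)) (hfin.preimage E.injective.injOn)]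
  refine finsum_congr fun k => ?_
  unfold bimode
  rw [smul_finsum' _ (bimode_finite n m n' m' hD _ _)]
  refine finsum_congr fun p => ?_
  change c k • quad n m n' m' v _ _ _ _ = c k • quad n m n' m' v _ _ _ _
  congr 2 <;> simp only [E, Equiv.coe_fn_mk] <;> ring

/-- Multiplying the `r`-th coefficients by `ρ ^ r`. -/
def scale (ρ : ℂ) (n : Fin L → ℕ+ → ℂ) : Fin L → ℕ+ → ℂ := fun j r => ρ ^ (r : ℕ) * n j r

theorem creat_scale_add (ρ : ℂ) : creat (scale ρ n + n') =
    (fun r : ℕ+ => ρ ^ (r : ℕ) • creat n r) + creat n' := by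
  funext r
  simp [creat, scale, add_smul, Finset.sum_add_distrib, Finset.smul_sum, smul_smul]

theorem annih_scale_add (ρ : ℂ) : annih (scale ρ m + m') =
    (fun r : ℕ+ => ρ ^ (r : ℕ) • annih m r) + annih m' := by
  funext r
  simp [annih, scale, add_smul, Finset.sum_add_distrib, Finset.smul_sum, smul_smul]

theorem coeffInt_scale_add {A : Type*} [Ring A] [Algebra ℂ A] {a b : ℕ+ → A} {ρ : ℂ}
    (ha : ∀ r s, Commute (a r) (a s)) (hb : ∀ r s, Commute (b r) (b s))
    (hab : ∀ r s, Commute (a r) (b s)) (k : ℤ) :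
    coeffInt k (expSum ((fun r : ℕ+ => ρ ^ (r : ℕ) • a r) + b)) =
      ∑ᶠ i : ℤ, ρ ^ i • (coeffInt i (expSum a) * coeffInt (k - i) (expSum b)) := by
  rw [expSum_add (fun r s => ((ha r s).smul_left _).smul_right _) hb
    (fun r s => (hab r s).smul_left _), coeffInt_mul_of_le _ _ k (N := k.toNat + 1) (by omega)]
  rw [finsum_eq_sum_of_support_subset (s := (Finset.range (k.toNat + 1)).map Nat.castEmbedding)]
  · rw [Finset.sum_map]
    refine Finset.sum_congr rfl fun i _ => ?_
    simp only [Nat.castEmbedding_apply]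
    rw [coeff_expSum_smul_pow, coeffInt_natCast, zpow_natCast, smul_mul_assoc]
  · intro i hi
    rw [Function.mem_support] at hi
    have h0 : 0 ≤ i := by
      by_contra h
      exact hi (by rw [coeffInt_of_neg (by omega)]; simp)
    have h1 : i ≤ k := by
      by_contra h
      exact hi (by rw [coeffInt_of_neg (show k - i < 0 by omega)]; simp)
    simp only [Finset.coe_map, Set.mem_image, Finset.coe_range, Set.mem_Iio,
      Nat.castEmbedding_apply]
    exact ⟨i.toNat, by omega, by omega⟩

theorem coeffInt_scale_finite {A : Type*} [Ring A] [Algebra ℂ A] (a b : ℕ+ → A) (ρ : ℂ) (k : ℤ) :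
    (Function.support fun i : ℤ =>
      ρ ^ i • (coeffInt i (expSum a) * coeffInt (k - i) (expSum b))).Finite := by
  refine (Set.finite_Icc 0 k).subset fun i hi => ?_
  rw [Function.mem_support] at hi
  constructor
  · by_contra h
    exact hi (by rw [coeffInt_of_neg (by omega)]; simp)
  · by_contra h
    exact hi (by rw [coeffInt_of_neg (show k - i < 0 by omega)]; simp)

/-- Specializing `z₁ = p z₂` in the normally ordered product of two vertex operators gives the
vertex operator with the combined coefficients. -/
theorem vert_fused {p : ℂ} (hp : p ≠ 0) (d : ℤ) (v : Fock L) :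
    (vert (scale p n + n') (scale p⁻¹ m + m')).1 d v =
      ∑ᶠ x : ℤ, p ^ (-x) • bimode n m n' m' x (d - x) v := by
  obtain ⟨D, hD⟩ := exists_mem_Fil v
  let ψ : ℤ × ℤ × ℤ → Fock L := fun t =>
    p ^ (t.2.1 - t.2.2) • quad n m n' m' v t.2.1 (t.1 - t.2.1) t.2.2 (d + t.1 - t.2.2)
  have hψ : ∀ t, ψ t ≠ 0 → 0 ≤ t.2.1 ∧ t.2.1 ≤ t.1 ∧ t.1 ≤ D - d ∧ 0 ≤ t.2.2 ∧ t.2.2 ≤ D := by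
    intro t ht
    have := quad_ne_zero n m n' m' hD (right_ne_zero_of_smul ht)
    omega
  have hfin : (Function.support ψ).Finite := by
    refine ((Set.finite_Icc 0 (D - d)).prod ((Set.finite_Icc 0 (D - d)).prod
      (Set.finite_Icc 0 D))).subset fun t ht => ?_
    have := hψ t ht
    simp only [Set.mem_prod, Set.mem_Icc]
    omega
  have h1 : (vert (scale p n + n') (scale p⁻¹ m + m')).1 d v =
      ∑ᶠ (k : ℤ) (a : ℤ) (i : ℤ), ψ (k, a, i) := by
    rw [vert, ordered_apply]
    refine finsum_congr fun k => ?_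
    rw [creat_scale_add, annih_scale_add,
      coeffInt_scale_add (creat_commute n n) (creat_commute n' n') (creat_commute n n'),
      coeffInt_scale_add (annih_commute m m) (annih_commute m' m') (annih_commute m m')]
    have e1 := ((LinearMap.applyₗ (R := ℂ) (M := Fock L) (M₂ := Fock L)
      ((∑ᶠ i : ℤ, p⁻¹ ^ i • (coeffInt i (expSum (annih m)) *
        coeffInt (d + k - i) (expSum (annih m')))) v)).toAddMonoidHom).map_finsum
        (coeffInt_scale_finite (creat n) (creat n') p k)
    refine e1.trans (finsum_congr fun a => ?_)
    have e2 := ((((p ^ a • (coeffInt a (expSum (creat n)) *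
        coeffInt (k - a) (expSum (creat n'))))).comp
          (LinearMap.id)).toAddMonoidHom.comp
        (LinearMap.applyₗ (R := ℂ) (M := Fock L) (M₂ := Fock L) v).toAddMonoidHom).map_finsum
        (coeffInt_scale_finite (annih m) (annih m') p⁻¹ (d + k))
    refine e2.trans (finsum_congr fun i => ?_)
    change p ^ a • (coeffInt a (expSum (creat n))) (coeffInt (k - a) (expSum (creat n'))
      (p⁻¹ ^ i • (coeffInt i (expSum (annih m)) (coeffInt (d + k - i) (expSum (annih m')) v)))) = _
    rw [map_smul, map_smul, smul_smul, inv_zpow', ← zpow_add₀ hp, ← sub_eq_add_neg]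
    rfl
  -- The mode `x` of `z₁` is the annihilation index `i` minus the creation index `a` of the first
  -- operator; the sum over `k` is one over the creation index `k - a` of the second.
  let E : ℤ × ℤ × ℤ ≃ ℤ × ℤ × ℤ :=
    { toFun := fun t => (t.2.1 + t.2.2, t.2.1, t.1 + t.2.1)
      invFun := fun t => (t.2.2 - t.2.1, t.2.1, t.1 - t.2.1)
      left_inv := fun t => by simp
      right_inv := fun t => by simp }
  rw [h1, ← finsum_curry₃ ψ hfin, ← finsum_comp_equiv E,
    finsum_curry (fun t => ψ (E t)) (hfin.preimage E.injective.injOn)]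
  refine finsum_congr fun x => ?_
  unfold bimode
  rw [smul_finsum' _ (bimode_finite n m n' m' hD _ _)]
  refine finsum_congr fun t => ?_
  change p ^ _ • quad n m n' m' v _ _ _ _ = p ^ _ • quad n m n' m' v _ _ _ _
  congr 1
  · congr 1
    simp [E]
  · congr 1 <;> simp only [E, Equiv.coe_fn_mk] <;> ring

end Vertex

/-! ### Power series that expand rational functions -/

section Expansion

theorem eventually_denom_ne_zero (f : RatFunc ℂ) :
    ∀ᶠ u : ℂ in cofinite, Polynomial.eval₂ (RingHom.id ℂ) u f.denom ≠ 0 := by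
  have h := f.denom.finite_setOfPred_isRoot f.denom_ne_zero
  filter_upwards [h.compl_mem_cofinite] with u hu h0
  exact hu h0

theorem eventually_eval_mul (f g : RatFunc ℂ) : ∀ᶠ u : ℂ in cofinite,
    (f * g).eval (RingHom.id ℂ) u = f.eval (RingHom.id ℂ) u * g.eval (RingHom.id ℂ) u := by
  filter_upwards [eventually_denom_ne_zero f, eventually_denom_ne_zero g] with u hf hg
  exact RatFunc.eval_mul _ _ hf hg

theorem eventually_eval_add (f g : RatFunc ℂ) : ∀ᶠ u : ℂ in cofinite,
    (f + g).eval (RingHom.id ℂ) u = f.eval (RingHom.id ℂ) u + g.eval (RingHom.id ℂ) u := by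
  filter_upwards [eventually_denom_ne_zero f, eventually_denom_ne_zero g] with u hf hg
  exact RatFunc.eval_add _ _ hf hg

theorem eventually_eval_sum {ι : Type*} (s : Finset ι) (f : ι → RatFunc ℂ) :
    ∀ᶠ u : ℂ in cofinite, (∑ i ∈ s, f i).eval (RingHom.id ℂ) u =
      ∑ i ∈ s, (f i).eval (RingHom.id ℂ) u := by
  classical
  induction s using Finset.induction_on with
  | empty => simp
  | insert i s hi ih =>
    filter_upwards [ih, eventually_eval_add (f i) (∑ i ∈ s, f i)] with u h1 h2
    rw [Finset.sum_insert hi, Finset.sum_insert hi, h2, h1]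

theorem eventually_eval_inv {f : RatFunc ℂ} (hf : f ≠ 0) : ∀ᶠ u : ℂ in cofinite,
    (f⁻¹).eval (RingHom.id ℂ) u = (f.eval (RingHom.id ℂ) u)⁻¹ := by
  filter_upwards [eventually_eval_mul f⁻¹ f] with u h
  rw [inv_mul_cancel₀ hf, RatFunc.eval_one] at h
  exact eq_inv_of_mul_eq_one_left h.symm

theorem eventually_eval_pow (f : RatFunc ℂ) (k : ℕ) : ∀ᶠ u : ℂ in cofinite,
    (f ^ k).eval (RingHom.id ℂ) u = f.eval (RingHom.id ℂ) u ^ k := by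
  induction k with
  | zero => simp
  | succ k ih =>
    filter_upwards [ih, eventually_eval_mul (f ^ k) f] with u h1 h2
    rw [pow_succ, h2, h1, pow_succ]

theorem eventually_eval_X_zpow (n : ℤ) : ∀ᶠ u : ℂ in cofinite,
    ((RatFunc.X : RatFunc ℂ) ^ n).eval (RingHom.id ℂ) u = u ^ n := by
  rcases n with k | k
  · filter_upwards [eventually_eval_pow RatFunc.X k] with u h
    simpa using h
  · filter_upwards [eventually_eval_pow RatFunc.X (k + 1),
      eventually_eval_inv (pow_ne_zero (k + 1) (RatFunc.X_ne_zero (K := ℂ)))] with u h1 h2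
    rw [zpow_negSucc, h2, h1, zpow_negSucc, RatFunc.eval_X]

/-- The power series `S` is the expansion at `0` of a rational function which takes the values
`φ u` for all but finitely many `u`. -/
def IsExpansion (S : PowerSeries ℂ) (φ : ℂ → ℂ) : Prop :=
  ∃ f : RatFunc ℂ, (f : LaurentSeries ℂ) = (S : LaurentSeries ℂ) ∧
    ∀ᶠ u : ℂ in cofinite, f.eval (RingHom.id ℂ) u = φ u

theorem IsExpansion.one : IsExpansion 1 1 := ⟨1, by simp, by simp⟩

theorem IsExpansion.mul {S T : PowerSeries ℂ} {φ χ : ℂ → ℂ} (hS : IsExpansion S φ)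
    (hT : IsExpansion T χ) : IsExpansion (S * T) (φ * χ) := by
  obtain ⟨f, hf, hf'⟩ := hS
  obtain ⟨g, hg, hg'⟩ := hT
  refine ⟨f * g, by rw [map_mul, hf, hg, PowerSeries.coe_mul], ?_⟩
  filter_upwards [hf', hg', eventually_eval_mul f g] with u h1 h2 h3
  rw [h3, h1, h2, Pi.mul_apply]

theorem IsExpansion.prod {ι : Type*} (s : Finset ι) {S : ι → PowerSeries ℂ} {φ : ι → ℂ → ℂ}
    (h : ∀ i ∈ s, IsExpansion (S i) (φ i)) : IsExpansion (∏ i ∈ s, S i) (∏ i ∈ s, φ i) := by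
  classical
  induction s using Finset.induction_on with
  | empty => exact IsExpansion.one
  | insert i s hi ih =>
    rw [Finset.prod_insert hi, Finset.prod_insert hi]
    exact (h i (Finset.mem_insert_self _ _)).mul
      (ih fun j hj => h j (Finset.mem_insert_of_mem hj))

theorem IsExpansion.inv {S T : PowerSeries ℂ} {φ : ℂ → ℂ} (hS : IsExpansion S φ)
    (hST : S * T = 1) : IsExpansion T φ⁻¹ := by
  obtain ⟨f, hf, hf'⟩ := hS
  have h1 : (f : LaurentSeries ℂ) * (T : LaurentSeries ℂ) = 1 := by
    rw [hf, ← PowerSeries.coe_mul, hST, PowerSeries.coe_one]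
  have hf0 : f ≠ 0 := by
    rintro rfl
    rw [map_zero, zero_mul] at h1
    exact zero_ne_one h1
  refine ⟨f⁻¹, ?_, ?_⟩
  · rw [map_inv₀]
    exact inv_eq_of_mul_eq_one_right h1
  · filter_upwards [hf', eventually_eval_inv hf0] with u h2 h3
    rw [h3, h2, Pi.inv_apply]

theorem isExpansion_one_sub (y : ℂ) :
    IsExpansion (1 - PowerSeries.C y * PowerSeries.X) (fun u => 1 - y * u) := by
  refine ⟨((1 - Polynomial.C y * Polynomial.X : Polynomial ℂ) : RatFunc ℂ), ?_, ?_⟩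
  · rw [← RatFunc.coe_coe]
    simp
  · refine Eventually.of_forall fun u => ?_
    rw [RatFunc.coePolynomial, RatFunc.eval_algebraMap]
    simp

/-- This is `exp (-log (1 - y w)) = 1 / (1 - y w)`. -/
theorem expSum_geom (y : ℂ) :
    expSum (fun r : ℕ+ => y ^ (r : ℕ) / (r : ℕ)) = PowerSeries.mk fun n => y ^ n := by
  symm
  refine eq_expSum (fun _ _ => Commute.all _ _) ?_ (by simp)
  ext n
  rw [coeff_euler, PowerSeries.coeff_mul, PowerSeries.coeff_mk]
  rw [Finset.Nat.sum_antidiagonal_eq_sum_range_succ (fun i j => PowerSeries.coeff i (euler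
    (posSeries fun r : ℕ+ => y ^ (r : ℕ) / (r : ℕ))) * PowerSeries.coeff j (PowerSeries.mk
      fun n => y ^ n)), Finset.sum_range_succ']
  simp only [coeff_euler, Nat.cast_zero, zero_smul, zero_mul, add_zero, PowerSeries.coeff_mk]
  rw [Finset.sum_congr rfl (g := fun _ => y ^ n), Finset.sum_const, Finset.card_range, nsmul_eq_mul,
    smul_eq_mul]
  intro i hi
  have hi' : i < n := by simpa using hi
  have := coeff_posSeries_pos (fun r : ℕ+ => y ^ (r : ℕ) / (r : ℕ)) ⟨i + 1, i.succ_pos⟩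
  rw [PNat.mk_coe] at this
  rw [this, smul_eq_mul, mul_div_cancel₀ _ (by exact_mod_cast i.succ_ne_zero),
    ← pow_add]
  congr 1
  omega

theorem one_sub_mul_expSum (y : ℂ) : (1 - PowerSeries.C y * PowerSeries.X) *
    expSum (fun r : ℕ+ => y ^ (r : ℕ) / (r : ℕ)) = 1 := by
  rw [expSum_geom]
  ext n
  rw [sub_mul, one_mul, map_sub, mul_assoc, PowerSeries.coeff_C_mul, PowerSeries.coeff_mk]
  rcases n with _ | n
  · simp
  · rw [PowerSeries.coeff_succ_X_mul, PowerSeries.coeff_mk, PowerSeries.coeff_one]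
    simp [pow_succ']

theorem isExpansion_pos (y : ℂ) :
    IsExpansion (expSum fun r : ℕ+ => y ^ (r : ℕ) / (r : ℕ)) (fun u => (1 - y * u)⁻¹) :=
  (isExpansion_one_sub y).inv (one_sub_mul_expSum y)

theorem isExpansion_neg (y : ℂ) :
    IsExpansion (expSum fun r : ℕ+ => -(y ^ (r : ℕ) / (r : ℕ))) (fun u => 1 - y * u) := by
  have h := (isExpansion_pos y).inv (T := expSum fun r : ℕ+ => -(y ^ (r : ℕ) / (r : ℕ))) (by
    rw [← expSum_add (fun _ _ => Commute.all _ _) (fun _ _ => Commute.all _ _)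
      (fun _ _ => Commute.all _ _), ← expSum_zero]
    congr 1
    funext r
    simp)
  convert h using 1
  funext u
  simp

/-- The rational function `(1 - α u) (1 - β u) / ((1 - γ u) (1 - δ u))`. -/
noncomputable def crossRatio (α β γ δ u : ℂ) : ℂ :=
  (1 - α * u) * (1 - β * u) / ((1 - γ * u) * (1 - δ * u))

theorem isExpansion_crossRatio (α β γ δ : ℂ) : IsExpansion
    (expSum fun r : ℕ+ => (γ ^ (r : ℕ) + δ ^ (r : ℕ) - α ^ (r : ℕ) - β ^ (r : ℕ)) / (r : ℕ))
    (crossRatio α β γ δ) := by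
  have h := ((isExpansion_neg α).mul (isExpansion_neg β)).mul
    ((isExpansion_pos γ).mul (isExpansion_pos δ))
  have hc : ∀ f g : ℕ+ → ℂ, expSum f * expSum g = expSum (f + g) := fun f g =>
    (expSum_add (fun _ _ => Commute.all _ _) (fun _ _ => Commute.all _ _)
      (fun _ _ => Commute.all _ _)).symm
  rw [hc, hc, hc] at h
  convert h using 1
  · congr 1
    funext r
    simp only [Pi.add_apply]
    ring
  · funext u
    simp only [crossRatio, Pi.mul_apply]
    rw [div_eq_mul_inv, mul_inv]

end Expansion

/-! ### Fusion of vertex operators -/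

section Fusion

variable {L : ℕ}

theorem coeff_coe_eq_coeffInt (S : PowerSeries ℂ) (n : ℤ) :
    (S : LaurentSeries ℂ).coeff n = coeffInt n S := by
  rw [PowerSeries.coeff_coe, coeffInt]
  split_ifs with h1 h2 h2
  · omega
  · rfl
  · rw [show n.natAbs = n.toNat by omega]
  · omega

/-- A convolution with the coefficients of a power series, written as a sum over the finite support
of the other factor. -/
theorem finsum_coeff_smul {V : Type*} [AddCommGroup V] [Module ℂ V] (S : PowerSeries ℂ)
    (β : ℤ → V) (s : Finset ℤ) (hs : ∀ x ∉ s, β x = 0) (y : ℤ) :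
    ∑ᶠ k : ℕ, PowerSeries.coeff k S • β (y - k) = ∑ x ∈ s, coeffInt (y - x) S • β x := by
  classical
  rw [finsum_eq_sum_of_support_subset (s := (s.filter (· ≤ y)).image fun x => (y - x).toNat),
    Finset.sum_image]
  · rw [Finset.sum_filter]
    refine Finset.sum_congr rfl fun x _ => ?_
    split_ifs with h
    · rw [coeffInt, if_pos (by omega)]
      congr 2
      omega
    · rw [coeffInt_of_neg (by omega), zero_smul]
  · intro a ha b hb hab
    simp only [Finset.coe_filter, Set.mem_ofPred_eq] at ha hb hab
    omega
  · intro k hk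
    simp only [Finset.coe_image, Finset.coe_filter, Set.mem_image, Set.mem_ofPred_eq]
    have h0 := right_ne_zero_of_smul (Function.mem_support.1 hk)
    refine ⟨y - k, ⟨?_, by omega⟩, by omega⟩
    by_contra hc
    exact h0 (hs _ hc)

/-- The product of two vertex operators has the expected fusion limit: the normally ordered product
at `z₁ = p z₂`, times the limit of the rational function that the structure function and the
contraction expand. -/
theorem isFusionLimit_vert {G : PowerSeries ℂ} {p : ℂ} (hp : p ≠ 0)
    (n m n' m' : Fin L → ℕ+ → ℂ) {φ : ℂ → ℂ}
    (hφ : IsExpansion (G * expSum (pairing m n')) φ) {l : ℂ}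
    (hl : Tendsto (fun u => (1 - p * u) * φ u) (𝓝[≠] p⁻¹) (𝓝 l)) :
    IsFusionLimit G p (vert n m) (vert n' m')
      (l • vert (scale p n + n') (scale p⁻¹ m + m')) := by
  intro v t d
  obtain ⟨D, hD⟩ := exists_mem_Fil v
  obtain ⟨R, hR, hR'⟩ := hφ
  -- For a fixed total mode `d`, the normally ordered product is a Laurent polynomial in `u`, so
  -- that the matrix element expands `R` times a Laurent polynomial.
  set β : ℤ → Fock L := fun x => bimode n m n' m' x (d - x) v with hβ
  set s : Finset ℤ := Finset.Icc (d - D) D with hs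
  have hβs : ∀ x ∉ s, β x = 0 := by
    intro x hx
    simp only [hs, Finset.mem_Icc, not_and_or, not_le] at hx
    exact bimode_eq_zero n m n' m' hD (by omega)
  refine ⟨R * ∑ x ∈ s, RatFunc.C (MvPolynomial.coeff t (β x)) * RatFunc.X ^ x, fun M => ?_, ?_⟩
  · have hcomp : ∀ k : ℕ, (vert n m).1 (M - k) ((vert n' m').1 (d - M + k) v) =
        ∑ x ∈ s, coeffInt (M - x - k) (expSum (pairing m n')) • β x := by
      intro k
      rw [vert_comp]
      have := finsum_coeff_smul (expSum (pairing m n')) β s hβs (M - k)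
      simp only [hβ] at this ⊢
      rw [finsum_congr fun l => ?_, this.trans (Finset.sum_congr rfl fun x _ => ?_)]
      · rw [show M - k - x = M - x - k by ring]
      · rw [show d - (M - k - l) = d - M + k + l by ring]
    have hsum : ∑ᶠ k : ℕ, PowerSeries.coeff k G • (vert n m).1 (M - k)
        ((vert n' m').1 (d - M + k) v) =
        ∑ x ∈ s, coeffInt (M - x) (G * expSum (pairing m n')) • β x := by
      rw [finsum_eq_sum_of_support_subset (s := Finset.range ((M - (d - D)).toNat + 1))]
      · simp only [hcomp, Finset.smul_sum, smul_smul]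
        rw [Finset.sum_comm]
        refine Finset.sum_congr rfl fun x hx => ?_
        rw [← Finset.sum_smul, ← coeffInt_mul_of_le]
        simp only [hs, Finset.mem_Icc] at hx
        omega
      · intro k hk
        rw [Function.mem_support, hcomp] at hk
        rw [Finset.coe_range, Set.mem_Iio]
        by_contra hlt
        refine hk ?_
        rw [Finset.sum_eq_zero, smul_zero]
        intro x hx
        simp only [hs, Finset.mem_Icc] at hx
        rw [coeffInt_of_neg (by omega), zero_smul]
    rw [hsum, map_mul, hR, map_sum, Finset.mul_sum, HahnSeries.coeff_sum]
    rw [MvPolynomial.coeff_sum]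
    refine Finset.sum_congr rfl fun x _ => ?_
    have hX : ((RatFunc.C (MvPolynomial.coeff t (β x)) * RatFunc.X ^ x : RatFunc ℂ) :
        LaurentSeries ℂ) = HahnSeries.single x (MvPolynomial.coeff t (β x)) := by
      have hC : ∀ c : ℂ, ((RatFunc.C c : RatFunc ℂ) : LaurentSeries ℂ) = HahnSeries.C c := by
        intro c
        rw [← RatFunc.algebraMap_C, ← IsScalarTower.algebraMap_apply]
        simp
      rw [map_mul, map_zpow₀, RatFunc.coe_X, ← RatFunc.single_zpow, hC, HahnSeries.C_apply,
        HahnSeries.single_mul_single, zero_add, mul_one]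
    rw [hX, MvPolynomial.coeff_smul, ← coeff_coe_eq_coeffInt]
    have := HahnSeries.coeff_mul_single_add (r := MvPolynomial.coeff t (β x))
      (x := ((G * expSum (pairing m n') : PowerSeries ℂ) : LaurentSeries ℂ)) (a := M - x) (b := x)
    rw [sub_add_cancel] at this
    rw [this, smul_eq_mul]
  · have hval : MvPolynomial.coeff t ((l • vert (scale p n + n') (scale p⁻¹ m + m')).1 d v) =
        l * ∑ x ∈ s, MvPolynomial.coeff t (β x) * p⁻¹ ^ x := by
      change MvPolynomial.coeff t (l • (vert (scale p n + n') (scale p⁻¹ m + m')).1 d v) = _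
      rw [vert_fused n m n' m' hp, finsum_eq_sum_of_support_subset (s := s),
        MvPolynomial.coeff_smul, MvPolynomial.coeff_sum, smul_eq_mul]
      · congr 1
        refine Finset.sum_congr rfl fun x _ => ?_
        rw [MvPolynomial.coeff_smul, smul_eq_mul, mul_comm, inv_zpow']
      · intro x hx
        by_contra hc
        exact right_ne_zero_of_smul (Function.mem_support.1 hx) (hβs x hc)
    rw [hval]
    have hlim : Tendsto (fun u : ℂ => (1 - p * u) * φ u *
        ∑ x ∈ s, MvPolynomial.coeff t (β x) * u ^ x) (𝓝[≠] p⁻¹)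
        (𝓝 (l * ∑ x ∈ s, MvPolynomial.coeff t (β x) * p⁻¹ ^ x)) := by
      refine hl.mul (tendsto_finsetSum _ fun x _ => Tendsto.const_mul _ ?_)
      exact ((continuousAt_zpow₀ _ x (Or.inl (inv_ne_zero hp))).tendsto).mono_left
        nhdsWithin_le_nhds
    refine hlim.congr' ?_
    have hcof : 𝓝[≠] p⁻¹ ≤ cofinite := nhdsNE_le_cofinite _
    have hterm : ∀ᶠ u : ℂ in cofinite, ∀ x ∈ s,
        (RatFunc.C (MvPolynomial.coeff t (β x)) * RatFunc.X ^ x : RatFunc ℂ).eval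
          (RingHom.id ℂ) u = MvPolynomial.coeff t (β x) * u ^ x := by
      rw [Filter.eventually_all_finset]
      intro x _
      filter_upwards [eventually_eval_mul (RatFunc.C (MvPolynomial.coeff t (β x)))
        (RatFunc.X ^ x), eventually_eval_X_zpow x] with u h1 h2
      rw [h1, h2, RatFunc.eval_C, RingHom.id_apply]
    filter_upwards [hcof hR', hcof hterm, hcof (eventually_eval_mul R (∑ x ∈ s,
      RatFunc.C (MvPolynomial.coeff t (β x)) * RatFunc.X ^ x)), hcof (eventually_eval_sum s
        fun x => RatFunc.C (MvPolynomial.coeff t (β x)) * RatFunc.X ^ x)] with u h1 h2 h3 h4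
    rw [h3, h4, h1, mul_assoc, Finset.sum_congr rfl h2]

/-- The sums in a fusion relation are finite on every vector. -/
theorem IsFusionLimit.finite {G : PowerSeries ℂ} (A B : Current L) (v : Fock L) (M d : ℤ) :
    (Function.support fun k : ℕ =>
      PowerSeries.coeff k G • A.1 (M - k) (B.1 (d - M + k) v)).Finite := by
  obtain ⟨K, hK⟩ := B.2 v
  refine (Set.finite_Iic (K - (d - M)).toNat).subset fun k hk => ?_
  rw [Function.mem_support] at hk
  rw [Set.mem_Iic]
  by_contra hlt
  exact hk (by rw [hK _ (by omega), map_zero, smul_zero])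

/-- A fusion limit of linear combinations is the corresponding linear combination of the limits. -/
theorem IsFusionLimit.sum {G : PowerSeries ℂ} {p : ℂ} {ι : Type*} (s : Finset ι)
    (a : ι → ℂ) (A B Y : ι → Current L) (X Z W : Current L)
    (h : ∀ i ∈ s, IsFusionLimit G p (A i) (B i) (Y i)) (hW : W = ∑ i ∈ s, a i • Y i)
    (hX : ∀ (x y : ℤ) (v : Fock L), X.1 x (Z.1 y v) =
      ∑ i ∈ s, a i • (A i).1 x ((B i).1 y v)) :
    IsFusionLimit G p X Z W := by
  intro v t d
  choose! f hf hf' using fun i hi => h i hi v t d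
  refine ⟨∑ i ∈ s, RatFunc.C (a i) * f i, fun M => ?_, ?_⟩
  · have hsum : ∑ᶠ k : ℕ, PowerSeries.coeff k G • X.1 (M - k) (Z.1 (d - M + k) v) =
        ∑ i ∈ s, a i • ∑ᶠ k : ℕ, PowerSeries.coeff k G •
          (A i).1 (M - k) ((B i).1 (d - M + k) v) := by
      simp only [hX, Finset.smul_sum]
      rw [finsum_sum_comm]
      · refine Finset.sum_congr rfl fun i _ => ?_
        rw [smul_finsum' _ (IsFusionLimit.finite _ _ _ _ _)]
        simp only [smul_comm (a i)]
      · intro i _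
        refine (IsFusionLimit.finite (G := G) (A i) (B i) v M d).subset fun k hk => ?_
        rw [Function.mem_support, smul_comm] at hk
        exact right_ne_zero_of_smul hk
    rw [hsum, MvPolynomial.coeff_sum, map_sum, HahnSeries.coeff_sum]
    refine Finset.sum_congr rfl fun i hi => ?_
    have hC : ((RatFunc.C (a i) : RatFunc ℂ) : LaurentSeries ℂ) = HahnSeries.C (a i) := by
      rw [← RatFunc.algebraMap_C, ← IsScalarTower.algebraMap_apply]
      simp
    rw [map_mul, hC, HahnSeries.C_mul_eq_smul, HahnSeries.coeff_smul, hf i hi,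
      MvPolynomial.coeff_smul]
  · have hval : MvPolynomial.coeff t (W.1 d v) =
        ∑ i ∈ s, a i * MvPolynomial.coeff t ((Y i).1 d v) := by
      have : W.1 d v = ∑ i ∈ s, a i • (Y i).1 d v := by
        rw [hW, Submodule.coe_sum, Finset.sum_apply, LinearMap.sum_apply]
        rfl
      rw [this, MvPolynomial.coeff_sum]
      simp
    rw [hval]
    refine (tendsto_finsetSum s fun i hi => (hf' i hi).const_mul (a i)).congr' ?_
    have hcof : 𝓝[≠] p⁻¹ ≤ cofinite := nhdsNE_le_cofinite _
    have hterm : ∀ᶠ u : ℂ in cofinite, ∀ i ∈ s, (RatFunc.C (a i) * f i).eval (RingHom.id ℂ) u =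
        a i * (f i).eval (RingHom.id ℂ) u := by
      rw [Filter.eventually_all_finset]
      intro i _
      filter_upwards [eventually_eval_mul (RatFunc.C (a i)) (f i)] with u h1
      rw [h1, RatFunc.eval_C, RingHom.id_apply]
    filter_upwards [hcof hterm, hcof (eventually_eval_sum s
      fun i => RatFunc.C (a i) * f i)] with u h1 h2
    rw [h2, Finset.mul_sum]
    refine Finset.sum_congr rfl fun i hi => ?_
    rw [h1 i hi]
    ring

/-- Limits are unique, as a Laurent series is the expansion of at most one rational function. -/
theorem IsFusionLimit.unique {G : PowerSeries ℂ} {p : ℂ} {A B Y Y' : Current L}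
    (h : IsFusionLimit G p A B Y) (h' : IsFusionLimit G p A B Y') : Y = Y' := by
  refine Subtype.ext (funext fun d => LinearMap.ext fun v => MvPolynomial.ext _ _ fun t => ?_)
  obtain ⟨f, hf, hl⟩ := h v t d
  obtain ⟨f', hf', hl'⟩ := h' v t d
  have : f = f' := by
    have hff : (f : LaurentSeries ℂ) = (f' : LaurentSeries ℂ) := by
      ext M
      rw [hf, hf']
    exact RingHom.injective _ hff
  subst this
  exact tendsto_nhds_unique hl hl'

end Fusion

namespace Data

variable {L : ℕ} {D : Data L}

/-! ### Generic parameters -/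

/-- The genericity assumptions on the parameters. They make `κ_r`, `b_c`, `c_λ` and the values of
`d_λ` that occur finite and nonzero. -/
structure Generic (D : Data L) : Prop where
  norm_pos : 0 < ‖D.x‖
  norm_lt : ‖D.x‖ < 1
  lam_sum : D.lam 0 + D.lam 1 + D.lam 2 = 0
  indep : ∀ l m n : ℤ, D.q 0 ^ l * D.q 1 ^ m * D.q 2 ^ n = 1 → l = m ∧ m = n
  mu_pow : ∀ m : ℕ, 1 ≤ m → D.mu ^ m ≠ 1
  u_ne : ∀ i, D.u i ≠ 0

namespace Generic

variable (hD : D.Generic)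

set_option linter.unusedSectionVars false

include hD

theorem x_ne : D.x ≠ 0 := norm_pos_iff.1 hD.norm_pos

theorem x_sub_inv_ne : D.x - D.x⁻¹ ≠ 0 := by
  intro h
  have h1 : D.x * D.x = 1 := by
    rw [sub_eq_zero] at h
    nth_rewrite 2 [h]
    exact mul_inv_cancel₀ hD.x_ne
  have h2 : ‖D.x‖ * ‖D.x‖ = 1 := by rw [← norm_mul, h1, norm_one]
  nlinarith [hD.norm_lt, hD.norm_pos]

theorem s_ne (c : Fin 3) : D.s c ≠ 0 := by
  rw [s, Ne, Complex.cpow_eq_zero_iff]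
  exact fun h => hD.x_ne h.1

theorem q_eq (c : Fin 3) : D.q c = D.s c ^ 2 := by
  rw [q, s, ← Complex.cpow_nat_mul]
  norm_num

theorem q_ne (c : Fin 3) : D.q c ≠ 0 := by
  rw [hD.q_eq]
  exact pow_ne_zero _ (hD.s_ne c)

theorem s_prod : D.s 0 * D.s 1 * D.s 2 = 1 := by
  rw [s, s, s, ← Complex.cpow_add _ _ hD.x_ne, ← Complex.cpow_add _ _ hD.x_ne,
    ← Complex.ofReal_add, ← Complex.ofReal_add, hD.lam_sum]
  simp

theorem q_prod : D.q 0 * D.q 1 * D.q 2 = 1 := by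
  rw [hD.q_eq, hD.q_eq, hD.q_eq, ← mul_pow, ← mul_pow, hD.s_prod, one_pow]

theorem q_zpow_ne (c : Fin 3) {l : ℤ} (hl : l ≠ 0) : D.q c ^ l ≠ 1 := by
  intro h
  fin_cases c
  · have := hD.indep l 0 0 (by simpa using h)
    omega
  · have := hD.indep 0 l 0 (by simpa using h)
    omega
  · have := hD.indep 0 0 l (by simpa using h)
    omega

theorem q_pow_ne (c : Fin 3) {l : ℕ} (hl : l ≠ 0) : D.q c ^ l ≠ 1 := by
  have := hD.q_zpow_ne c (l := l) (by omega)
  rwa [zpow_natCast] at this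

theorem q_mul_zpow_ne {c : Fin 3} (hc : c ≠ 1) (k : ℤ) : D.q c * D.q 1 ^ k ≠ 1 := by
  intro h
  fin_cases c
  · have := hD.indep 1 k 0 (by simpa using h)
    omega
  · exact hc rfl
  · have := hD.indep 0 k 1 (by rw [zpow_zero, one_mul, zpow_one, mul_comm]; exact h)
    omega

theorem one_sub_q_pow_ne (c : Fin 3) (r : ℕ+) : 1 - D.q c ^ (r : ℕ) ≠ 0 :=
  sub_ne_zero.2 (hD.q_pow_ne c r.ne_zero).symm

theorem one_sub_mu_pow_ne (r : ℕ+) : 1 - D.mu ^ (r : ℕ) ≠ 0 :=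
  sub_ne_zero.2 (hD.mu_pow r r.pos).symm

theorem kappa_ne (r : ℕ+) : D.kappa r ≠ 0 :=
  Finset.prod_ne_zero_iff.2 fun c _ => hD.one_sub_q_pow_ne c r

theorem s_sub_inv_ne (c : Fin 3) (r : ℕ+) : D.s c ^ (r : ℕ) - (D.s c ^ (r : ℕ))⁻¹ ≠ 0 := by
  intro h
  have hs := pow_ne_zero (r : ℕ) (hD.s_ne c)
  refine hD.one_sub_q_pow_ne c r ?_
  rw [hD.q_eq, ← pow_mul, mul_comm, pow_mul]
  field_simp at h
  linear_combination -h

theorem b_ne (c : Fin 3) : D.b c ≠ 0 := by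
  rw [b, neg_div, neg_ne_zero]
  refine div_ne_zero ?_ (hD.kappa_ne 1)
  simpa using hD.s_sub_inv_ne c 1

theorem a_ne (i : Fin L) : D.a i ≠ 0 :=
  Finset.prod_ne_zero_iff.2 fun _ _ => inv_ne_zero (hD.s_ne _)

end Generic

/-! ### The dressed currents as vertex operators -/

variable (D)

/-- The scalar `[h_r, h_{-r}]` in the `j`-th tensor factor. -/
noncomputable def heis (j : Fin L) (r : ℕ+) : ℂ :=
  ((D.s (D.col j)) ^ (r : ℕ) - ((D.s (D.col j)) ^ (r : ℕ))⁻¹) / (((r : ℕ) : ℂ) * D.kappa r)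

/-- The creation coefficients of the dressed current `𝚲_i`. -/
noncomputable def dressedNeg (i j : Fin L) (r : ℕ+) : ℂ :=
  if i = j then D.kappa r / (1 - D.q (D.col i) ^ (r : ℕ)) * D.a i ^ (r : ℕ) else 0

/-- The annihilation coefficients of the undressed current `Λ_i`. -/
noncomputable def barePos (i j : Fin L) (r : ℕ+) : ℂ :=
  (if i = j then D.kappa r / (1 - D.q (D.col i) ^ (r : ℕ)) * D.s (D.col i) ^ (r : ℕ) *
    (D.a i ^ (r : ℕ))⁻¹ * D.heis i r else 0) +
  if i < j then D.kappa r * (((D.s (D.col j))⁻¹ * D.a j) ^ (r : ℕ))⁻¹ * D.heis j r else 0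

/-- The annihilation coefficients of the dressing factor. -/
noncomputable def dressPos (j : Fin L) (r : ℕ+) : ℂ :=
  -((1 - D.mu ^ (r : ℕ))⁻¹ * (D.kappa r * (((D.s (D.col j))⁻¹ * D.a j) ^ (r : ℕ))⁻¹ * D.heis j r))

theorem annih_add (m m' : Fin L → ℕ+ → ℂ) : annih (m + m') = annih m + annih m' := by
  funext r
  simp [annih, add_smul, Finset.sum_add_distrib]

theorem lamNeg_eq (i : Fin L) : D.lamNeg i = expSum (creat (D.dressedNeg i)) := by
  rw [lamNeg]
  congr 1
  funext r
  simp [creat, dressedNeg, vNegExp, hNeg]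

theorem lamPos_eq (i : Fin L) : D.lamPos i = expSum (annih (D.barePos i)) := by
  rw [lamPos]
  congr 1
  funext r
  simp only [annih, barePos, vPosExp, psiExp, hPos, add_smul, Finset.sum_add_distrib, ite_smul,
    zero_smul, Finset.sum_ite_eq, Finset.mem_univ, if_true, smul_smul, heis]
  congr 1
  rw [← Finset.sum_filter]
  refine Finset.sum_congr ?_ fun _ _ => rfl
  ext j
  simp

theorem dressing_eq : D.dressing = expSum (annih D.dressPos) := by
  rw [dressing]
  congr 1
  funext r
  simp only [annih, dressPos, kExp, psiExp, hPos, smul_smul, Finset.smul_sum, heis]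
  rw [← Finset.sum_neg_distrib]
  exact Finset.sum_congr rfl fun j _ => (neg_smul _ _).symm

theorem ordered_congr {N N' M M' : PowerSeries (Module.End ℂ (Fock L))} (hM : Lowering M)
    (hM' : Lowering M') (h : N = N') (h' : M = M') : ordered N M hM = ordered N' M' hM' := by
  subst h h'
  rfl

theorem dressed_eq (i : Fin L) :
    D.dressed i = D.u i • vert (D.dressedNeg i) (D.barePos i + D.dressPos) := by
  rw [dressed, vert]
  congr 1
  refine ordered_congr _ _ (D.lamNeg_eq i) ?_
  rw [lamPos_eq, dressing_eq, annih_add, expSum_add (annih_commute _ _) (annih_commute _ _)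
    (annih_commute _ _)]

variable {D}

/-- The contractions of the dressed currents. -/
theorem pairing_dressed (hD : D.Generic) (i j : Fin L) (r : ℕ+) :
    pairing (D.barePos i + D.dressPos) (D.dressedNeg j) r = D.kappa r / (r : ℕ) *
      ((1 - D.mu ^ (r : ℕ))⁻¹ - (if i = j then (1 - D.q (D.col i) ^ (r : ℕ))⁻¹ else 0) -
        if i < j then 1 else 0) := by
  have hr : ((r : ℕ) : ℂ) ≠ 0 := by exact_mod_cast r.ne_zero
  have hk := hD.kappa_ne r
  have hq := hD.one_sub_q_pow_ne (D.col j) r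
  have hs := pow_ne_zero (r : ℕ) (hD.s_ne (D.col j))
  have ha := pow_ne_zero (r : ℕ) (hD.a_ne j)
  have hmu := hD.one_sub_mu_pow_ne r
  have hqs : D.q (D.col j) ^ (r : ℕ) = (D.s (D.col j) ^ (r : ℕ)) ^ 2 := by
    rw [hD.q_eq, ← pow_mul, ← pow_mul, mul_comm]
  have e : pairing (D.barePos i + D.dressPos) (D.dressedNeg j) r =
      (D.barePos i j r + D.dressPos j r) *
        (D.kappa r / (1 - D.q (D.col j) ^ (r : ℕ)) * D.a j ^ (r : ℕ)) := by
    simp [pairing, dressedNeg]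
  simp only [e, barePos, dressPos, heis]
  rw [mul_pow, inv_pow]
  rw [hqs] at hq ⊢
  rcases lt_trichotomy i j with h | h | h
  · rw [if_neg h.ne, if_pos h, if_neg h.ne, if_pos h]
    field_simp
    ring
  · subst h
    rw [if_pos rfl, if_neg (lt_irrefl _), if_pos rfl, if_neg (lt_irrefl _), hqs]
    field_simp
    ring
  · rw [if_neg h.ne', if_neg h.not_gt, if_neg h.ne', if_neg h.not_gt]
    field_simp
    ring

variable (D)

/-! ### The rational functions of the operator products -/

/-- First zero parameter of `pairFn`. The contraction of `𝚲_i(z₁) 𝚲_j(z₂)` depends on the order of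
`i` and `j`, and on the colour only for `i = j`. -/
noncomputable def zeroA (i j : Fin L) : ℂ :=
  if j < i then D.q 0 else if i < j then (D.q 0)⁻¹ else D.q (D.col i)

/-- Second zero parameter of `pairFn`. -/
noncomputable def zeroB (i j : Fin L) : ℂ :=
  if j < i then D.q 2 else if i < j then (D.q 2)⁻¹ else (D.q (D.col i))⁻¹

/-- First pole parameter of `pairFn`. -/
noncomputable def poleA (i j : Fin L) : ℂ := if j < i then (D.q 1)⁻¹ else D.q 1

/-- Second pole parameter of `pairFn`. -/
noncomputable def poleB (i j : Fin L) : ℂ := if i = j then (D.q 1)⁻¹ else 1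

/-- The rational function of `v = z₂ / z₁` expanded by `g_{1,1}(v)` times the contraction of
`𝚲_i(z₁) 𝚲_j(z₂)`. -/
noncomputable def pairFn (i j : Fin L) : ℂ → ℂ :=
  crossRatio (D.zeroA i j) (D.zeroB i j) (D.poleA i j) (D.poleB i j)

/-- The rational function by whose shifts `g_{m,n}` differs from a product of shifts of
`g_{1,1}`. -/
noncomputable def corrFn : ℂ → ℂ := crossRatio 1 (D.q 1)⁻¹ (D.q 0) (D.q 2)

/-- The position `s_2 ^ (m - 1 - 2 a)` of the `a`-th current in the fusion of `m` of them. -/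
noncomputable def pos (m a : ℕ) : ℂ := D.s 1 ^ ((m : ℤ) - 1 - 2 * a)

/-- The creation coefficients of the normally ordered product of the currents `𝚲_{I a}` at
their positions. -/
noncomputable def tupleNeg {m : ℕ} (I : Fin m → Fin L) : Fin L → ℕ+ → ℂ :=
  ∑ a : Fin m, scale (D.pos m a) (D.dressedNeg (I a))

/-- The annihilation coefficients of the normally ordered product of the currents `𝚲_{I a}` at
their positions. -/
noncomputable def tuplePos {m : ℕ} (I : Fin m → Fin L) : Fin L → ℕ+ → ℂ :=
  ∑ a : Fin m, scale (D.pos m a)⁻¹ (D.barePos (I a) + D.dressPos)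

/-- The contraction of two normally ordered products is the sum of the contractions of the pairs. -/
theorem pairing_sum_scale {ι κ : Type*} [Fintype ι] [Fintype κ] (x : ι → ℂ) (y : κ → ℂ)
    (m : ι → Fin L → ℕ+ → ℂ) (n : κ → Fin L → ℕ+ → ℂ) (r : ℕ+) :
    pairing (∑ a, scale (x a) (m a)) (∑ b, scale (y b) (n b)) r =
      ∑ a, ∑ b, (x a * y b) ^ (r : ℕ) * pairing (m a) (n b) r := by
  simp only [pairing, Finset.sum_apply, scale, Finset.sum_mul_sum]
  rw [Finset.sum_comm]
  refine Finset.sum_congr rfl fun a _ => ?_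
  rw [Finset.sum_comm]
  refine Finset.sum_congr rfl fun b _ => ?_
  rw [Finset.mul_sum]
  refine Finset.sum_congr rfl fun j _ => ?_
  rw [mul_pow]
  ring

variable {D}

/-- The exponent of `g_{1,1}` without the part depending on `μ`, times the summation index. -/
noncomputable def baseExp (D : Data L) (r : ℕ+) : ℂ :=
  (1 - D.q 0 ^ (r : ℕ)) * (1 - D.q 2 ^ (r : ℕ))

theorem q_pow_prod (hD : D.Generic) (r : ℕ) : D.q 0 ^ r * D.q 1 ^ r * D.q 2 ^ r = 1 := by
  rw [← mul_pow, ← mul_pow, hD.q_prod, one_pow]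

/-- Up to a term that depends on neither `i` nor `j`, the contraction of two dressed currents is the
exponent of `pairFn i j`. -/
theorem pairing_dressed_eq (hD : D.Generic) (i j : Fin L) (r : ℕ+) :
    pairing (D.barePos i + D.dressPos) (D.dressedNeg j) r =
      (D.kappa r * (1 - D.mu ^ (r : ℕ))⁻¹ - D.baseExp r) / (r : ℕ) +
      (D.poleA i j ^ (r : ℕ) + D.poleB i j ^ (r : ℕ) - D.zeroA i j ^ (r : ℕ) -
        D.zeroB i j ^ (r : ℕ)) / (r : ℕ) := by
  have hr : ((r : ℕ) : ℂ) ≠ 0 := by exact_mod_cast r.ne_zero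
  have h0 := pow_ne_zero (r : ℕ) (hD.q_ne 0)
  have h1 := pow_ne_zero (r : ℕ) (hD.q_ne 1)
  have h2 := pow_ne_zero (r : ℕ) (hD.q_ne 2)
  have hp := q_pow_prod hD r
  have hk : D.kappa r =
      (1 - D.q 0 ^ (r : ℕ)) * (1 - D.q 1 ^ (r : ℕ)) * (1 - D.q 2 ^ (r : ℕ)) := by
    rw [kappa, Fin.prod_univ_three]
  have e0 : (D.q 0 ^ (r : ℕ))⁻¹ = D.q 1 ^ (r : ℕ) * D.q 2 ^ (r : ℕ) :=
    inv_eq_of_mul_eq_one_right (by rw [← mul_assoc]; exact hp)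
  have e2 : (D.q 2 ^ (r : ℕ))⁻¹ = D.q 0 ^ (r : ℕ) * D.q 1 ^ (r : ℕ) :=
    inv_eq_of_mul_eq_one_left hp
  have e1 : (D.q 1 ^ (r : ℕ))⁻¹ = D.q 0 ^ (r : ℕ) * D.q 2 ^ (r : ℕ) :=
    inv_eq_of_mul_eq_one_left (by linear_combination hp)
  rw [pairing_dressed hD, poleA, poleB, zeroA, zeroB, ← add_div, div_mul_eq_mul_div, baseExp]
  congr 1
  rcases lt_trichotomy i j with h | h | h
  · simp only [h.ne, h.not_gt, h, if_true, if_false, inv_pow, e0, e2, one_pow]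
    rw [hk]
    linear_combination hp
  · subst h
    simp only [lt_irrefl, if_true, if_false, inv_pow, e1]
    have hc : D.col i = 0 ∨ D.col i = 1 ∨ D.col i = 2 := by
      generalize D.col i = c
      fin_cases c <;> simp
    have hq := hD.one_sub_q_pow_ne (D.col i) r
    rw [mul_sub, mul_sub, hk]
    rcases hc with h | h | h
    · rw [h] at hq ⊢
      rw [e0]
      field_simp
      ring
    · rw [h] at hq ⊢
      rw [e1]
      field_simp
      ring
    · rw [h] at hq ⊢
      rw [e2]
      field_simp
      ring
  · simp only [h.ne', h.not_gt, h, if_true, if_false, inv_pow, e1, one_pow]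
    ring

/-- The quantum integer as a symmetric geometric sum. -/
theorem sum_range_zpow {S : ℂ} (hS : S ≠ 0) (hS' : S - S⁻¹ ≠ 0) (m : ℕ) :
    ∑ a ∈ Finset.range m, S ^ ((m : ℤ) - 1 - 2 * a) = (S ^ m - (S ^ m)⁻¹) / (S - S⁻¹) := by
  rw [eq_div_iff hS', Finset.sum_mul]
  have h := Finset.sum_range_sub' (fun a : ℕ => S ^ ((m : ℤ) - 2 * a)) m
  have e : ∀ a : ℕ, S ^ ((m : ℤ) - 1 - 2 * a) * (S - S⁻¹) =
      S ^ ((m : ℤ) - 2 * a) - S ^ ((m : ℤ) - 2 * (a + 1 : ℕ)) := by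
    intro a
    rw [mul_sub, ← zpow_add_one₀ hS, ← zpow_sub_one₀ hS]
    congr 2
    · ring
    · push_cast; ring
  rw [Finset.sum_congr rfl fun a _ => e a, h, show (m : ℤ) - 2 * ((0 : ℕ) : ℤ) = m by simp,
    show (m : ℤ) - 2 * (m : ℤ) = -m by ring, zpow_neg, zpow_natCast]

theorem sum_pos_pow (hD : D.Generic) (m : ℕ) (r : ℕ+) :
    ∑ a : Fin m, D.pos m a ^ (r : ℕ) =
      ((D.s 1 ^ (r : ℕ)) ^ m - ((D.s 1 ^ (r : ℕ)) ^ m)⁻¹) /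
        (D.s 1 ^ (r : ℕ) - (D.s 1 ^ (r : ℕ))⁻¹) := by
  rw [← sum_range_zpow (pow_ne_zero _ (hD.s_ne 1)) (hD.s_sub_inv_ne 1 r),
    ← Fin.sum_univ_eq_sum_range (fun a => (D.s 1 ^ (r : ℕ)) ^ ((m : ℤ) - 1 - 2 * a))]
  refine Finset.sum_congr rfl fun a _ => ?_
  rw [pos, ← zpow_natCast, ← zpow_natCast, ← zpow_mul, ← zpow_mul, mul_comm]

theorem sum_pos_inv_pow (hD : D.Generic) (m : ℕ) (r : ℕ+) :
    ∑ a : Fin m, (D.pos m a)⁻¹ ^ (r : ℕ) =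
      ((D.s 1 ^ (r : ℕ)) ^ m - ((D.s 1 ^ (r : ℕ)) ^ m)⁻¹) /
        (D.s 1 ^ (r : ℕ) - (D.s 1 ^ (r : ℕ))⁻¹) := by
  rw [← sum_pos_pow hD, ← Equiv.sum_comp Fin.revPerm]
  refine Finset.sum_congr rfl fun a _ => ?_
  congr 1
  rw [pos, pos, ← zpow_neg, Fin.revPerm_apply, Fin.val_rev]
  congr 1
  have := a.2
  omega

/-- The exponent of the structure function: the parts depending on `μ` and on `min` and `max`
are separated. -/
theorem g_exponent (hD : D.Generic) (m n : ℕ) (r : ℕ+) :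
    (1 / ((r : ℕ) : ℂ)) *
    (D.qint (D.lam 0 * (r : ℕ)) * D.qint (D.lam 2 * (r : ℕ)) *
      D.qint ((min m n : ℕ) * D.lam 1 * (r : ℕ)) *
      D.qint ((D.alpha - (max m n : ℕ) * D.lam 1) * (r : ℕ))) /
    (D.qint (D.lam 1 * (r : ℕ)) * D.qint (D.alpha * (r : ℕ))) * (D.x - D.x⁻¹) ^ 2 =
      -(D.kappa r * (1 - D.mu ^ (r : ℕ))⁻¹ - D.baseExp r) / (r : ℕ) *
        ((((D.s 1 ^ (r : ℕ)) ^ m - ((D.s 1 ^ (r : ℕ)) ^ m)⁻¹) /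
          (D.s 1 ^ (r : ℕ) - (D.s 1 ^ (r : ℕ))⁻¹)) *
        (((D.s 1 ^ (r : ℕ)) ^ n - ((D.s 1 ^ (r : ℕ)) ^ n)⁻¹) /
          (D.s 1 ^ (r : ℕ) - (D.s 1 ^ (r : ℕ))⁻¹))) -
      D.baseExp r / (r : ℕ) * ((((D.s 1 ^ (r : ℕ)) ^ min m n - ((D.s 1 ^ (r : ℕ)) ^ min m n)⁻¹) /
          (D.s 1 ^ (r : ℕ) - (D.s 1 ^ (r : ℕ))⁻¹)) *
        ((((D.s 1 ^ (r : ℕ)) ^ max m n - ((D.s 1 ^ (r : ℕ)) ^ max m n)⁻¹) /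
          (D.s 1 ^ (r : ℕ) - (D.s 1 ^ (r : ℕ))⁻¹)) -
          D.s 1 ^ (r : ℕ) * ((D.s 1 ^ (r : ℕ)) ^ max m n)⁻¹)) := by
  have hx := hD.x_ne
  have hw := hD.x_sub_inv_ne
  have hmm : ((D.s 1 ^ (r : ℕ)) ^ m - ((D.s 1 ^ (r : ℕ)) ^ m)⁻¹) *
      ((D.s 1 ^ (r : ℕ)) ^ n - ((D.s 1 ^ (r : ℕ)) ^ n)⁻¹) =
      ((D.s 1 ^ (r : ℕ)) ^ min m n - ((D.s 1 ^ (r : ℕ)) ^ min m n)⁻¹) *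
      ((D.s 1 ^ (r : ℕ)) ^ max m n - ((D.s 1 ^ (r : ℕ)) ^ max m n)⁻¹) := by
    rcases le_total m n with h | h
    · rw [min_eq_left h, max_eq_right h]
    · rw [min_eq_right h, max_eq_left h, mul_comm]
  rw [div_mul_div_comm (((D.s 1 ^ (r : ℕ)) ^ m - _)), hmm]
  generalize min m n = N
  generalize max m n = M
  have hr : ((r : ℕ) : ℂ) ≠ 0 := by exact_mod_cast r.ne_zero
  have hs : ∀ c : Fin 3, D.x ^ ((D.lam c : ℂ) * (r : ℕ)) = D.s c ^ (r : ℕ) := fun c => by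
    rw [Complex.cpow_mul_nat, s]
  have hN : D.x ^ ((N : ℂ) * D.lam 1 * (r : ℕ)) = (D.s 1 ^ (r : ℕ)) ^ N := by
    rw [Complex.cpow_mul_nat, Complex.cpow_nat_mul, s, ← pow_mul, ← pow_mul, mul_comm]
  have ha : D.x ^ (D.alpha * (r : ℕ)) = (D.x ^ D.alpha) ^ (r : ℕ) := Complex.cpow_mul_nat _ _ _
  have hM : D.x ^ ((D.alpha - M * D.lam 1) * (r : ℕ)) =
      (D.x ^ D.alpha) ^ (r : ℕ) / (D.s 1 ^ (r : ℕ)) ^ M := by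
    rw [Complex.cpow_mul_nat, Complex.cpow_sub _ _ hx, Complex.cpow_nat_mul, div_pow, s, ← pow_mul,
      ← pow_mul, mul_comm M]
  have hmu : D.mu ^ (r : ℕ) = ((D.x ^ D.alpha) ^ (r : ℕ)) ^ 2 := by
    have h : D.mu = (D.x ^ D.alpha) ^ 2 := by
      rw [mu, ← Complex.cpow_nat_mul]
      norm_num
    rw [h, ← pow_mul, ← pow_mul, mul_comm]
  have hmu1 := hD.one_sub_mu_pow_ne r
  have hS0 := pow_ne_zero (r : ℕ) (hD.s_ne 0)
  have hS1 := pow_ne_zero (r : ℕ) (hD.s_ne 1)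
  have hS2 := pow_ne_zero (r : ℕ) (hD.s_ne 2)
  have hS1' := hD.s_sub_inv_ne 1 r
  have hq : ∀ c : Fin 3, D.q c ^ (r : ℕ) = (D.s c ^ (r : ℕ)) ^ 2 := fun c => by
    rw [hD.q_eq, ← pow_mul, ← pow_mul, mul_comm]
  have hk : D.kappa r =
      (1 - D.q 0 ^ (r : ℕ)) * (1 - D.q 1 ^ (r : ℕ)) * (1 - D.q 2 ^ (r : ℕ)) := by
    rw [kappa, Fin.prod_univ_three]
  have hτ : (D.x ^ D.alpha) ^ (r : ℕ) ≠ 0 :=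
    pow_ne_zero _ fun h => hx ((Complex.cpow_eq_zero_iff _ _).1 h).1
  have hp : D.s 0 ^ (r : ℕ) * D.s 1 ^ (r : ℕ) * D.s 2 ^ (r : ℕ) = 1 := by
    rw [← mul_pow, ← mul_pow, hD.s_prod, one_pow]
  -- Everything is now rational in `x ^ (λ_c r)`, `x ^ (α r)`, `x ^ (λ_2 r N)` and `x ^ (λ_2 r M)`.
  simp only [qint, Complex.cpow_neg, hs, hN, ha, hM]
  rw [hk, baseExp, hq, hq, hq, hmu]
  rw [hmu] at hmu1
  generalize (D.x ^ D.alpha) ^ (r : ℕ) = τ at *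
  generalize D.s 0 ^ (r : ℕ) = S0 at *
  generalize D.s 1 ^ (r : ℕ) = S at *
  generalize D.s 2 ^ (r : ℕ) = S2 at *
  have hSN : S ^ N ≠ 0 := pow_ne_zero _ hS1
  have hSM : S ^ M ≠ 0 := pow_ne_zero _ hS1
  generalize S ^ N = X at *
  generalize S ^ M = Y at *
  have e2 : S2 = (S0 * S)⁻¹ := eq_inv_of_mul_eq_one_right hp
  have hw2 : S ^ 2 - 1 ≠ 0 := by
    intro h
    apply hS1'
    field_simp
    linear_combination h
  have hw3 : τ ^ 2 - 1 ≠ 0 := fun h => hmu1 (by linear_combination -h)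
  have e3 : S - S⁻¹ = (S ^ 2 - 1) / S := by field_simp
  have e4 : τ - τ⁻¹ = (τ ^ 2 - 1) / τ := by field_simp
  have e5 : (1 - τ ^ 2)⁻¹ = -(τ ^ 2 - 1)⁻¹ := by rw [← inv_neg, neg_sub]
  subst e2
  rw [e5, e3, e4]
  generalize D.x - D.x⁻¹ = w at *
  field_simp
  ring

theorem isExpansion_scaled (α β γ δ t : ℂ) : IsExpansion
    (expSum fun r : ℕ+ => t ^ (r : ℕ) *
      ((γ ^ (r : ℕ) + δ ^ (r : ℕ) - α ^ (r : ℕ) - β ^ (r : ℕ)) / (r : ℕ)))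
    (fun u => crossRatio α β γ δ (t * u)) := by
  have h := isExpansion_crossRatio (t * α) (t * β) (t * γ) (t * δ)
  convert h using 1
  · congr 1
    funext r
    simp only [mul_pow]
    ring
  · funext u
    simp only [crossRatio]
    ring

/-- The structure function times the contraction of two fused products expands an explicit product
of rational functions. The part of the contractions that depends on `μ` but not on the tuples
cancels against `g_{m,n}`, which leaves the factors `corrFn`. -/
theorem isExpansion_tuple (hD : D.Generic) {m n : ℕ} (hmn : 1 ≤ max m n) (I : Fin m → Fin L)
    (J : Fin n → Fin L) :
    IsExpansion (D.g m n * expSum (pairing (D.tuplePos I) (D.tupleNeg J)))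
      (fun u => (∏ p : Fin m × Fin n,
          D.pairFn (I p.1) (J p.2) ((D.pos m p.1)⁻¹ * D.pos n p.2 * u)) *
        ∏ p ∈ Finset.range (min m n) ×ˢ Finset.range (max m n - 1),
          D.corrFn (D.pos (min m n) p.1 * D.pos (max m n) p.2 * u)) := by
  have h1 := IsExpansion.prod (Finset.univ : Finset (Fin m × Fin n)) fun p _ =>
    isExpansion_scaled (D.zeroA (I p.1) (J p.2)) (D.zeroB (I p.1) (J p.2))
      (D.poleA (I p.1) (J p.2)) (D.poleB (I p.1) (J p.2)) ((D.pos m p.1)⁻¹ * D.pos n p.2)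
  have h2 := IsExpansion.prod (Finset.range (min m n) ×ˢ Finset.range (max m n - 1)) fun p _ =>
    isExpansion_scaled 1 (D.q 1)⁻¹ (D.q 0) (D.q 2) (D.pos (min m n) p.1 * D.pos (max m n) p.2)
  have h3 := h1.mul h2
  rw [← expSum_sum, ← expSum_sum, ← expSum_add (fun _ _ => Commute.all _ _)
    (fun _ _ => Commute.all _ _) (fun _ _ => Commute.all _ _)] at h3
  rw [g, ← expSum_add (fun _ _ => Commute.all _ _) (fun _ _ => Commute.all _ _)
    (fun _ _ => Commute.all _ _)]
  convert h3 using 1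
  · congr 1
    funext r
    simp only [Pi.add_apply, Finset.sum_apply]
    rw [g_exponent hD, tuplePos, tupleNeg, pairing_sum_scale]
    simp only [pairing_dressed_eq hD, mul_add, Finset.sum_add_distrib]
    rw [Fintype.sum_prod_type]
    have e1 : ∑ a : Fin m, ∑ b : Fin n, ((D.pos m a)⁻¹ * D.pos n b) ^ (r : ℕ) *
        ((D.kappa r * (1 - D.mu ^ (r : ℕ))⁻¹ - D.baseExp r) / (r : ℕ)) =
        (D.kappa r * (1 - D.mu ^ (r : ℕ))⁻¹ - D.baseExp r) / (r : ℕ) *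
        ((((D.s 1 ^ (r : ℕ)) ^ m - ((D.s 1 ^ (r : ℕ)) ^ m)⁻¹) /
          (D.s 1 ^ (r : ℕ) - (D.s 1 ^ (r : ℕ))⁻¹)) *
        (((D.s 1 ^ (r : ℕ)) ^ n - ((D.s 1 ^ (r : ℕ)) ^ n)⁻¹) /
          (D.s 1 ^ (r : ℕ) - (D.s 1 ^ (r : ℕ))⁻¹))) := by
      rw [← sum_pos_inv_pow hD, ← sum_pos_pow hD n, Finset.sum_mul_sum, Finset.mul_sum]
      refine Finset.sum_congr rfl fun a _ => ?_
      rw [Finset.mul_sum]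
      refine Finset.sum_congr rfl fun b _ => ?_
      rw [mul_pow, mul_comm]
    have e2 : ∑ p ∈ Finset.range (min m n) ×ˢ Finset.range (max m n - 1),
        (D.pos (min m n) p.1 * D.pos (max m n) p.2) ^ (r : ℕ) *
        ((D.q 0 ^ (r : ℕ) + D.q 2 ^ (r : ℕ) - 1 ^ (r : ℕ) - (D.q 1)⁻¹ ^ (r : ℕ)) / (r : ℕ)) =
        -D.baseExp r / (r : ℕ) *
        ((((D.s 1 ^ (r : ℕ)) ^ min m n - ((D.s 1 ^ (r : ℕ)) ^ min m n)⁻¹) /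
          (D.s 1 ^ (r : ℕ) - (D.s 1 ^ (r : ℕ))⁻¹)) *
        ((((D.s 1 ^ (r : ℕ)) ^ max m n - ((D.s 1 ^ (r : ℕ)) ^ max m n)⁻¹) /
          (D.s 1 ^ (r : ℕ) - (D.s 1 ^ (r : ℕ))⁻¹)) -
          D.s 1 ^ (r : ℕ) * ((D.s 1 ^ (r : ℕ)) ^ max m n)⁻¹)) := by
      have hb : (D.q 0 ^ (r : ℕ) + D.q 2 ^ (r : ℕ) - 1 ^ (r : ℕ) - (D.q 1)⁻¹ ^ (r : ℕ)) =
          -D.baseExp r := by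
        rw [inv_pow, inv_eq_of_mul_eq_one_left (a := D.q 0 ^ (r : ℕ) * D.q 2 ^ (r : ℕ))
          (by linear_combination q_pow_prod hD r), baseExp, one_pow]
        ring
      obtain ⟨M, hM⟩ : ∃ M, max m n = M + 1 := ⟨max m n - 1, by omega⟩
      rw [hM, Nat.add_sub_cancel]
      have hlast : ∑ b ∈ Finset.range M, D.pos (M + 1) b ^ (r : ℕ) =
          (((D.s 1 ^ (r : ℕ)) ^ (M + 1) - ((D.s 1 ^ (r : ℕ)) ^ (M + 1))⁻¹) /
          (D.s 1 ^ (r : ℕ) - (D.s 1 ^ (r : ℕ))⁻¹)) -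
          D.s 1 ^ (r : ℕ) * ((D.s 1 ^ (r : ℕ)) ^ (M + 1))⁻¹ := by
        rw [← sum_pos_pow hD (M + 1),
          Fin.sum_univ_eq_sum_range (fun b => D.pos (M + 1) b ^ (r : ℕ)),
          Finset.sum_range_succ, eq_sub_iff_add_eq]
        congr 1
        have hS := pow_ne_zero (r : ℕ) (hD.s_ne 1)
        rw [pow_succ, mul_inv, mul_comm, mul_assoc, inv_mul_cancel₀ hS, mul_one, pos,
          show ((M + 1 : ℕ) : ℤ) - 1 - 2 * M = -M by push_cast; ring, zpow_neg, zpow_natCast,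
          inv_pow, ← pow_mul, ← pow_mul, mul_comm]
      rw [← hlast, ← sum_pos_pow hD, Fin.sum_univ_eq_sum_range
        (fun a => D.pos (min m n) a ^ (r : ℕ)), Finset.sum_mul_sum, hb, Finset.sum_product,
        Finset.mul_sum]
      refine Finset.sum_congr rfl fun a _ => ?_
      rw [Finset.mul_sum]
      refine Finset.sum_congr rfl fun b _ => ?_
      rw [mul_pow, mul_comm]
    rw [e1, e2]
    ring
  · funext u
    simp only [Pi.mul_apply, Finset.prod_apply]
    rfl

/-! ### Limits at the fusion points -/

theorem continuousAt_crossRatio {α β γ δ v : ℂ} (hγ : 1 - γ * v ≠ 0) (hδ : 1 - δ * v ≠ 0) :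
    ContinuousAt (crossRatio α β γ δ) v := by
  unfold crossRatio
  exact ContinuousAt.div (by fun_prop) (by fun_prop) (mul_ne_zero hγ hδ)

theorem tendsto_mul_left_punctured {t : ℂ} (ht : t ≠ 0) (x : ℂ) :
    Tendsto (fun u => t * u) (𝓝[≠] x) (𝓝[≠] (t * x)) := by
  refine tendsto_nhdsWithin_iff.2 ⟨((continuous_const_mul t).tendsto x).mono_left
    nhdsWithin_le_nhds, ?_⟩
  filter_upwards [self_mem_nhdsWithin] with u hu h
  exact hu (mul_left_cancel₀ ht h)

theorem q_one_sub_zpow_ne (hD : D.Generic) {k : ℤ} (hk : k ≠ 0) : 1 - D.q 1 ^ k ≠ 0 :=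
  sub_ne_zero.2 (hD.q_zpow_ne 1 hk).symm

theorem poleA_eq (i j : Fin L) : D.poleA i j = D.q 1 ^ (if j < i then (-1 : ℤ) else 1) := by
  unfold poleA
  split_ifs <;> simp

theorem poleB_eq (i j : Fin L) : D.poleB i j = D.q 1 ^ (if i = j then (-1 : ℤ) else 0) := by
  unfold poleB
  split_ifs <;> simp

theorem continuousAt_pairFn (hD : D.Generic) (i j : Fin L) {k : ℕ} (hk : 2 ≤ k) :
    ContinuousAt (D.pairFn i j) (D.q 1 ^ k)⁻¹ := by
  have hq := hD.q_ne 1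
  refine continuousAt_crossRatio ?_ ?_
  · rw [poleA_eq, ← zpow_natCast, ← zpow_neg, ← zpow_add₀ hq]
    refine q_one_sub_zpow_ne hD ?_
    split_ifs <;> omega
  · rw [poleB_eq, ← zpow_natCast, ← zpow_neg, ← zpow_add₀ hq]
    refine q_one_sub_zpow_ne hD ?_
    split_ifs <;> omega

/-- The limit of `(1 - q_2 v) F_{ij}(v)` as `v → q_2⁻¹`, for `F_{ij} = pairFn i j`. -/
noncomputable def res (D : Data L) (i j : Fin L) : ℂ :=
  if j < i then 0 else (1 - D.zeroA i j * (D.q 1)⁻¹) * (1 - D.zeroB i j * (D.q 1)⁻¹) /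
    (1 - D.poleB i j * (D.q 1)⁻¹)

theorem one_sub_poleB_ne (hD : D.Generic) (i j : Fin L) : 1 - D.poleB i j * (D.q 1)⁻¹ ≠ 0 := by
  rw [poleB_eq, ← zpow_neg_one, ← zpow_add₀ (hD.q_ne 1)]
  refine q_one_sub_zpow_ne hD ?_
  split_ifs <;> omega

theorem tendsto_res (hD : D.Generic) (i j : Fin L) :
    Tendsto (fun v => (1 - D.q 1 * v) * D.pairFn i j v) (𝓝[≠] (D.q 1)⁻¹) (𝓝 (D.res i j)) := by
  have hq := hD.q_ne 1
  by_cases h : j < i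
  · rw [res, if_pos h]
    have hc : ContinuousAt (D.pairFn i j) (D.q 1)⁻¹ := by
      refine continuousAt_crossRatio ?_ (one_sub_poleB_ne hD i j)
      rw [poleA_eq, if_pos h, ← zpow_neg_one, ← zpow_add₀ hq]
      exact q_one_sub_zpow_ne hD (by omega)
    have h1 : ContinuousAt (fun v => (1 - D.q 1 * v) * D.pairFn i j v) (D.q 1)⁻¹ :=
      ContinuousAt.mul (by fun_prop) hc
    have h2 := h1.tendsto.mono_left (nhdsWithin_le_nhds (s := {(D.q 1)⁻¹}ᶜ))
    simpa [hq] using h2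
  · rw [res, if_neg h]
    have h1 : ContinuousAt (fun v => (1 - D.zeroA i j * v) * (1 - D.zeroB i j * v) /
        (1 - D.poleB i j * v)) (D.q 1)⁻¹ :=
      ContinuousAt.div (by fun_prop) (by fun_prop) (one_sub_poleB_ne hD i j)
    refine (h1.tendsto.mono_left nhdsWithin_le_nhds).congr' ?_
    filter_upwards [self_mem_nhdsWithin] with v hv
    have hv' : 1 - D.q 1 * v ≠ 0 := fun h0 => hv (by
      exact eq_inv_of_mul_eq_one_right (sub_eq_zero.1 h0).symm)
    rw [pairFn, crossRatio, poleA, if_neg h, ← mul_div_assoc, mul_div_mul_left _ _ hv']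

/-- Exchanging the two currents inverts all four parameters, whose products in numerator and
denominator agree. -/
theorem pairFn_inv (hD : D.Generic) (i j : Fin L) {v : ℂ} (hv : v ≠ 0) :
    D.pairFn i j v⁻¹ = D.pairFn j i v := by
  have h0 := hD.q_ne 0
  have h1 := hD.q_ne 1
  have h2 := hD.q_ne 2
  have hp := hD.q_prod
  have e1 : ∀ a b c d : ℂ, a ≠ 0 → b ≠ 0 → c ≠ 0 → d ≠ 0 → a * b = c * d →
      crossRatio a b c d v⁻¹ = crossRatio a⁻¹ b⁻¹ c⁻¹ d⁻¹ v := by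
    intro a b c d ha hb hc hd h
    have f : ∀ a : ℂ, a ≠ 0 → 1 - a * v⁻¹ = -(a * v⁻¹) * (1 - a⁻¹ * v) := by
      intro a ha
      field_simp
      ring
    rw [crossRatio, crossRatio, f a ha, f b hb, f c hc, f d hd]
    rw [show -(a * v⁻¹) * (1 - a⁻¹ * v) * (-(b * v⁻¹) * (1 - b⁻¹ * v)) =
      (a * b * v⁻¹ * v⁻¹) * ((1 - a⁻¹ * v) * (1 - b⁻¹ * v)) by ring,
      show -(c * v⁻¹) * (1 - c⁻¹ * v) * (-(d * v⁻¹) * (1 - d⁻¹ * v)) =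
      (a * b * v⁻¹ * v⁻¹) * ((1 - c⁻¹ * v) * (1 - d⁻¹ * v)) by rw [h]; ring]
    exact mul_div_mul_left _ _ (mul_ne_zero (mul_ne_zero (mul_ne_zero ha hb) (inv_ne_zero hv))
      (inv_ne_zero hv))
  have e0 : D.q 0 * D.q 2 = (D.q 1)⁻¹ := eq_inv_of_mul_eq_one_left (by linear_combination hp)
  have hA : ∀ i j : Fin L, D.zeroA i j ≠ 0 := by
    intro i j
    unfold zeroA
    split_ifs
    · exact h0
    · exact inv_ne_zero h0
    · exact hD.q_ne _
  have hB : ∀ i j : Fin L, D.zeroB i j ≠ 0 := by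
    intro i j
    unfold zeroB
    split_ifs
    · exact h2
    · exact inv_ne_zero h2
    · exact inv_ne_zero (hD.q_ne _)
  have hAB : D.zeroA i j * D.zeroB i j = D.poleA i j * D.poleB i j := by
    unfold zeroA zeroB poleA poleB
    rcases lt_trichotomy i j with h | h | h
    · simp only [h, h.not_gt, h.ne, if_true, if_false]
      rw [← mul_inv, e0, inv_inv, mul_one]
    · subst h
      simp only [lt_irrefl, if_true, if_false]
      rw [mul_inv_cancel₀ (hD.q_ne _), mul_inv_cancel₀ h1]
    · simp only [h, h.ne', if_true, if_false, e0, mul_one]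
  unfold pairFn
  rw [e1 _ _ _ _ (hA i j) (hB i j) (by rw [poleA_eq]; exact zpow_ne_zero _ h1)
    (by rw [poleB_eq]; exact zpow_ne_zero _ h1) hAB]
  unfold zeroA zeroB poleA poleB
  rcases lt_trichotomy i j with h | h | h
  · simp only [h, h.not_gt, h.ne, h.ne', if_true, if_false, inv_inv, inv_one]
  · subst h
    simp only [lt_irrefl, if_true, if_false, crossRatio, inv_inv]
    ring
  · simp only [h, h.not_gt, h.ne, h.ne', if_true, if_false, inv_inv, inv_one]

theorem tendsto_inv_punctured {x : ℂ} (hx : x ≠ 0) :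
    Tendsto (fun u : ℂ => u⁻¹) (𝓝[≠] x) (𝓝[≠] x⁻¹) := by
  refine tendsto_nhdsWithin_iff.2 ⟨(tendsto_inv₀ hx).mono_left nhdsWithin_le_nhds, ?_⟩
  filter_upwards [self_mem_nhdsWithin] with u hu h
  exact hu (inv_injective h)

theorem eventually_ne_zero_punctured {x : ℂ} (hx : x ≠ 0) : ∀ᶠ u : ℂ in 𝓝[≠] x, u ≠ 0 :=
  (eventually_ne_nhds hx).filter_mono nhdsWithin_le_nhds

/-- The pole of `pairFn i j` at `q_2` mirrors that of `pairFn j i` at `q_2⁻¹`; the sign comes from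
`1 - q_2⁻¹ v = -q_2⁻¹ v (1 - q_2 v⁻¹)`. -/
theorem tendsto_res_swap (hD : D.Generic) (i j : Fin L) :
    Tendsto (fun v => (1 - (D.q 1)⁻¹ * v) * D.pairFn i j v) (𝓝[≠] (D.q 1))
      (𝓝 (-D.res j i)) := by
  have hq := hD.q_ne 1
  have h1 := (tendsto_res hD j i).comp (tendsto_inv_punctured hq)
  have h2 : Tendsto (fun v : ℂ => -(v * (D.q 1)⁻¹)) (𝓝[≠] (D.q 1)) (𝓝 (-1)) := by
    have : ContinuousAt (fun v : ℂ => -(v * (D.q 1)⁻¹)) (D.q 1) := by fun_prop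
    have h := this.tendsto.mono_left (nhdsWithin_le_nhds (s := {D.q 1}ᶜ))
    rwa [mul_inv_cancel₀ hq] at h
  have h3 := h2.mul h1
  rw [neg_one_mul] at h3
  refine h3.congr' ?_
  filter_upwards [eventually_ne_zero_punctured hq] with v hv
  rw [Function.comp_apply, pairFn_inv hD _ _ hv, ← mul_assoc]
  congr 1
  field_simp
  ring

theorem tendsto_pairFn_swap (hD : D.Generic) (i j : Fin L) {k : ℕ} (hk : 2 ≤ k) :
    Tendsto (D.pairFn i j) (𝓝[≠] (D.q 1 ^ k)) (𝓝 (D.pairFn j i (D.q 1 ^ k)⁻¹)) := by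
  have hq : D.q 1 ^ k ≠ 0 := pow_ne_zero k (hD.q_ne 1)
  have h1 := (continuousAt_pairFn hD j i hk).tendsto.comp
    ((tendsto_inv₀ hq).mono_left (nhdsWithin_le_nhds (s := {D.q 1 ^ k}ᶜ)))
  refine h1.congr' ?_
  filter_upwards [eventually_ne_zero_punctured hq] with v hv
  rw [Function.comp_apply, pairFn_inv hD _ _ hv]

/-! ### The constants of the fusion relations -/

/-- The constant `d_λ(x ^ ((2 k + 1) λ_2))`. -/
noncomputable def dVal (D : Data L) (k : ℕ) : ℂ :=
  D.dLam (D.x ^ (((2 * k + 1 : ℕ) : ℂ) * D.lam 1))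

theorem dVal_eq (hD : D.Generic) (k : ℕ) : D.dVal k =
    (1 - D.q 0 * D.q 1 ^ (k + 1)) * (1 - D.q 2 * D.q 1 ^ (k + 1)) /
      ((1 - D.q 1 ^ (k + 1)) * (1 - D.q 1 ^ k)) := by
  have hx := hD.x_ne
  have h0 := hD.s_ne 0
  have h1 := hD.s_ne 1
  have h2 := hD.s_ne 2
  have hp := hD.s_prod
  have e1 : D.s 0 / D.s 2 * D.s 1 ^ (2 * k + 1) = D.q 0 * D.q 1 ^ (k + 1) := by
    rw [hD.q_eq, hD.q_eq, ← pow_mul, div_mul_eq_mul_div, div_eq_iff h2]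
    linear_combination (-D.s 0 * D.s 1 ^ (2 * k + 1)) * hp
  have e2 : D.s 2 / D.s 0 * D.s 1 ^ (2 * k + 1) = D.q 2 * D.q 1 ^ (k + 1) := by
    rw [hD.q_eq, hD.q_eq, ← pow_mul, div_mul_eq_mul_div, div_eq_iff h0]
    linear_combination (-D.s 2 * D.s 1 ^ (2 * k + 1)) * hp
  have e3 : D.s 1 * D.s 1 ^ (2 * k + 1) = D.q 1 ^ (k + 1) := by
    rw [hD.q_eq, ← pow_mul]
    ring
  have e4 : (D.s 1)⁻¹ * D.s 1 ^ (2 * k + 1) = D.q 1 ^ k := by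
    rw [hD.q_eq, ← pow_mul, pow_succ]
    field_simp
  rw [dVal, dLam, Complex.cpow_nat_mul, Complex.cpow_sub _ _ hx, Complex.cpow_sub _ _ hx,
    Complex.cpow_neg]
  change (1 - D.s 0 / D.s 2 * D.s 1 ^ (2 * k + 1)) * (1 - D.s 2 / D.s 0 * D.s 1 ^ (2 * k + 1)) /
    ((1 - D.s 1 * D.s 1 ^ (2 * k + 1)) * (1 - (D.s 1)⁻¹ * D.s 1 ^ (2 * k + 1))) = _
  rw [e1, e2, e3, e4]

theorem one_sub_q_mul_zpow_ne (hD : D.Generic) {c : Fin 3} (hc : c ≠ 1) (k : ℤ) :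
    1 - D.q c * D.q 1 ^ k ≠ 0 :=
  sub_ne_zero.2 (hD.q_mul_zpow_ne hc k).symm

theorem dVal_ne (hD : D.Generic) {k : ℕ} (hk : 1 ≤ k) : D.dVal k ≠ 0 := by
  rw [dVal_eq hD]
  refine div_ne_zero (mul_ne_zero ?_ ?_) (mul_ne_zero ?_ ?_)
  · exact_mod_cast one_sub_q_mul_zpow_ne hD (c := 0) (by decide) ((k + 1 : ℕ) : ℤ)
  · exact_mod_cast one_sub_q_mul_zpow_ne hD (c := 2) (by decide) ((k + 1 : ℕ) : ℤ)
  · exact hD.one_sub_q_pow_ne 1 ⟨k + 1, k.succ_pos⟩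
  · exact hD.one_sub_q_pow_ne 1 ⟨k, hk⟩

theorem corrFn_pow (hD : D.Generic) (k : ℕ) : D.corrFn (D.q 1 ^ (k + 1)) = (D.dVal k)⁻¹ := by
  have h1 := hD.q_ne 1
  rw [dVal_eq hD, corrFn, crossRatio, inv_div, one_mul, pow_succ', inv_mul_cancel_left₀ h1]

theorem corrFn_inv (hD : D.Generic) (k : ℕ) : D.corrFn (D.q 1 ^ k)⁻¹ = (D.dVal k)⁻¹ := by
  have h0 := hD.q_ne 0
  have h1 := hD.q_ne 1
  have h2 := hD.q_ne 2
  have hp := hD.q_prod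
  have hQ : D.q 1 ^ k ≠ 0 := pow_ne_zero k h1
  rw [dVal_eq hD, corrFn, crossRatio, inv_div, pow_succ']
  generalize D.q 1 ^ k = Q at *
  have e0 : 1 - D.q 0 * Q⁻¹ = -(D.q 0 * Q⁻¹) * (1 - D.q 2 * (D.q 1 * Q)) := by
    field_simp
    linear_combination -Q * hp
  have e2 : 1 - D.q 2 * Q⁻¹ = -(D.q 2 * Q⁻¹) * (1 - D.q 0 * (D.q 1 * Q)) := by
    field_simp
    linear_combination -Q * hp
  have e1 : 1 - (D.q 1)⁻¹ * Q⁻¹ = -(D.q 0 * D.q 2 * Q⁻¹) * (1 - D.q 1 * Q) := by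
    field_simp
    linear_combination (1 - D.q 1 * Q) * hp
  have e3 : 1 - 1 * Q⁻¹ = -Q⁻¹ * (1 - Q) := by
    field_simp
    ring
  rw [e0, e1, e2, e3,
    show -Q⁻¹ * (1 - Q) * (-(D.q 0 * D.q 2 * Q⁻¹) * (1 - D.q 1 * Q)) =
      (D.q 0 * D.q 2 * Q⁻¹ * Q⁻¹) * ((1 - D.q 1 * Q) * (1 - Q)) by ring,
    show -(D.q 0 * Q⁻¹) * (1 - D.q 2 * (D.q 1 * Q)) *
      (-(D.q 2 * Q⁻¹) * (1 - D.q 0 * (D.q 1 * Q))) =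
      (D.q 0 * D.q 2 * Q⁻¹ * Q⁻¹) * ((1 - D.q 0 * (D.q 1 * Q)) * (1 - D.q 2 * (D.q 1 * Q))) by ring]
  exact mul_div_mul_left _ _ (mul_ne_zero (mul_ne_zero (mul_ne_zero h0 h2) (inv_ne_zero hQ))
    (inv_ne_zero hQ))

theorem continuousAt_corrFn (hD : D.Generic) (k : ℤ) : ContinuousAt D.corrFn (D.q 1 ^ k) :=
  continuousAt_crossRatio (one_sub_q_mul_zpow_ne hD (by decide) k)
    (one_sub_q_mul_zpow_ne hD (by decide) k)

theorem cLam_ne (hD : D.Generic) : D.cLam ≠ 0 := by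
  have h : ∀ c : Fin 3, D.qint (D.lam c) ≠ 0 := by
    intro c
    rw [qint, Complex.cpow_neg]
    refine div_ne_zero ?_ hD.x_sub_inv_ne
    have := hD.s_sub_inv_ne c 1
    rwa [PNat.one_coe, pow_one, s] at this
  exact mul_ne_zero (div_ne_zero (mul_ne_zero (h 0) (h 2)) (h 1)) hD.x_sub_inv_ne

/-- The normalization attached to two currents at distance `k` in a fused product. -/
noncomputable def normal (D : Data L) (k : ℕ) : ℂ := if k = 1 then -D.cLam else D.dVal (k - 1)

theorem normal_ne (hD : D.Generic) {k : ℕ} (hk : 1 ≤ k) : D.normal k ≠ 0 := by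
  unfold normal
  split_ifs with h
  · exact neg_ne_zero.2 (cLam_ne hD)
  · exact dVal_ne hD (by omega)

/-- In row `a` the factor `normal (a + 1)` is split off; the other factors are values of `d_λ`, as
their distance is at least `2`. -/
theorem prod_range_normal (N M : ℕ) :
    ∏ a ∈ Finset.range (N + 1), ∏ b ∈ Finset.range (M + 1), D.normal (a + b + 1) =
      -D.cLam * (∏ l ∈ Finset.Icc 1 N, D.dVal l) *
        ∏ p ∈ Finset.range (N + 1) ×ˢ Finset.range M, D.dVal (p.1 + p.2 + 1) := by
  have h1 : ∀ a, ∏ b ∈ Finset.range (M + 1), D.normal (a + b + 1) =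
      (∏ b ∈ Finset.range M, D.dVal (a + b + 1)) * D.normal (a + 1) := by
    intro a
    rw [Finset.prod_range_succ']
    refine congrArg₂ (· * ·) (Finset.prod_congr rfl fun b _ => ?_) rfl
    rw [normal, if_neg (by omega)]
    congr 1
  have h2 : ∏ a ∈ Finset.range (N + 1), D.normal (a + 1) =
      -D.cLam * ∏ l ∈ Finset.Icc 1 N, D.dVal l := by
    induction N with
    | zero => simp [normal]
    | succ N ih =>
      rw [Finset.prod_range_succ, ih, Finset.prod_Icc_succ_top (by omega), mul_assoc, normal,
        if_neg (by omega)]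
      rfl
  simp only [h1]
  rw [Finset.prod_mul_distrib, h2, Finset.prod_product, mul_comm]

/-- The normalizations of all pairs of currents in two groups of `m` and `n` adjacent currents
multiply to the constant of the fusion relation. -/
theorem prod_normal {m n : ℕ} (hm : 1 ≤ m) (hn : 1 ≤ n) :
    ∏ p : Fin m × Fin n, D.normal (m + p.2 - p.1) =
      -D.cLam * (∏ l ∈ Finset.Icc 1 (min m n - 1), D.dVal l) *
        ∏ p ∈ Finset.range (min m n) ×ˢ Finset.range (max m n - 1), D.dVal (p.1 + p.2 + 1) := by
  have h1 : ∏ p : Fin m × Fin n, D.normal (m + p.2 - p.1) =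
      ∏ a ∈ Finset.range m, ∏ b ∈ Finset.range n, D.normal (a + b + 1) := by
    rw [Fintype.prod_prod_type, ← Finset.prod_range_reflect, ← Fin.prod_univ_eq_prod_range
      (fun a => ∏ b ∈ Finset.range n, D.normal (m - 1 - a + b + 1))]
    refine Finset.prod_congr rfl fun a _ => ?_
    rw [← Fin.prod_univ_eq_prod_range (fun b => D.normal (m - 1 - a + b + 1))]
    refine Finset.prod_congr rfl fun b _ => ?_
    congr 1
    have := a.2
    dsimp only
    omega
  rw [h1]
  rcases le_total m n with h | h
  · rw [min_eq_left h, max_eq_right h]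
    obtain ⟨N, rfl⟩ : ∃ N, m = N + 1 := ⟨m - 1, by omega⟩
    obtain ⟨M, rfl⟩ : ∃ M, n = M + 1 := ⟨n - 1, by omega⟩
    exact prod_range_normal N M
  · rw [min_eq_right h, max_eq_left h, Finset.prod_comm]
    obtain ⟨M, rfl⟩ : ∃ M, m = M + 1 := ⟨m - 1, by omega⟩
    obtain ⟨N, rfl⟩ : ∃ N, n = N + 1 := ⟨n - 1, by omega⟩
    rw [← Nat.add_sub_cancel (n := N) (m := 1), Nat.add_sub_cancel, Nat.add_sub_cancel,
      Nat.add_sub_cancel, ← prod_range_normal N M]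
    simp only [add_comm]

/-- The value at `q_2 ^ (-k)` of `pairFn i j`, or of its residue for `k = 1`. -/
noncomputable def pairVal (D : Data L) (i j : Fin L) (k : ℕ) : ℂ :=
  if k = 1 then D.res i j else D.pairFn i j (D.q 1 ^ k)⁻¹

theorem pos_ne (hD : D.Generic) (m a : ℕ) : D.pos m a ≠ 0 := zpow_ne_zero _ (hD.s_ne 1)

theorem q_zpow_eq (hD : D.Generic) (k : ℤ) : D.q 1 ^ k = D.s 1 ^ (2 * k) := by
  rw [hD.q_eq, ← zpow_natCast, ← zpow_mul]
  rfl

/-- The limit of the rational function of `isExpansion_tuple` at the pole where the first group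
of currents precedes the second one. -/
theorem tendsto_tuple_pos (hD : D.Generic) {m n : ℕ} (hm : 1 ≤ m) (hn : 1 ≤ n)
    (I : Fin m → Fin L) (J : Fin n → Fin L) {p : ℂ} (hp : p = D.s 1 ^ (m + n)) :
    Tendsto (fun u => (1 - p * u) * ((∏ c : Fin m × Fin n,
          D.pairFn (I c.1) (J c.2) ((D.pos m c.1)⁻¹ * D.pos n c.2 * u)) *
        ∏ c ∈ Finset.range (min m n) ×ˢ Finset.range (max m n - 1),
          D.corrFn (D.pos (min m n) c.1 * D.pos (max m n) c.2 * u))) (𝓝[≠] p⁻¹)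
      (𝓝 ((∏ c : Fin m × Fin n, D.pairVal (I c.1) (J c.2) (m + c.2 - c.1)) *
        ∏ c ∈ Finset.range (min m n) ×ˢ Finset.range (max m n - 1),
          (D.dVal (c.1 + c.2 + 1))⁻¹)) := by
  have hs := hD.s_ne 1
  have hp' : p = D.s 1 ^ ((m : ℤ) + n) := by rw [hp]; exact_mod_cast rfl
  -- Only the last current of the first group and the first one of the second are at distance `1`,
  -- where `pairFn` has a pole.
  let c₀ : Fin m × Fin n := (⟨m - 1, by omega⟩, ⟨0, hn⟩)
  have hfac : ∀ u : ℂ, (1 - p * u) = ∏ c : Fin m × Fin n, if c = c₀ then 1 - p * u else 1 := by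
    intro u
    rw [Finset.prod_ite_eq' Finset.univ c₀ (fun _ => 1 - p * u), if_pos (Finset.mem_univ _)]
  have hterm : ∀ c : Fin m × Fin n, (D.pos m c.1)⁻¹ * D.pos n c.2 * p⁻¹ =
      (D.q 1 ^ (m + c.2 - c.1 : ℕ))⁻¹ := by
    intro c
    have := c.1.2
    rw [← zpow_natCast, q_zpow_eq hD, pos, pos, hp', ← zpow_neg, ← zpow_neg, ← zpow_neg,
      ← zpow_add₀ hs, ← zpow_add₀ hs]
    congr 1
    omega
  have hcorr : ∀ c : ℕ × ℕ, D.pos (min m n) c.1 * D.pos (max m n) c.2 * p⁻¹ =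
      (D.q 1 ^ (c.1 + c.2 + 1))⁻¹ := by
    intro c
    rw [← zpow_natCast, q_zpow_eq hD, pos, pos, hp', ← zpow_neg, ← zpow_neg, ← zpow_add₀ hs,
      ← zpow_add₀ hs]
    congr 1
    have := min_add_max m n
    push_cast
    omega
  have h1 : Tendsto (fun u => ∏ c : Fin m × Fin n, ((if c = c₀ then 1 - p * u else 1) *
      D.pairFn (I c.1) (J c.2) ((D.pos m c.1)⁻¹ * D.pos n c.2 * u))) (𝓝[≠] p⁻¹)
      (𝓝 (∏ c : Fin m × Fin n, D.pairVal (I c.1) (J c.2) (m + c.2 - c.1))) := by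
    refine tendsto_finsetProd _ fun c _ => ?_
    have ht : (D.pos m c.1)⁻¹ * D.pos n c.2 ≠ 0 :=
      mul_ne_zero (inv_ne_zero (pos_ne hD _ _)) (pos_ne hD _ _)
    have hmul := tendsto_mul_left_punctured ht p⁻¹
    rw [hterm] at hmul
    by_cases hc : c = c₀
    · have hk : m + c.2 - c.1 = 1 := by
        rw [hc]
        simp only [c₀]
        omega
      rw [hk, pow_one] at hmul
      rw [hk, pairVal, if_pos rfl]
      refine ((tendsto_res hD (I c.1) (J c.2)).comp hmul).congr fun u => ?_
      rw [if_pos hc, Function.comp_apply]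
      congr 2
      have := hterm c
      rw [hk, pow_one] at this
      have hq := hD.q_ne 1
      have hp0 : p ≠ 0 := by rw [hp]; exact pow_ne_zero _ hs
      have e : (D.pos m c.1)⁻¹ * D.pos n c.2 = (D.q 1)⁻¹ * p := by
        rw [← this, inv_mul_cancel_right₀ hp0]
      rw [e]
      field_simp
    · have hk : 2 ≤ m + c.2 - c.1 := by
        by_contra hlt
        have := c.1.2
        refine hc (Prod.ext (Fin.ext ?_) (Fin.ext ?_)) <;> simp only [c₀] <;> omega
      simp only [if_neg hc, one_mul]
      rw [pairVal, if_neg (by omega)]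
      exact (continuousAt_pairFn hD _ _ hk).tendsto.comp (hmul.mono_right nhdsWithin_le_nhds)
  have h2 : Tendsto (fun u => ∏ c ∈ Finset.range (min m n) ×ˢ Finset.range (max m n - 1),
      D.corrFn (D.pos (min m n) c.1 * D.pos (max m n) c.2 * u)) (𝓝[≠] p⁻¹)
      (𝓝 (∏ c ∈ Finset.range (min m n) ×ˢ Finset.range (max m n - 1),
        (D.dVal (c.1 + c.2 + 1))⁻¹)) := by
    refine tendsto_finsetProd _ fun c _ => ?_
    have ht : D.pos (min m n) c.1 * D.pos (max m n) c.2 ≠ 0 :=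
      mul_ne_zero (pos_ne hD _ _) (pos_ne hD _ _)
    have hmul := tendsto_mul_left_punctured ht p⁻¹
    rw [hcorr] at hmul
    rw [← corrFn_inv hD]
    have hcont := continuousAt_corrFn hD (-((c.1 + c.2 + 1 : ℕ) : ℤ))
    rw [zpow_neg, zpow_natCast] at hcont
    exact hcont.tendsto.comp (hmul.mono_right nhdsWithin_le_nhds)
  refine (h1.mul h2).congr fun u => ?_
  rw [Finset.prod_mul_distrib, ← hfac, mul_assoc]

/-- The limit of the rational function of `isExpansion_tuple` at the pole where the second group
of currents precedes the first one. -/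
theorem tendsto_tuple_neg (hD : D.Generic) {m n : ℕ} (hm : 1 ≤ m) (hn : 1 ≤ n)
    (I : Fin m → Fin L) (J : Fin n → Fin L) {p : ℂ} (hp : p = (D.s 1 ^ (m + n))⁻¹) :
    Tendsto (fun u => (1 - p * u) * ((∏ c : Fin m × Fin n,
          D.pairFn (I c.1) (J c.2) ((D.pos m c.1)⁻¹ * D.pos n c.2 * u)) *
        ∏ c ∈ Finset.range (min m n) ×ˢ Finset.range (max m n - 1),
          D.corrFn (D.pos (min m n) c.1 * D.pos (max m n) c.2 * u))) (𝓝[≠] p⁻¹)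
      (𝓝 (-(∏ c : Fin m × Fin n, D.pairVal (J c.2) (I c.1) (n + c.1 - c.2)) *
        ∏ c ∈ Finset.range (min m n) ×ˢ Finset.range (max m n - 1),
          (D.dVal (c.1 + c.2 + 1))⁻¹)) := by
  have hs := hD.s_ne 1
  have hp' : p = D.s 1 ^ (-((m : ℤ) + n)) := by rw [hp, zpow_neg]; exact_mod_cast rfl
  -- Now the pole comes from the last current of the second group and the first one of the first.
  let c₀ : Fin m × Fin n := (⟨0, hm⟩, ⟨n - 1, by omega⟩)
  have hfac : ∀ u : ℂ, u = ∏ c : Fin m × Fin n, if c = c₀ then u else 1 := by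
    intro u
    rw [Finset.prod_ite_eq' Finset.univ c₀ (fun _ => u), if_pos (Finset.mem_univ _)]
  have hterm : ∀ c : Fin m × Fin n, (D.pos m c.1)⁻¹ * D.pos n c.2 * p⁻¹ =
      D.q 1 ^ (n + c.1 - c.2 : ℕ) := by
    intro c
    have := c.2.2
    rw [← zpow_natCast, q_zpow_eq hD, pos, pos, hp', ← zpow_neg, ← zpow_neg,
      ← zpow_add₀ hs, ← zpow_add₀ hs]
    congr 1
    omega
  have h1 : Tendsto (fun u => ∏ c : Fin m × Fin n, ((if c = c₀ then 1 - p * u else 1) *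
      D.pairFn (I c.1) (J c.2) ((D.pos m c.1)⁻¹ * D.pos n c.2 * u))) (𝓝[≠] p⁻¹)
      (𝓝 (∏ c : Fin m × Fin n, ((if c = c₀ then -1 else 1) *
        D.pairVal (J c.2) (I c.1) (n + c.1 - c.2)))) := by
    refine tendsto_finsetProd _ fun c _ => ?_
    have ht : (D.pos m c.1)⁻¹ * D.pos n c.2 ≠ 0 :=
      mul_ne_zero (inv_ne_zero (pos_ne hD _ _)) (pos_ne hD _ _)
    have hmul := tendsto_mul_left_punctured ht p⁻¹
    rw [hterm] at hmul
    by_cases hc : c = c₀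
    · have hk : n + c.1 - c.2 = 1 := by
        rw [hc]
        simp only [c₀]
        omega
      rw [hk, pow_one] at hmul
      rw [hk, pairVal, if_pos rfl, if_pos hc, neg_one_mul]
      refine ((tendsto_res_swap hD (I c.1) (J c.2)).comp hmul).congr fun u => ?_
      rw [if_pos hc, Function.comp_apply]
      congr 2
      have := hterm c
      rw [hk, pow_one] at this
      have hq := hD.q_ne 1
      have hp0 : p ≠ 0 := by rw [hp]; exact inv_ne_zero (pow_ne_zero _ hs)
      have e : (D.pos m c.1)⁻¹ * D.pos n c.2 = D.q 1 * p := by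
        rw [← this, inv_mul_cancel_right₀ hp0]
      rw [e]
      field_simp
    · have hk : 2 ≤ n + c.1 - c.2 := by
        by_contra hlt
        have := c.2.2
        refine hc (Prod.ext (Fin.ext ?_) (Fin.ext ?_)) <;> simp only [c₀] <;> omega
      simp only [if_neg hc, one_mul]
      rw [pairVal, if_neg (by omega)]
      exact (tendsto_pairFn_swap hD _ _ hk).comp hmul
  have h2 : Tendsto (fun u => ∏ c ∈ Finset.range (min m n) ×ˢ Finset.range (max m n - 1),
      D.corrFn (D.pos (min m n) c.1 * D.pos (max m n) c.2 * u)) (𝓝[≠] p⁻¹)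
      (𝓝 (∏ c ∈ Finset.range (min m n) ×ˢ Finset.range (max m n - 1),
        (D.dVal (c.1 + c.2 + 1))⁻¹)) := by
    -- Reversing both ranges matches the exponents with those of the limit.
    have hrev : ∏ c ∈ Finset.range (min m n) ×ˢ Finset.range (max m n - 1),
        (D.dVal (c.1 + c.2 + 1))⁻¹ =
        ∏ c ∈ Finset.range (min m n) ×ˢ Finset.range (max m n - 1),
          (D.dVal ((min m n - 1 - c.1) + (max m n - 1 - 1 - c.2) + 1))⁻¹ := by
      rw [Finset.prod_product, Finset.prod_product, ← Finset.prod_range_reflect]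
      refine Finset.prod_congr rfl fun a _ => ?_
      rw [← Finset.prod_range_reflect]
    rw [hrev]
    refine tendsto_finsetProd _ fun c hc => ?_
    rw [Finset.mem_product, Finset.mem_range, Finset.mem_range] at hc
    have ht : D.pos (min m n) c.1 * D.pos (max m n) c.2 ≠ 0 :=
      mul_ne_zero (pos_ne hD _ _) (pos_ne hD _ _)
    have hmul := tendsto_mul_left_punctured ht p⁻¹
    have hcorr : D.pos (min m n) c.1 * D.pos (max m n) c.2 * p⁻¹ =
        D.q 1 ^ ((min m n - 1 - c.1) + (max m n - 1 - 1 - c.2) + 1 + 1) := by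
      rw [← zpow_natCast, q_zpow_eq hD, pos, pos, hp', ← zpow_neg, ← zpow_add₀ hs,
        ← zpow_add₀ hs]
      congr 1
      have := min_add_max m n
      omega
    rw [hcorr] at hmul
    rw [← corrFn_pow hD]
    have hcont := continuousAt_corrFn hD
      (((min m n - 1 - c.1) + (max m n - 1 - 1 - c.2) + 1 + 1 : ℕ) : ℤ)
    rw [zpow_natCast] at hcont
    exact hcont.tendsto.comp (hmul.mono_right nhdsWithin_le_nhds)
  have h3 := h1.mul h2
  rw [Finset.prod_mul_distrib, ← hfac, neg_one_mul] at h3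
  refine h3.congr fun u => ?_
  rw [Finset.prod_mul_distrib, ← hfac, mul_assoc]

end Data

/-! ### Rescaled and fused vertex operators -/

section Rescale

variable {L : ℕ}

theorem scale_one (n : Fin L → ℕ+ → ℂ) : scale 1 n = n := by
  funext j r
  simp [scale]

theorem scale_scale (ρ σ : ℂ) (n : Fin L → ℕ+ → ℂ) : scale ρ (scale σ n) = scale (ρ * σ) n := by
  funext j r
  simp [scale, mul_pow, mul_assoc]

theorem scale_sum {ι : Type*} (s : Finset ι) (ρ : ℂ) (n : ι → Fin L → ℕ+ → ℂ) :
    scale ρ (∑ i ∈ s, n i) = ∑ i ∈ s, scale ρ (n i) := by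
  funext j r
  simp [scale, Finset.sum_apply, Finset.mul_sum]

theorem coeffInt_creat_scale {ρ : ℂ} (n : Fin L → ℕ+ → ℂ) (k : ℤ) :
    coeffInt k (expSum (creat (scale ρ n))) = ρ ^ k • coeffInt k (expSum (creat n)) := by
  have h : creat (scale ρ n) = fun r : ℕ+ => ρ ^ (r : ℕ) • creat n r := by
    funext r
    simp [creat, scale, Finset.smul_sum, smul_smul]
  rcases lt_or_ge k 0 with hk | hk
  · rw [coeffInt_of_neg hk, coeffInt_of_neg hk, smul_zero]
  · lift k to ℕ using hk
    rw [coeffInt_natCast, coeffInt_natCast, h, coeff_expSum_smul_pow, zpow_natCast]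

theorem coeffInt_annih_scale {ρ : ℂ} (n : Fin L → ℕ+ → ℂ) (k : ℤ) :
    coeffInt k (expSum (annih (scale ρ n))) = ρ ^ k • coeffInt k (expSum (annih n)) := by
  have h : annih (scale ρ n) = fun r : ℕ+ => ρ ^ (r : ℕ) • annih n r := by
    funext r
    simp [annih, scale, Finset.smul_sum, smul_smul]
  rcases lt_or_ge k 0 with hk | hk
  · rw [coeffInt_of_neg hk, coeffInt_of_neg hk, smul_zero]
  · lift k to ℕ using hk
    rw [coeffInt_natCast, coeffInt_natCast, h, coeff_expSum_smul_pow, zpow_natCast]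

theorem rescale_vert {ρ : ℂ} (hρ : ρ ≠ 0) (n m : Fin L → ℕ+ → ℂ) :
    Current.rescale ρ (vert n m) = vert (scale ρ n) (scale ρ⁻¹ m) := by
  refine Subtype.ext (funext fun d => LinearMap.ext fun v => ?_)
  change ρ ^ (-d) • (vert n m).1 d v = (vert (scale ρ n) (scale ρ⁻¹ m)).1 d v
  rw [vert, vert, ordered_apply, ordered_apply,
    smul_finsum' _ (ordered_finite _ (annih_lowering m) d v)]
  refine finsum_congr fun a => ?_
  rw [coeffInt_creat_scale, coeffInt_annih_scale, LinearMap.smul_apply, LinearMap.smul_apply,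
    map_smul, smul_smul, inv_zpow', ← zpow_add₀ hρ]
  congr 2
  ring

theorem rescale_sum {ι : Type*} (s : Finset ι) (ρ : ℂ) (a : ι → ℂ) (A : ι → Current L) :
    Current.rescale ρ (∑ i ∈ s, a i • A i) = ∑ i ∈ s, a i • Current.rescale ρ (A i) := by
  refine Subtype.ext (funext fun d => ?_)
  change ρ ^ (-d) • (∑ i ∈ s, a i • A i : Current L).1 d = _
  simp only [Submodule.coe_sum, Finset.sum_apply, Finset.smul_sum]
  refine Finset.sum_congr rfl fun i _ => ?_
  change ρ ^ (-d) • (a i • (A i).1 d) = a i • (ρ ^ (-d) • (A i).1 d)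
  exact smul_comm _ _ _

theorem vert_zero : vert (0 : Fin L → ℕ+ → ℂ) 0 = Current.id L := by
  have hc : creat (0 : Fin L → ℕ+ → ℂ) = 0 := by
    funext r
    simp [creat]
  have ha : annih (0 : Fin L → ℕ+ → ℂ) = 0 := by
    funext r
    simp [annih]
  have h1 : ∀ k : ℤ, coeffInt k (1 : PowerSeries (Module.End ℂ (Fock L))) =
      if k = 0 then 1 else 0 := by
    intro k
    rcases lt_or_ge k 0 with hk | hk
    · rw [coeffInt_of_neg hk, if_neg hk.ne]
    · lift k to ℕ using hk
      rw [coeffInt_natCast, PowerSeries.coeff_one]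
      simp
  refine Subtype.ext (funext fun d => LinearMap.ext fun v => ?_)
  rw [vert, ordered_apply, hc, ha, expSum_zero, finsum_eq_single _ (0 : ℤ)]
  · rw [add_zero, h1, if_pos rfl, h1]
    rfl
  · intro a ha
    rw [h1 a, if_neg ha, LinearMap.zero_apply]

end Rescale

namespace Data

variable {L : ℕ}

/-! ### The higher currents -/

/-- The factor of a pair of currents at distance `k` in the coefficient of a fused product. The
normalization absorbs the constants of the fusion relations. -/
noncomputable def weight (D : Data L) (i j : Fin L) (k : ℕ) : ℂ := D.pairVal i j k / D.normal k

/-- The coefficient of the normally ordered product of the currents `𝚲_{K a}` in the fused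
current. -/
noncomputable def coef (D : Data L) {n : ℕ} (K : Fin n → Fin L) : ℂ :=
  (∏ a, D.b (D.col (K a)) * D.u (K a)) *
    ∏ a : Fin n, ∏ b : Fin n, if a < b then D.weight (K a) (K b) (b - a) else 1

/-- The current `𝐓_n(z)`: a linear combination over all tuples `K` of the normally ordered products
`:𝚲_{K 0}(s_2 ^ (n - 1) z) ⋯ 𝚲_{K (n - 1)}(s_2 ^ (1 - n) z):`. -/
noncomputable def higher (D : Data L) (n : ℕ) : Current L :=
  ∑ K : Fin n → Fin L, D.coef K • vert (D.tupleNeg K) (D.tuplePos K)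

variable {D : Data L}

theorem castAdd_lt_natAdd {m n : ℕ} (a : Fin m) (b : Fin n) : Fin.castAdd n a < Fin.natAdd m b := by
  rw [Fin.lt_def, Fin.val_castAdd, Fin.val_natAdd]
  omega

/-- The pairs inside the two groups give the coefficients of the groups; the mixed pairs remain. -/
theorem coef_append {m n : ℕ} (I : Fin m → Fin L) (J : Fin n → Fin L) :
    D.coef (Fin.append I J) = D.coef I * D.coef J *
      ∏ c : Fin m × Fin n, D.weight (I c.1) (J c.2) (m + c.2 - c.1) := by
  unfold coef
  rw [Fin.prod_univ_add, Fin.prod_univ_add, Fintype.prod_prod_type]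
  have h1 : ∀ a : Fin m, (∏ b : Fin (m + n), if Fin.castAdd n a < b then
      D.weight (Fin.append I J (Fin.castAdd n a)) (Fin.append I J b) (b - Fin.castAdd n a : ℕ)
        else 1) = (∏ b : Fin m, if a < b then D.weight (I a) (I b) (b - a) else 1) *
      ∏ b : Fin n, D.weight (I a) (J b) (m + b - a) := by
    intro a
    rw [Fin.prod_univ_add]
    congr 1
    · refine Finset.prod_congr rfl fun b _ => ?_
      rw [Fin.append_left, Fin.append_left]
      rfl
    · refine Finset.prod_congr rfl fun b _ => ?_
      rw [if_pos (castAdd_lt_natAdd _ _), Fin.append_left, Fin.append_right]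
      rfl
  have h2 : ∀ a : Fin n, (∏ b : Fin (m + n), if Fin.natAdd m a < b then
      D.weight (Fin.append I J (Fin.natAdd m a)) (Fin.append I J b) (b - Fin.natAdd m a : ℕ)
        else 1) = ∏ b : Fin n, if a < b then D.weight (J a) (J b) (b - a) else 1 := by
    intro a
    rw [Fin.prod_univ_add, Finset.prod_eq_one, one_mul]
    · refine Finset.prod_congr rfl fun b _ => ?_
      rw [Fin.append_right, Fin.append_right]
      simp only [Fin.natAdd_lt_natAdd_iff, Fin.val_natAdd]
      rw [show m + (b : ℕ) - (m + a) = b - a by omega]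
    · intro b _
      rw [if_neg (castAdd_lt_natAdd _ _).not_gt]
  rw [Finset.prod_congr rfl fun a _ => h1 a, Finset.prod_congr rfl fun a _ => h2 a]
  simp only [Fin.append_left, Fin.append_right, Finset.prod_mul_distrib]
  ring

/-- The positions of `m + n` currents at `s_2 ^ m z` are those of `m` currents at `s_2 ^ (m + n) z`
followed by those of `n` currents at `z`. -/
theorem tupleNeg_append (hD : D.Generic) {m n : ℕ} (I : Fin m → Fin L) (J : Fin n → Fin L) :
    scale (D.s 1 ^ m) (D.tupleNeg (Fin.append I J)) =
      scale (D.s 1 ^ (m + n)) (D.tupleNeg I) + D.tupleNeg J := by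
  have hs := hD.s_ne 1
  simp only [tupleNeg, scale_sum, scale_scale]
  rw [Fin.sum_univ_add]
  congr 1
  · refine Finset.sum_congr rfl fun a _ => ?_
    rw [Fin.append_left, pos, pos, ← zpow_natCast, ← zpow_natCast, ← zpow_add₀ hs,
      ← zpow_add₀ hs, Fin.val_castAdd]
    congr 2
    push_cast
    ring
  · refine Finset.sum_congr rfl fun a _ => ?_
    rw [Fin.append_right, pos, pos, ← zpow_natCast, ← zpow_add₀ hs, Fin.val_natAdd]
    congr 2
    push_cast
    ring

theorem tuplePos_append (hD : D.Generic) {m n : ℕ} (I : Fin m → Fin L) (J : Fin n → Fin L) :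
    scale (D.s 1 ^ m)⁻¹ (D.tuplePos (Fin.append I J)) =
      scale (D.s 1 ^ (m + n))⁻¹ (D.tuplePos I) + D.tuplePos J := by
  have hs := hD.s_ne 1
  simp only [tuplePos, scale_sum, scale_scale, ← mul_inv]
  rw [Fin.sum_univ_add]
  congr 1
  · refine Finset.sum_congr rfl fun a _ => ?_
    rw [Fin.append_left, pos, pos, ← zpow_natCast, ← zpow_natCast, ← zpow_add₀ hs,
      ← zpow_add₀ hs, Fin.val_castAdd]
    congr 3
    push_cast
    ring
  · refine Finset.sum_congr rfl fun a _ => ?_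
    rw [Fin.append_right, pos, pos, ← zpow_natCast, ← zpow_add₀ hs, Fin.val_natAdd]
    congr 3
    push_cast
    ring

/-- The positions of `n + m` currents at `s_2 ^ (-m) z` are those of `n` currents at `z` followed by
those of `m` currents at `s_2 ^ (-(m + n)) z`. -/
theorem tupleNeg_append_inv (hD : D.Generic) {m n : ℕ} (I : Fin m → Fin L) (J : Fin n → Fin L) :
    scale (D.s 1 ^ m)⁻¹ (D.tupleNeg (Fin.append J I)) =
      scale (D.s 1 ^ (m + n))⁻¹ (D.tupleNeg I) + D.tupleNeg J := by
  have hs := hD.s_ne 1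
  simp only [tupleNeg, scale_sum, scale_scale]
  rw [Fin.sum_univ_add, add_comm]
  congr 1
  · refine Finset.sum_congr rfl fun a _ => ?_
    rw [Fin.append_right, pos, pos, ← zpow_natCast, ← zpow_natCast, ← zpow_neg, ← zpow_neg,
      ← zpow_add₀ hs, ← zpow_add₀ hs, Fin.val_natAdd]
    congr 2
    push_cast
    ring
  · refine Finset.sum_congr rfl fun a _ => ?_
    rw [Fin.append_left, pos, pos, ← zpow_natCast, ← zpow_neg, ← zpow_add₀ hs, Fin.val_castAdd]
    congr 2
    push_cast
    ring

theorem tuplePos_append_inv (hD : D.Generic) {m n : ℕ} (I : Fin m → Fin L) (J : Fin n → Fin L) :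
    scale (D.s 1 ^ m)⁻¹⁻¹ (D.tuplePos (Fin.append J I)) =
      scale (D.s 1 ^ (m + n))⁻¹⁻¹ (D.tuplePos I) + D.tuplePos J := by
  have hs := hD.s_ne 1
  simp only [tuplePos, scale_sum, scale_scale, ← mul_inv]
  rw [Fin.sum_univ_add, add_comm]
  congr 1
  · refine Finset.sum_congr rfl fun a _ => ?_
    rw [Fin.append_right, pos, pos, ← zpow_natCast, ← zpow_natCast, ← zpow_neg, ← zpow_neg,
      ← zpow_add₀ hs, ← zpow_add₀ hs, Fin.val_natAdd]
    congr 3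
    push_cast
    ring
  · refine Finset.sum_congr rfl fun a _ => ?_
    rw [Fin.append_left, pos, pos, ← zpow_natCast, ← zpow_neg, ← zpow_add₀ hs, Fin.val_castAdd]
    congr 3
    push_cast
    ring

theorem higher_comp (m n : ℕ) (x y : ℤ) (v : Fock L) :
    (D.higher m).1 x ((D.higher n).1 y v) =
      ∑ c : (Fin m → Fin L) × (Fin n → Fin L), (D.coef c.1 * D.coef c.2) •
        (vert (D.tupleNeg c.1) (D.tuplePos c.1)).1 x
          ((vert (D.tupleNeg c.2) (D.tuplePos c.2)).1 y v) := by
  have h : ∀ (n : ℕ) (y : ℤ) (w : Fock L), (D.higher n).1 y w = ∑ K : Fin n → Fin L,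
      D.coef K • (vert (D.tupleNeg K) (D.tuplePos K)).1 y w := by
    intro n y w
    rw [higher, Submodule.coe_sum, Finset.sum_apply, LinearMap.sum_apply]
    rfl
  rw [h n, map_sum, Fintype.sum_prod_type_right]
  refine Finset.sum_congr rfl fun J _ => ?_
  rw [map_smul, h m, Finset.smul_sum]
  refine Finset.sum_congr rfl fun I _ => ?_
  rw [smul_smul, mul_comm]

/-- The product of the weights of all pairs from two groups of currents, in terms of the constants
of the fusion relation. -/
theorem prod_pairVal (hD : D.Generic) {m n : ℕ} (hm : 1 ≤ m) (hn : 1 ≤ n) (I : Fin m → Fin L)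
    (J : Fin n → Fin L) :
    (∏ c : Fin m × Fin n, D.pairVal (I c.1) (J c.2) (m + c.2 - c.1)) *
        ∏ c ∈ Finset.range (min m n) ×ˢ Finset.range (max m n - 1),
          (D.dVal (c.1 + c.2 + 1))⁻¹ =
      -(D.cLam * ∏ l ∈ Finset.Icc 1 (min m n - 1), D.dVal l) *
        ∏ c : Fin m × Fin n, D.weight (I c.1) (J c.2) (m + c.2 - c.1) := by
  have hne : ∏ c ∈ Finset.range (min m n) ×ˢ Finset.range (max m n - 1),
      D.dVal (c.1 + c.2 + 1) ≠ 0 := Finset.prod_ne_zero_iff.2 fun c _ => dVal_ne hD (by omega)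
  have hN : ∏ c : Fin m × Fin n, D.normal (m + c.2 - c.1) ≠ 0 :=
    Finset.prod_ne_zero_iff.2 fun c _ => normal_ne hD (by have := c.1.2; omega)
  simp only [weight, Finset.prod_div_distrib, Finset.prod_inv_distrib]
  rw [mul_div_assoc', eq_div_iff hN, prod_normal hm hn]
  field_simp

/-- Each pair of tuples fuses to its concatenation, and the coefficients match by `coef_append` and
`prod_pairVal`. -/
theorem fusion_pos_higher (hD : D.Generic) {m n : ℕ} (hm : 1 ≤ m) (hn : 1 ≤ n) :
    IsFusionLimit (D.g m n) (D.x ^ (((m + n : ℕ) : ℂ) * D.lam 1)) (D.higher m) (D.higher n)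
      ((-(D.cLam * ∏ l ∈ Finset.Icc 1 (min m n - 1),
          D.dLam (D.x ^ (((2 * l + 1 : ℕ) : ℂ) * D.lam 1)))) •
        Current.rescale (D.x ^ ((m : ℂ) * D.lam 1)) (D.higher (m + n))) := by
  have hs := hD.s_ne 1
  have hp : D.x ^ (((m + n : ℕ) : ℂ) * D.lam 1) = D.s 1 ^ (m + n) := Complex.cpow_nat_mul _ _ _
  have hm' : D.x ^ ((m : ℂ) * D.lam 1) = D.s 1 ^ m := Complex.cpow_nat_mul _ _ _
  rw [hm']
  refine IsFusionLimit.sum Finset.univ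
    (fun c : (Fin m → Fin L) × (Fin n → Fin L) => D.coef c.1 * D.coef c.2)
    (fun c => vert (D.tupleNeg c.1) (D.tuplePos c.1))
    (fun c => vert (D.tupleNeg c.2) (D.tuplePos c.2)) _ _ _ _
    (fun c _ => isFusionLimit_vert (by rw [hp]; exact pow_ne_zero _ hs) _ _ _ _
      (isExpansion_tuple hD (by omega) c.1 c.2) (tendsto_tuple_pos hD hm hn c.1 c.2 hp)) ?_
    (higher_comp m n)
  rw [higher, rescale_sum, Finset.smul_sum, ← (Fin.appendEquiv m n).sum_comp]
  refine Finset.sum_congr rfl fun c _ => ?_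
  change _ • D.coef (Fin.append c.1 c.2) • Current.rescale _ (vert (D.tupleNeg (Fin.append c.1 c.2))
    (D.tuplePos (Fin.append c.1 c.2))) = _
  rw [rescale_vert (pow_ne_zero _ hs), tupleNeg_append hD, tuplePos_append hD, hp, smul_smul,
    smul_smul, coef_append, prod_pairVal hD hm hn]
  congr 1
  simp only [dVal]
  ring

/-- Here the second tuple comes first in the concatenation, and the sign of the residue changes. -/
theorem fusion_neg_higher (hD : D.Generic) {m n : ℕ} (hm : 1 ≤ m) (hn : 1 ≤ n) :
    IsFusionLimit (D.g m n) (D.x ^ (-(((m + n : ℕ) : ℂ) * D.lam 1))) (D.higher m) (D.higher n)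
      ((D.cLam * ∏ l ∈ Finset.Icc 1 (min m n - 1),
          D.dLam (D.x ^ (((2 * l + 1 : ℕ) : ℂ) * D.lam 1))) •
        Current.rescale (D.x ^ (-((m : ℂ) * D.lam 1))) (D.higher (m + n))) := by
  have hs := hD.s_ne 1
  have hp : D.x ^ (-(((m + n : ℕ) : ℂ) * D.lam 1)) = (D.s 1 ^ (m + n))⁻¹ := by
    rw [Complex.cpow_neg, Complex.cpow_nat_mul, s]
  have hm' : D.x ^ (-((m : ℂ) * D.lam 1)) = (D.s 1 ^ m)⁻¹ := by
    rw [Complex.cpow_neg, Complex.cpow_nat_mul, s]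
  rw [hm']
  refine IsFusionLimit.sum Finset.univ
    (fun c : (Fin m → Fin L) × (Fin n → Fin L) => D.coef c.1 * D.coef c.2)
    (fun c => vert (D.tupleNeg c.1) (D.tuplePos c.1))
    (fun c => vert (D.tupleNeg c.2) (D.tuplePos c.2)) _ _ _ _
    (fun c _ => isFusionLimit_vert (by rw [hp]; exact inv_ne_zero (pow_ne_zero _ hs)) _ _ _ _
      (isExpansion_tuple hD (by omega) c.1 c.2) (tendsto_tuple_neg hD hm hn c.1 c.2 hp)) ?_
    (higher_comp m n)
  have hcomm : D.higher (m + n) = D.higher (n + m) := by rw [Nat.add_comm]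
  rw [hcomm, higher, rescale_sum, Finset.smul_sum, ← (Fin.appendEquiv n m).sum_comp,
    ← (Equiv.prodComm _ _).sum_comp]
  refine Finset.sum_congr rfl fun c _ => ?_
  change _ • D.coef (Fin.append c.2 c.1) • Current.rescale _ (vert (D.tupleNeg (Fin.append c.2 c.1))
    (D.tuplePos (Fin.append c.2 c.1))) = _
  have hprod := prod_pairVal hD hn hm c.2 c.1
  rw [min_comm, max_comm, ← (Equiv.prodComm (Fin m) (Fin n)).prod_comp,
    ← (Equiv.prodComm (Fin m) (Fin n)).prod_comp] at hprod
  simp only [Equiv.prodComm_apply, Prod.fst_swap, Prod.snd_swap] at hprod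
  rw [rescale_vert (inv_ne_zero (pow_ne_zero _ hs)), tupleNeg_append_inv hD,
    tuplePos_append_inv hD, hp, smul_smul, smul_smul, coef_append, neg_mul, hprod,
    ← (Equiv.prodComm (Fin m) (Fin n)).prod_comp]
  congr 1
  simp only [dVal, Equiv.prodComm_apply, Prod.fst_swap, Prod.snd_swap]
  ring

theorem higher_zero : D.higher 0 = Current.id L := by
  rw [higher, Fintype.sum_unique, ← vert_zero]
  have h1 : ∀ K : Fin 0 → Fin L, D.coef K = 1 := fun K => by simp [coef]
  rw [h1, one_smul]
  congr 1

theorem higher_one : D.higher 1 = D.basic := by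
  rw [higher, basic, ← (Equiv.funUnique (Fin 1) (Fin L)).symm.sum_comp]
  refine Finset.sum_congr rfl fun i _ => ?_
  have hK : ∀ a : Fin 1, (Equiv.funUnique (Fin 1) (Fin L)).symm i a = i := fun _ => rfl
  have hpos : D.pos 1 0 = 1 := by simp [pos]
  have h1 : D.tupleNeg ((Equiv.funUnique (Fin 1) (Fin L)).symm i) = D.dressedNeg i := by
    simp only [tupleNeg, hK, Fin.sum_univ_one, Fin.val_zero, hpos, scale_one]
  have h2 : D.tuplePos ((Equiv.funUnique (Fin 1) (Fin L)).symm i) = D.barePos i + D.dressPos := by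
    simp only [tuplePos, hK, Fin.sum_univ_one, Fin.val_zero, hpos, inv_one, scale_one]
  have h3 : D.coef ((Equiv.funUnique (Fin 1) (Fin L)).symm i) = D.b (D.col i) * D.u i := by
    simp [coef]
  rw [h1, h2, h3, dressed_eq, smul_smul]

theorem isHigherCurrents_higher (hD : D.Generic) : IsHigherCurrents D D.higher where
  zero := higher_zero
  one := higher_one
  fusion_pos _ _ hi hj := fusion_pos_higher hD hi hj
  fusion_neg _ _ hi hj := fusion_neg_higher hD hi hj

theorem rescale_injective {ρ : ℂ} (hρ : ρ ≠ 0) :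
    Function.Injective (Current.rescale (L := L) ρ) := by
  intro A B h
  refine Subtype.ext (funext fun d => ?_)
  have h1 : ρ ^ (-d) • A.1 d = ρ ^ (-d) • B.1 d := congrFun (congrArg Subtype.val h) d
  exact smul_right_injective _ (zpow_ne_zero (-d) hρ) h1

/-- Fusion with the basic current determines every current from the preceding ones. -/
theorem isHigherCurrents_unique (hD : D.Generic) {T T' : ℕ → Current L} (hT : IsHigherCurrents D T)
    (hT' : IsHigherCurrents D T') : T' = T := by
  funext i
  induction i with
  | zero => rw [hT.zero, hT'.zero]
  | succ i ih =>
    rcases Nat.eq_zero_or_pos i with h0 | h0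
    · rw [h0, zero_add, hT.one, hT'.one]
    · have h1 := hT.fusion_pos 1 i le_rfl h0
      have h2 := hT'.fusion_pos 1 i le_rfl h0
      rw [ih, hT'.one, ← hT.one] at h2
      have h3 := h2.unique h1
      have hc : -(D.cLam * ∏ l ∈ Finset.Icc 1 (min 1 i - 1),
          D.dLam (D.x ^ (((2 * l + 1 : ℕ) : ℂ) * D.lam 1))) ≠ 0 := by
        have : min 1 i - 1 = 0 := by omega
        rw [this]
        simpa using cLam_ne hD
      have h4 := rescale_injective (fun h => hD.x_ne ((Complex.cpow_eq_zero_iff _ _).1 h).1)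
        (smul_right_injective _ hc h3)
      rwa [Nat.add_comm] at h4

end Data

section Vacuum

variable {L : ℕ}

/-! ### Matrix elements between the vacuum and the algebra of the `h_{-1}` -/

theorem one_mem_Fil : (1 : Fock L) ∈ Fil L 0 :=
  Submodule.subset_span ⟨0, by simp [energy], rfl⟩

/-- The vacuum is killed by all annihilation operators, so that only the creation part acts. -/
theorem vert_vacuum (n m : Fin L → ℕ+ → ℂ) (N : ℕ) :
    (vert n m).1 (-N) 1 = PowerSeries.coeff N (expSum fun r : ℕ+ =>
      (∑ j, n j r • MvPolynomial.X (j, r) : Fock L)) := by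
  have hc : creat n = fun r : ℕ+ => Algebra.lmul ℂ (Fock L)
      (∑ j, n j r • MvPolynomial.X (j, r)) := funext (creat_eq n)
  rw [vert, ordered_apply, finsum_eq_single _ (N : ℤ)]
  · rw [neg_add_cancel, coeffInt_natCast, ← Nat.cast_zero, coeffInt_natCast, coeff_zero_expSum,
      hc, expSum_map]
    simp
  · intro a ha
    rcases lt_or_gt_of_ne ha with h | h
    · rw [coeffInt_of_neg (show -(N : ℤ) + a < 0 by omega)]
      simp
    · rw [(annih_lowering m).coeffInt_eq_zero one_mem_Fil (by omega), map_zero]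

theorem coeff_expSum_single {A : Type*} [CommRing A] [Algebra ℂ A] (y : A) (N : ℕ) :
    PowerSeries.coeff N (expSum fun r : ℕ+ => if r = 1 then y else 0) =
      ((N.factorial : ℂ)⁻¹) • y ^ N := by
  have h : posSeries (fun r : ℕ+ => if r = 1 then y else 0) = PowerSeries.C y * PowerSeries.X := by
    ext k
    rw [posSeries, PowerSeries.coeff_mk, PowerSeries.coeff_C_mul, PowerSeries.coeff_X]
    by_cases hk : k = 1
    · subst hk
      simp [show (⟨1, one_pos⟩ : ℕ+) = 1 from rfl]
    · simp only [if_neg hk, mul_zero]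
      split_ifs with hr h
      · exact absurd (congrArg PNat.val h) hk
      · rfl
      · rfl
  rw [coeff_expSum _ (Nat.lt_succ_self N), h, Finset.sum_eq_single N]
  · rw [mul_pow, ← map_pow, PowerSeries.coeff_C_mul, PowerSeries.coeff_X_pow, if_pos rfl, mul_one]
  · intro k _ hk
    rw [mul_pow, ← map_pow, PowerSeries.coeff_C_mul, PowerSeries.coeff_X_pow, if_neg (Ne.symm hk),
      mul_zero, smul_zero]
  · simp

/-- The linear combination of the `h_{-1}` with the leading creation coefficients. -/
noncomputable def leading (n : Fin L → ℕ+ → ℂ) : Fock L :=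
  ∑ j, n j 1 • MvPolynomial.X (j, 1)

/-- The algebra map that kills `h_{-r}` for `r > 1`. -/
noncomputable def truncate (L : ℕ) : Fock L →ₐ[ℂ] Fock L :=
  MvPolynomial.aeval fun p => if p.2 = 1 then MvPolynomial.X p else 0

/-- On the vacuum, the vertex operator gives `exp (leading n * z)` modulo the `h_{-r}` with
`r > 1`. -/
theorem truncate_vert_vacuum (n m : Fin L → ℕ+ → ℂ) (N : ℕ) :
    truncate L ((vert n m).1 (-N) 1) = ((N.factorial : ℂ)⁻¹) • leading n ^ N := by
  rw [vert_vacuum, ← expSum_map, ← coeff_expSum_single]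
  congr 2
  funext r
  rw [map_sum]
  by_cases hr : r = 1
  · subst hr
    simp [truncate, leading]
  · simp [truncate, hr]

theorem leading_injective {n n' : Fin L → ℕ+ → ℂ} (h : leading n = leading n') (j : Fin L) :
    n j 1 = n' j 1 := by
  have hc : ∀ n : Fin L → ℕ+ → ℂ,
      MvPolynomial.coeff (Finsupp.single (j, 1) 1) (leading n) = n j 1 := by
    intro n
    classical
    rw [leading, MvPolynomial.coeff_sum, Finset.sum_eq_single j]
    · simp
    · intro b _ hb
      have : (Finsupp.single (b, (1 : ℕ+)) 1 : Fin L × ℕ+ →₀ ℕ) ≠ Finsupp.single (j, 1) 1 := by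
        rw [Ne, Finsupp.single_left_inj one_ne_zero]
        exact fun h => hb (congrArg Prod.fst h)
      rw [MvPolynomial.coeff_smul, MvPolynomial.coeff_X, if_neg this, smul_zero]
    · simp
  rw [← hc n, h, hc]

/-- Vertex operators with distinct leading creation coefficients are linearly independent: applied
to the vacuum, they produce the powers of distinct elements of an integral domain, which are
independent by Dedekind's theorem. -/
theorem sum_vert_ne_zero {ι : Type*} [Fintype ι] (c : ι → ℂ) (n m : ι → Fin L → ℕ+ → ℂ)
    (hinj : ∀ i i', c i ≠ 0 → c i' ≠ 0 → (∀ j, n i j 1 = n i' j 1) → i = i')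
    {i₀ : ι} (h₀ : c i₀ ≠ 0) : ∑ i, c i • vert (n i) (m i) ≠ 0 := by
  classical
  intro h
  let f : {i // c i ≠ 0} → Multiplicative ℕ →* Fock L := fun i => powersHom _ (leading (n i))
  have hf : Function.Injective f := fun i i' hii =>
    Subtype.ext (hinj i i' i.2 i'.2 (leading_injective ((powersHom _).injective hii)))
  have hli := (linearIndependent_monoidHom (Multiplicative ℕ) (Fock L)).comp f hf
  refine h₀ ?_
  have h0 := Fintype.linearIndependent_iff.1 hli (fun i => MvPolynomial.C (c i)) ?_ ⟨i₀, h₀⟩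
  · exact MvPolynomial.C_injective _ _ (h0.trans (map_zero _).symm)
  · funext N
    have h1 : truncate L ((∑ i, c i • vert (n i) (m i) : Current L).1
        (-(Multiplicative.toAdd N : ℕ)) 1) = 0 := by
      rw [h]
      exact map_zero _
    rw [Submodule.coe_sum, Finset.sum_apply, LinearMap.sum_apply, map_sum] at h1
    have h2 : ∀ i, truncate L ((c i • vert (n i) (m i) : Current L).1
        (-(Multiplicative.toAdd N : ℕ)) 1) = (((Multiplicative.toAdd N).factorial : ℂ)⁻¹) •
          (c i • leading (n i) ^ (Multiplicative.toAdd N)) := by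
      intro i
      rw [smul_comm, ← truncate_vert_vacuum (n i) (m i), ← map_smul]
      rfl
    rw [Finset.sum_congr rfl fun i _ => h2 i, ← Finset.smul_sum, smul_eq_zero_iff_right
      (inv_ne_zero (Nat.cast_ne_zero.2 (Nat.factorial_ne_zero _)))] at h1
    rw [Finset.sum_apply, Pi.zero_apply, ← h1,
      ← Finset.sum_subset (Finset.subset_univ (Finset.univ.filter fun i => c i ≠ 0)),
      Finset.sum_subtype (Finset.univ.filter fun i => c i ≠ 0) (p := fun i => c i ≠ 0) (by simp)]
    · refine Finset.sum_congr rfl fun i _ => ?_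
      rw [MvPolynomial.smul_eq_C_mul]
      rfl
    · intro i _ hi
      have : c i = 0 := by simpa using hi
      rw [this, zero_smul]

end Vacuum

namespace Data

variable {L : ℕ} {D : Data L}

/-! ### The coefficients of the fused currents -/

theorem one_sub_mul_inv_ne (hD : D.Generic) {c : Fin 3} (hc : c ≠ 1) (k : ℕ) :
    1 - D.q c * (D.q 1 ^ k)⁻¹ ≠ 0 := by
  have := one_sub_q_mul_zpow_ne hD hc (-(k : ℤ))
  rwa [zpow_neg, zpow_natCast] at this

theorem one_sub_inv_mul_inv_ne (hD : D.Generic) {c : Fin 3} (hc : c ≠ 1) (k : ℕ) :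
    1 - (D.q c)⁻¹ * (D.q 1 ^ k)⁻¹ ≠ 0 := by
  rw [← mul_inv, Ne, sub_eq_zero, eq_comm, inv_eq_one]
  have := hD.q_mul_zpow_ne hc k
  rwa [zpow_natCast] at this

/-- The zeros of `pairFn i j` for `i < j`, or for `i = j` of a colour other than the second one, are
not powers of `q_2`. -/
theorem weight_ne (hD : D.Generic) {i j : Fin L} (h : i < j ∨ i = j ∧ D.col i ≠ 1) {k : ℕ}
    (hk : 1 ≤ k) : D.weight i j k ≠ 0 := by
  have hq := hD.q_ne 1
  have hji : ¬ j < i := by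
    rcases h with h | h
    · exact h.not_gt
    · exact h.1.not_gt
  have hA : 1 - D.zeroA i j * (D.q 1 ^ k)⁻¹ ≠ 0 := by
    rw [zeroA, if_neg hji]
    rcases h with h | h
    · rw [if_pos h]
      exact one_sub_inv_mul_inv_ne hD (by decide) k
    · rw [if_neg h.1.not_lt]
      exact one_sub_mul_inv_ne hD h.2 k
  have hB : 1 - D.zeroB i j * (D.q 1 ^ k)⁻¹ ≠ 0 := by
    rw [zeroB, if_neg hji]
    rcases h with h | h
    · rw [if_pos h]
      exact one_sub_inv_mul_inv_ne hD (by decide) k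
    · rw [if_neg h.1.not_lt]
      exact one_sub_inv_mul_inv_ne hD h.2 k
  refine div_ne_zero ?_ (normal_ne hD hk)
  rw [pairVal]
  split_ifs with h1
  · subst h1
    rw [pow_one] at hA hB
    rw [res, if_neg hji]
    exact div_ne_zero (mul_ne_zero hA hB) (one_sub_poleB_ne hD i j)
  · refine div_ne_zero (mul_ne_zero hA hB) (mul_ne_zero ?_ ?_)
    · rw [poleA_eq, ← zpow_natCast, ← zpow_neg, ← zpow_add₀ hq]
      refine q_one_sub_zpow_ne hD ?_
      rw [if_neg hji]
      omega
    · rw [poleB_eq, ← zpow_natCast, ← zpow_neg, ← zpow_add₀ hq]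
      refine q_one_sub_zpow_ne hD ?_
      split_ifs <;> omega

/-- For `j < i` there is no pole to take the residue at, and for `i = j` of the second colour a zero
cancels it. -/
theorem weight_one_eq_zero (hD : D.Generic) {i j : Fin L}
    (h : ¬ (i < j ∨ i = j ∧ D.col i ≠ 1)) : D.weight i j 1 = 0 := by
  rw [weight, pairVal, if_pos rfl, div_eq_zero_iff]
  left
  rw [res]
  split_ifs with hji
  · rfl
  · have hij : i = j := le_antisymm (not_lt.1 hji) (not_lt.1 fun h' => h (Or.inl h'))
    subst hij
    have hc : D.col i = 1 := by
      by_contra hc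
      exact h (Or.inr ⟨rfl, hc⟩)
    rw [zeroA, if_neg (lt_irrefl _), if_neg (lt_irrefl _), hc, mul_inv_cancel₀ (hD.q_ne 1),
      sub_self, zero_mul, zero_div]

theorem coef_ne (hD : D.Generic) {n : ℕ} {K : Fin n → Fin L}
    (h : ∀ a b, a < b → K a < K b ∨ K a = K b ∧ D.col (K a) ≠ 1) : D.coef K ≠ 0 := by
  refine mul_ne_zero (Finset.prod_ne_zero_iff.2 fun a _ => mul_ne_zero (hD.b_ne _) (hD.u_ne _))
    (Finset.prod_ne_zero_iff.2 fun a _ => Finset.prod_ne_zero_iff.2 fun b _ => ?_)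
  split_ifs with hab
  · refine weight_ne hD (h a b hab) ?_
    have := Fin.lt_def.1 hab
    omega
  · exact one_ne_zero

/-- Adjacent entries of a tuple are at distance `1`, where the weight vanishes unless they increase,
or agree with a colour other than the second one. -/
theorem of_coef_ne (hD : D.Generic) {n : ℕ} {K : Fin (n + 1) → Fin L} (h : D.coef K ≠ 0)
    (a : Fin n) : K a.castSucc < K a.succ ∨ K a.castSucc = K a.succ ∧ D.col (K a.castSucc) ≠ 1 := by
  by_contra hc
  have h1 := Finset.prod_ne_zero_iff.1 (right_ne_zero_of_mul h) a.castSucc (Finset.mem_univ _)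
  have h2 := Finset.prod_ne_zero_iff.1 h1 a.succ (Finset.mem_univ _)
  rw [if_pos Fin.castSucc_lt_succ, Fin.val_succ, Fin.val_castSucc, Nat.add_sub_cancel_left] at h2
  exact h2 (weight_one_eq_zero hD hc)

theorem monotone_of_coef_ne (hD : D.Generic) {n : ℕ} {K : Fin n → Fin L} (h : D.coef K ≠ 0) :
    Monotone K := by
  rcases n with _ | n
  · exact fun a => a.elim0
  · refine Fin.monotone_iff_le_succ.2 fun a => ?_
    rcases of_coef_ne hD h a with h | h
    · exact h.le
    · exact h.1.le

theorem strictMono_of_coef_ne (hD : D.Generic) (hc : ∀ i, D.col i = 1) {n : ℕ}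
    {K : Fin n → Fin L} (h : D.coef K ≠ 0) : StrictMono K := by
  rcases n with _ | n
  · exact fun a => a.elim0
  · refine Fin.strictMono_iff_lt_succ.2 fun a => ?_
    rcases of_coef_ne hD h a with h | h
    · exact h
    · exact absurd (hc _) h.2

/-! ### Separation of the terms of a fused current -/

theorem tupleNeg_one {n : ℕ} (K : Fin n → Fin L) (j : Fin L) :
    D.tupleNeg K j 1 = D.kappa 1 / (1 - D.q (D.col j)) * D.a j *
      ∑ a ∈ Finset.univ.filter (fun a => K a = j), D.pos n a := by
  rw [tupleNeg, Finset.sum_apply, Finset.sum_apply, Finset.mul_sum, Finset.sum_filter]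
  refine Finset.sum_congr rfl fun a _ => ?_
  rw [scale, dressedNeg]
  split_ifs with h
  · subst h
    rw [PNat.one_coe, pow_one, pow_one, pow_one]
    ring
  · rw [mul_zero]

/-- A lower set of `Fin n` is the initial segment of its cardinality. -/
theorem mem_lower_iff {n : ℕ} {S : Finset (Fin n)} (hS : ∀ a b, a ≤ b → b ∈ S → a ∈ S)
    (a : Fin n) : a ∈ S ↔ (a : ℕ) < S.card := by
  constructor
  · intro ha
    have := Finset.card_le_card (fun b hb => hS b a (Finset.mem_Iic.1 hb) ha : Finset.Iic a ⊆ S)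
    rw [Fin.card_Iic] at this
    omega
  · intro ha
    by_contra hn
    have := Finset.card_le_card (fun b hb => Finset.mem_Iio.2 (not_le.1 fun hab =>
      hn (hS a b hab hb)) : S ⊆ Finset.Iio a)
    rw [Fin.card_Iio] at this
    omega

/-- The positions in an initial segment form a geometric progression of ratio `q_2⁻¹`. -/
theorem sum_pos_lower (hD : D.Generic) {n : ℕ} {S : Finset (Fin n)}
    (hS : ∀ a b, a ≤ b → b ∈ S → a ∈ S) :
    (∑ a ∈ S, D.pos n a) * (1 - (D.q 1)⁻¹) = D.s 1 ^ ((n : ℤ) - 1) * (1 - (D.q 1)⁻¹ ^ S.card) := by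
  have hs := hD.s_ne 1
  have hcard : S.card ≤ n := by simpa using Finset.card_le_univ S
  have h1 : ∑ a ∈ S, D.pos n a = ∑ a ∈ Finset.range S.card, D.pos n a := by
    have : S = Finset.univ.filter fun a : Fin n => (a : ℕ) < S.card := by
      ext a
      simp [mem_lower_iff hS a]
    conv_lhs => rw [this, Finset.sum_filter]
    rw [Fin.sum_univ_eq_sum_range (fun a => if a < S.card then D.pos n a else 0) n,
      ← Finset.sum_filter]
    refine Finset.sum_congr ?_ fun _ _ => rfl
    ext a
    simp only [Finset.mem_filter, Finset.mem_range]
    omega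
  have h2 : ∀ a : ℕ, D.pos n a = D.s 1 ^ ((n : ℤ) - 1) * (D.q 1)⁻¹ ^ a := by
    intro a
    rw [pos, hD.q_eq, ← inv_pow, ← pow_mul, inv_pow, ← zpow_natCast, ← zpow_neg, ← zpow_add₀ hs]
    congr 1
  rw [h1, Finset.sum_congr rfl fun a _ => h2 a, ← Finset.mul_sum, mul_assoc, geom_sum_mul_neg]

/-- A monotone tuple is determined by its leading creation coefficients: their partial sums over the
tensor factors are geometric sums, which determine how many entries of the tuple are at most
a given one. -/
theorem tuple_ext (hD : D.Generic) {n : ℕ} {K K' : Fin n → Fin L} (hK : Monotone K)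
    (hK' : Monotone K') (h : ∀ j, D.tupleNeg K j 1 = D.tupleNeg K' j 1) : K = K' := by
  have h1 : ∀ j, ∑ a ∈ Finset.univ.filter (fun a => K a = j), D.pos n a =
      ∑ a ∈ Finset.univ.filter (fun a => K' a = j), D.pos n a := by
    intro j
    have hj := h j
    rw [tupleNeg_one, tupleNeg_one] at hj
    refine mul_left_cancel₀ (mul_ne_zero (div_ne_zero (hD.kappa_ne 1) ?_) (hD.a_ne j)) hj
    simpa using hD.one_sub_q_pow_ne (D.col j) 1
  have h2 : ∀ (K : Fin n → Fin L) (i : Fin L), ∑ a ∈ Finset.univ.filter (fun a => K a ≤ i),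
      D.pos n a = ∑ j ∈ Finset.Iic i, ∑ a ∈ Finset.univ.filter (fun a => K a = j), D.pos n a := by
    intro K i
    rw [← Finset.sum_fiberwise_of_maps_to (g := K) (t := Finset.Iic i) (by simp)]
    refine Finset.sum_congr rfl fun j hj => Finset.sum_congr ?_ fun _ _ => rfl
    ext a
    simp only [Finset.mem_filter, Finset.mem_univ, true_and, Finset.mem_Iic] at hj ⊢
    exact ⟨fun h => h.2, fun h => ⟨h ▸ hj, h⟩⟩
  have h3 : ∀ {K : Fin n → Fin L}, Monotone K → ∀ (i : Fin L) (a b : Fin n), a ≤ b →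
      b ∈ Finset.univ.filter (fun a => K a ≤ i) → a ∈ Finset.univ.filter (fun a => K a ≤ i) := by
    intro K hK i a b hab hb
    simp only [Finset.mem_filter, Finset.mem_univ, true_and] at hb ⊢
    exact (hK hab).trans hb
  have h4 : ∀ i, (Finset.univ.filter fun a => K a ≤ i).card =
      (Finset.univ.filter fun a => K' a ≤ i).card := by
    intro i
    have e := sum_pos_lower hD (h3 hK i)
    rw [h2, Finset.sum_congr rfl fun j _ => h1 j, ← h2, sum_pos_lower hD (h3 hK' i)] at e
    have e' := sub_right_injective (mul_left_cancel₀ (zpow_ne_zero _ (hD.s_ne 1)) e)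
    rw [inv_pow, inv_pow, inv_inj, ← zpow_natCast, ← zpow_natCast] at e'
    by_contra hne
    refine hD.q_zpow_ne 1 (sub_ne_zero.2 (Nat.cast_injective (R := ℤ) |>.ne hne)) ?_
    rw [zpow_sub₀ (hD.q_ne 1), e', div_self (zpow_ne_zero _ (hD.q_ne 1))]
  have h5 : ∀ a i, K a ≤ i ↔ K' a ≤ i := by
    intro a i
    have e := mem_lower_iff (h3 hK i) a
    have e' := mem_lower_iff (h3 hK' i) a
    rw [h4, ← e'] at e
    simpa using e
  funext a
  exact le_antisymm ((h5 a _).2 le_rfl) ((h5 a _).1 le_rfl)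

theorem higher_ne_zero (hD : D.Generic) {n : ℕ} {K : Fin n → Fin L} (h : D.coef K ≠ 0) :
    D.higher n ≠ 0 :=
  sum_vert_ne_zero _ _ _ (fun _ _ h1 h2 => tuple_ext hD (monotone_of_coef_ne hD h1)
    (monotone_of_coef_ne hD h2)) h

/-- Repeating a current of a colour other than the second one contributes to every fusion. -/
theorem higher_ne_zero_of_col_ne (hD : D.Generic) {i : Fin L} (hi : D.col i ≠ 1) (n : ℕ) :
    D.higher n ≠ 0 :=
  higher_ne_zero hD (K := fun _ => i) (coef_ne hD fun _ _ _ => Or.inr ⟨rfl, hi⟩)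

/-- A strictly increasing tuple contributes. -/
theorem higher_ne_zero_of_le (hD : D.Generic) {n : ℕ} (hn : n ≤ L) : D.higher n ≠ 0 :=
  higher_ne_zero hD (K := Fin.castLE hn) (coef_ne hD fun _ _ h => Or.inl h)

/-- If all colours are the second one, only strictly increasing tuples contribute. -/
theorem higher_eq_zero (hD : D.Generic) (hc : ∀ i, D.col i = 1) {n : ℕ} (hn : L < n) :
    D.higher n = 0 := by
  refine Finset.sum_eq_zero fun K _ => ?_
  have h : D.coef K = 0 := by
    by_contra h
    have := Fintype.card_le_of_injective K (strictMono_of_coef_ne hD hc h).injective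
    rw [Fintype.card_fin, Fintype.card_fin] at this
    omega
  rw [h, zero_smul]

end Data
end QY

theorem proposition2 (L₁ L₂ L₃ : ℕ) (hL : 1 ≤ L₁ + L₂ + L₃)
    (D : QY.Data (L₁ + L₂ + L₃))
    (hx0 : 0 < ‖D.x‖) (hx1 : ‖D.x‖ < 1)
    (hlam : D.lam 0 + D.lam 1 + D.lam 2 = 0)
    (hgen : ∀ l m n : ℤ, D.q 0 ^ l * D.q 1 ^ m * D.q 2 ^ n = 1 → l = m ∧ m = n)
    (hmu : ∀ m : ℕ, 1 ≤ m → D.mu ^ m ≠ 1)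
    (hcol : ∀ c : Fin 3, (Finset.univ.filter fun i => D.col i = c).card = ![L₁, L₂, L₃] c)
    (hu : ∀ i, D.u i ≠ 0) :
    ∃ T : ℕ → QY.Current (L₁ + L₂ + L₃),
      QY.IsHigherCurrents D T ∧
      (∀ T' : ℕ → QY.Current (L₁ + L₂ + L₃), QY.IsHigherCurrents D T' → T' = T) ∧
      (1 ≤ L₁ + L₃ → ∀ i : ℕ, T i ≠ 0) ∧
      (L₁ + L₃ = 0 → ∀ i : ℕ, (i ≤ L₂ → T i ≠ 0) ∧ (L₂ < i → T i = 0)) := by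
  have hD : D.Generic := ⟨hx0, hx1, hlam, hgen, hmu, hu⟩
  have h0 : (Finset.univ.filter fun i => D.col i = 0).card = L₁ := hcol 0
  have h2 : (Finset.univ.filter fun i => D.col i = 2).card = L₃ := hcol 2
  have hT := QY.Data.isHigherCurrents_higher hD
  refine ⟨D.higher, hT, fun T' hT' => QY.Data.isHigherCurrents_unique hD hT hT', ?_, ?_⟩
  · intro h i
    obtain ⟨j, hj⟩ : ∃ j, D.col j ≠ 1 := by
      by_contra! hall
      have e0 : L₁ = 0 := by rw [← h0]; simp [hall]
      have e2 : L₃ = 0 := by rw [← h2]; simp [hall]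
      omega
    exact QY.Data.higher_ne_zero_of_col_ne hD hj i
  · intro h i
    refine ⟨fun hi => QY.Data.higher_ne_zero_of_le hD (by omega),
      fun hi => QY.Data.higher_eq_zero hD (fun j => ?_) (by omega)⟩
    have e0 := Finset.card_eq_zero.1 (h0.trans (by omega : L₁ = 0))
    have e2 := Finset.card_eq_zero.1 (h2.trans (by omega : L₃ = 0))
    have n0 : D.col j ≠ 0 := fun hj => by
      have : j ∈ Finset.univ.filter fun i => D.col i = 0 := by simpa using hj
      simp [e0] at this
    have n2 : D.col j ≠ 2 := fun hj => by
      have : j ∈ Finset.univ.filter fun i => D.col i = 2 := by simpa using hj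
      simp [e2] at this
    generalize D.col j = c at n0 n2
    fin_cases c
    · exact absurd rfl n0
    · rfl
    · exact absurd rfl n2
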